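/- Let $X_1,X_2,\dots$ be independent random variables with common density $f$ on $\mathbb R$, let $K$ be a kernel, and for $h>0$ put $$\hat f_h(x)=\frac1{nh}\sum_{i=1}^n K\Big(\frac{x-X_i}h\Big),\qquad CV(h)=\int \hat f_h^2(x)\,dx-\frac2n\sum_{i=1}^n\hat f_h^{\,i}(X_i),\qquad M(h)=E\int(\hat f_h(x)-f(x))^2\,dx ,$$ where $\hat f_h^{\,i}$ is the kernel estimate with bandwidth $h$ computed from the $n-1$ observations other than $X_i$. Let $h_{n,0}$ be a minimizer of $M$ over $(0,\infty)$. Suppose that $K$ is a probability density with $K(-u)=K(u)$ for all $u$, that the first two derivatives of $K$ exist everywhere, that $K(u)$ and $K'(u)$ are both $o(\exp(-a_1u^{a_2}))$ as $u\to\infty$ for some constants $a_1,a_2>0$, and that $u^2K''(u)$ is integrable. Suppose that the first three derivatives of $f$ exist and are bounded and continuous, and that $f''$ is square integrable. Put $L(u)=-uK'(u)$, $H(u)=-uL'(u)$, $A=K*K$, $B=K*L$, $C=L*L$, $D=K*H$ (convolutions), $V=A-B-K+L$, $W=3A+C-5B+D-2K+3L-H$, $\sigma_K^2=\int u^2K(u)\,du$,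 and $$B^*=\frac{8}{25}\,\frac{\int V(u)W(u)\,du\,\int f^2(x)\,dx}{\big[\int K^2(u)\,du\big]^{8/5}\big[\sigma_K^4\int (f''(x))^2\,dx\big]^{2/5}} .$$ Then $CV$ and $M$ are twice differentiable on $(0,\infty)$, $CV'(h)CV''(h)$ is integrable for every $h>0$, a minimizer $h_{n,0}$ exists for all large $n$, $B^*>0$, and for every choice of the minimizers $h_{n,0}$, as $n\to\infty$, $$\frac{E\left[CV'(h_{n,0})\,CV''(h_{n,0})\right]}{M''(h_{n,0})^2}=-B^*n^{-2/5}+o(n^{-2/5}) .$$ -/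

import Mathlib

open MeasureTheory ProbabilityTheory Filter Asymptotics

namespace KernelCV

noncomputable section

/-- `g` is a probability density on the real line. -/
structure IsDensity (g : ℝ → ℝ) : Prop where
  nonneg : ∀ x, 0 ≤ g x
  integrable : Integrable g
  integral_eq_one : ∫ x, g x = 1

/-- The kernel density estimate at `t` with kernel `K` and bandwidth `h`
from the sample `x 0, …, x (n-1)`. -/
def kde (K : ℝ → ℝ) {n : ℕ} (x : Fin n → ℝ) (h t : ℝ) : ℝ :=
  1 / ((n : ℝ) * h) * ∑ j, K ((t - x j) / h)

/-- The kernel density estimate at `t` computed from the `n - 1` observations other than `x i`. -/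
def kdeLeaveOut (K : ℝ → ℝ) {n : ℕ} (x : Fin n → ℝ) (i : Fin n) (h t : ℝ) : ℝ :=
  1 / (((n : ℝ) - 1) * h) * ∑ j ∈ Finset.univ.erase i, K ((t - x j) / h)

/-- The leave-one-out cross-validation criterion as a function of the bandwidth. -/
def CV (K : ℝ → ℝ) {n : ℕ} (x : Fin n → ℝ) (h : ℝ) : ℝ :=
  (∫ t, kde K x h t ^ 2) - 2 / (n : ℝ) * ∑ i, kdeLeaveOut K x i h (x i)

/-- The integrated squared error of the kernel density estimate of `f`. -/
def ISE (K f : ℝ → ℝ) {n : ℕ} (x : Fin n → ℝ) (h : ℝ) : ℝ :=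
  ∫ t, (kde K x h t - f t) ^ 2

/-- The first `n` observations. -/
def sample {Ω : Type*} (X : ℕ → Ω → ℝ) (n : ℕ) (ω : Ω) : Fin n → ℝ := fun i => X i ω

/-- The mean integrated squared error for sample size `n`, as a function of the bandwidth. -/
def MISE {Ω : Type*} [MeasurableSpace Ω] (P : Measure Ω) (X : ℕ → Ω → ℝ) (K f : ℝ → ℝ)
    (n : ℕ) (h : ℝ) : ℝ :=
  ∫ ω, ISE K f (sample X n ω) h ∂P

/-- `h` is an optimal bandwidth for the criterion `M`: a global minimizer over `(0, ∞)`. -/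
def IsOptimalBandwidth (M : ℝ → ℝ) (h : ℝ) : Prop :=
  0 < h ∧ IsMinOn M (Set.Ioi 0) h

/-- `L(u) = -u K'(u)`. -/
def kerL (K : ℝ → ℝ) (u : ℝ) : ℝ := -u * deriv K u

/-- `H(u) = -u L'(u)`. -/
def kerH (K : ℝ → ℝ) (u : ℝ) : ℝ := -u * deriv (kerL K) u

/-- Convolution on the line, `(p * q)(x) = ∫ p(x - u) q(u) du`. -/
def conv (p q : ℝ → ℝ) (x : ℝ) : ℝ := ∫ u, p (x - u) * q u

/-- `V = A - B - K + L` with `A = K * K` and `B = K * L`. -/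
def kerV (K : ℝ → ℝ) (u : ℝ) : ℝ :=
  conv K K u - conv K (kerL K) u - K u + kerL K u

/-- `W = 3A + C - 5B + D - 2K + 3L - H` with `A = K * K`, `B = K * L`, `C = L * L`,
`D = K * H`. -/
def kerW (K : ℝ → ℝ) (u : ℝ) : ℝ :=
  3 * conv K K u + conv (kerL K) (kerL K) u - 5 * conv K (kerL K) u + conv K (kerH K) u
    - 2 * K u + 3 * kerL K u - kerH K u

/-- The constant
`B* = (8/25) ∫VW ∫f² / ([∫K²]^(8/5) [σ_K⁴ ∫(f'')²]^(2/5))`, where `σ_K² = ∫ u² K(u) du`. -/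
def BStar (K f : ℝ → ℝ) : ℝ :=
  8 / 25 * ((∫ u, kerV K u * kerW K u) * ∫ x, f x ^ 2) /
    ((∫ u, K u ^ 2) ^ (8 / 5 : ℝ) *
      ((∫ u, u ^ 2 * K u) ^ 2 * ∫ x, deriv (deriv f) x ^ 2) ^ (2 / 5 : ℝ))

end

end KernelCV

open KernelCV

/-! By symmetry of `K`, CV(h) is A(0)/(nh) plus 2/(n(n-1)) times the sum over ordered pairs i ≠ j of
h⁻¹G((X_i - X_j)/h), where G = `pairKernel K n` is A/2 - K up to a term of order 1/n (`CV_eq`). One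
and two derivatives of h⁻¹G(d/h) in h give -h⁻² `opV G` and h⁻³ `opW G` at d/h, and for G = A/2 - K
these operators produce exactly V and W (`kerV_eq`, `kerW_eq`). So CV' and CV'' are affine functions
of pair sums.

The mean of CV'(h) is M'(h), which vanishes at a minimizer, so E[CV'CV''] there is a covariance. Two
pairs of indices without a common index contribute nothing. Equal or swapped pairs give the leading
term -8/(n²h⁴) ∫VW ∫f². Pairs with one common index are controlled by the conditional means given
the shared observation. Up to a factor h these are O(h²) for CV'' and, because A/2 - K has vanishing
second moment, O(h³ + h²/n) for CV'. After multiplication by n²h⁴ the shared pairs amount to O(nh⁶ +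
h⁵), which is negligible when nh⁵ converges (`abs_integral_deriv_CV_mul_le`,
`tendsto_mul_integral_deriv_CV`).

For M itself, let r(s) = ∫ f(y+s) f(y) dy. Then M(h) = A(0)/(nh) - a(h)/n + b(h), with a and the
squared bias b integrals of kernels against r(hu) (`MISE_eq_risk`). All derivatives in h fall on r,
and b''(h)/h² → 3β with β = σ_K⁴∫(f'')² (`tendsto_sq_bias_deriv2`). Moreover b > 0 off zero, since a
density is not periodic (`sq_bias_pos`). These facts, collected in `RiskProfile`, yield existence of
minimizers, their convergence to 0, nh⁵ → A(0)/β and nh³M''(h) → 5A(0). Dividing the two limits and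
removing h through (nh⁵)^(2/5) = n^(2/5)h² gives the expansion (`isLittleO_deriv_CV`).

Positivity of the constant comes from W = 2V + uV', whence ∫VW = (3/2)∫V². -/

namespace KernelCV

open scoped Topology

/-! ### Rapidly decreasing functions -/

/-- Continuous functions that decay faster than any power. -/
structure RapidDecay (p : ℝ → ℝ) : Prop where
  cont : Continuous p
  decay : ∀ k : ℕ, ∃ C, ∀ x, |x| ^ k * |p x| ≤ C

namespace RapidDecay

variable {p q : ℝ → ℝ}

theorem bounded (hp : RapidDecay p) : ∃ C, 0 ≤ C ∧ ∀ x, |p x| ≤ C := by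
  obtain ⟨C, hC⟩ := hp.decay 0
  refine ⟨C, ?_, fun x => by simpa using hC x⟩
  have := hC 0
  simp at this
  exact (abs_nonneg _).trans this

theorem add (hp : RapidDecay p) (hq : RapidDecay q) : RapidDecay fun x => p x + q x := by
  refine ⟨hp.cont.add hq.cont, fun k => ?_⟩
  obtain ⟨C, hC⟩ := hp.decay k
  obtain ⟨D, hD⟩ := hq.decay k
  refine ⟨C + D, fun x => ?_⟩
  have h1 : |x| ^ k * |p x + q x| ≤ |x| ^ k * (|p x| + |q x|) := by
    gcongr; exact abs_add_le _ _
  linarith [hC x, hD x, mul_add (|x| ^ k) |p x| |q x|]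

theorem const_mul (hp : RapidDecay p) (c : ℝ) : RapidDecay fun x => c * p x := by
  refine ⟨hp.cont.const_mul c, fun k => ?_⟩
  obtain ⟨C, hC⟩ := hp.decay k
  refine ⟨|c| * C, fun x => ?_⟩
  calc |x| ^ k * |c * p x| = |c| * (|x| ^ k * |p x|) := by rw [abs_mul]; ring
    _ ≤ _ := by gcongr; exact hC x

theorem neg (hp : RapidDecay p) : RapidDecay fun x => -p x := by
  simpa using hp.const_mul (-1)

theorem sub (hp : RapidDecay p) (hq : RapidDecay q) : RapidDecay fun x => p x - q x := by
  simpa [sub_eq_add_neg] using hp.add hq.neg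

theorem id_mul (hp : RapidDecay p) : RapidDecay fun x => x * p x := by
  refine ⟨continuous_id.mul hp.cont, fun k => ?_⟩
  obtain ⟨C, hC⟩ := hp.decay (k + 1)
  refine ⟨C, fun x => ?_⟩
  have := hC x
  rw [abs_mul]
  calc _ = |x| ^ (k + 1) * |p x| := by ring
    _ ≤ C := this

theorem pow_mul (hp : RapidDecay p) (m : ℕ) : RapidDecay fun x => x ^ m * p x := by
  induction m with
  | zero => simpa using hp
  | succ m ih =>
    have h1 : (fun x => x ^ (m + 1) * p x) = fun x => x * (x ^ m * p x) := by
      ext x; ring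
    rw [h1]
    exact ih.id_mul

theorem abs (hp : RapidDecay p) : RapidDecay fun x => |p x| :=
  ⟨hp.cont.abs, fun k => by simpa using hp.decay k⟩

theorem abs_pow_mul (hp : RapidDecay p) (m : ℕ) : RapidDecay fun x => |x| ^ m * p x := by
  refine ⟨(continuous_abs.pow m).mul hp.cont, fun k => ?_⟩
  obtain ⟨C, hC⟩ := (hp.pow_mul m).decay k
  exact ⟨C, fun x => by simpa [abs_mul, abs_pow] using hC x⟩

theorem integrable (hp : RapidDecay p) : Integrable p := by
  obtain ⟨C, hC⟩ := hp.decay 0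
  obtain ⟨D, hD⟩ := hp.decay 2
  refine (integrable_inv_one_add_sq.const_mul (C + D)).mono' hp.cont.aestronglyMeasurable
    (ae_of_all _ fun x => ?_)
  have h1 := hC x
  have h2 := hD x
  simp only [pow_zero, one_mul, sq_abs] at h1 h2
  rw [Real.norm_eq_abs, ← div_eq_mul_inv, le_div_iff₀ (by positivity)]
  linarith

theorem mul (hp : RapidDecay p) (hq : RapidDecay q) : RapidDecay fun x => p x * q x := by
  refine ⟨hp.cont.mul hq.cont, fun k => ?_⟩
  obtain ⟨C, hC⟩ := hp.decay k
  obtain ⟨D, hD0, hD⟩ := hq.bounded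
  refine ⟨C * D, fun x => ?_⟩
  rw [abs_mul, ← mul_assoc]
  exact mul_le_mul (hC x) (hD x) (abs_nonneg _) ((by positivity : (0:ℝ) ≤ _).trans (hC x))

theorem integrable_mul_bdd (hp : RapidDecay p) {φ : ℝ → ℝ} (hφ : Measurable φ) {C : ℝ}
    (hC : ∀ x, |φ x| ≤ C) : Integrable fun x => p x * φ x :=
  hp.integrable.mul_bdd hφ.aestronglyMeasurable (ae_of_all _ hC)

theorem integrable_conv (hp : RapidDecay p) (hq : Integrable q) (x : ℝ) :
    Integrable fun u => p (x - u) * q u := by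
  obtain ⟨C, -, hC⟩ := hp.bounded
  exact hq.bdd_mul (hp.cont.comp (continuous_const.sub continuous_id)).aestronglyMeasurable
    (ae_of_all _ fun u => hC _)

theorem continuous_conv (hp : RapidDecay p) (hq : RapidDecay q) : Continuous (conv p q) := by
  obtain ⟨C, -, hC⟩ := hp.bounded
  refine continuous_of_dominated (bound := fun u => C * |q u|) ?_ ?_ ?_ ?_
  · exact fun x => (hp.integrable_conv hq.integrable x).aestronglyMeasurable
  · refine fun x => ae_of_all _ fun u => ?_
    rw [Real.norm_eq_abs, abs_mul]
    gcongr; exact hC _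
  · exact hq.integrable.abs.const_mul C
  · exact ae_of_all _ fun u => by
      have := hp.cont
      fun_prop

/-- From |x|^k ≤ 2^k(|x-u|^k + |u|^k), the weight can be given to whichever factor has the matching
argument. -/
theorem conv (hp : RapidDecay p) (hq : RapidDecay q) : RapidDecay (conv p q) := by
  refine ⟨hp.continuous_conv hq, fun k => ?_⟩
  obtain ⟨C, hC0, hC⟩ := hp.bounded
  obtain ⟨D, hD⟩ := hp.decay k
  refine ⟨∫ u, 2 ^ k * (D * |q u| + C * (|u| ^ k * |q u|)), fun x => ?_⟩
  have hi : Integrable fun u => 2 ^ k * (D * |q u| + C * (|u| ^ k * |q u|)) :=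
    ((hq.abs.integrable.const_mul D).add
      ((hq.abs.abs_pow_mul k).integrable.const_mul C)).const_mul _
  calc |x| ^ k * |KernelCV.conv p q x| = |∫ u, x ^ k * (p (x - u) * q u)| := by
        rw [KernelCV.conv, integral_const_mul, abs_mul, abs_pow]
    _ ≤ ∫ u, |x ^ k * (p (x - u) * q u)| := abs_integral_le_integral_abs
    _ ≤ _ := by
      refine integral_mono ((hp.integrable_conv hq.integrable x).const_mul _).abs hi fun u => ?_
      have h1 : |x| ^ k ≤ 2 ^ k * (|x - u| ^ k + |u| ^ k) := by
        have h2 : |x| ≤ 2 * max |x - u| |u| := by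
          have : |x| ≤ |x - u| + |u| := by simpa using abs_add_le (x - u) u
          linarith [le_max_left |x - u| |u|, le_max_right |x - u| |u|]
        calc |x| ^ k ≤ (2 * max |x - u| |u|) ^ k := by gcongr
          _ = 2 ^ k * (max |x - u| |u|) ^ k := by rw [_root_.mul_pow]
          _ ≤ _ := by
            gcongr
            rcases max_cases |x - u| |u| with h | h <;> rw [h.1] <;>
              linarith [pow_nonneg (abs_nonneg (x - u)) k, pow_nonneg (abs_nonneg u) k]
      simp only [abs_mul, abs_pow]
      calc |x| ^ k * (|p (x - u)| * |q u|)
          ≤ 2 ^ k * (|x - u| ^ k + |u| ^ k) * (|p (x - u)| * |q u|) := by gcongr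
        _ = 2 ^ k * ((|x - u| ^ k * |p (x - u)|) * |q u|
              + |p (x - u)| * (|u| ^ k * |q u|)) := by ring
        _ ≤ _ := by
          gcongr
          · exact hD _
          · exact hC _

/-- The substitution v = u^b shows that the stretched exponential beats every power; compactness
covers the remaining bounded interval. Symmetry is asked of |p| only, so that the result serves both
the even `K` and the odd `deriv K`. -/
theorem of_even_of_isLittleO (hc : Continuous p) (he : ∀ x, |p (-x)| = |p x|) {a b : ℝ}
    (ha : 0 < a) (hb : 0 < b) (h : p =o[atTop] fun u : ℝ => Real.exp (-a * u ^ b)) :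
    RapidDecay p := by
  refine ⟨hc, fun k => ?_⟩
  have h1 : Tendsto (fun u : ℝ => u ^ k * Real.exp (-a * u ^ b)) atTop (nhds 0) := by
    have h2 := (tendsto_rpow_mul_exp_neg_mul_atTop_nhds_zero (k / b) a ha).comp
      (tendsto_rpow_atTop hb)
    refine h2.congr' ?_
    filter_upwards [eventually_gt_atTop 0] with u hu
    simp only [Function.comp]
    rw [← Real.rpow_mul hu.le, mul_div_cancel₀ _ hb.ne', Real.rpow_natCast]
  have h3 : ∀ᶠ u : ℝ in atTop, |u| ^ k * |p u| ≤ 1 := by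
    filter_upwards [h.bound one_pos, h1.eventually_le_const one_pos, eventually_gt_atTop 0]
      with u h4 h5 h6
    simp only [Real.norm_eq_abs, one_mul, Real.abs_exp] at h4
    rw [abs_of_pos h6]
    exact (mul_le_mul_of_nonneg_left h4 (by positivity)).trans h5
  obtain ⟨T, hT⟩ := eventually_atTop.1 h3
  obtain ⟨C, hC⟩ := (isCompact_Icc (a := (0:ℝ)) (b := T)).bddAbove_image
    (f := fun u => |u| ^ k * |p u|) (by fun_prop)
  have h7 : ∀ u, 0 ≤ u → |u| ^ k * |p u| ≤ max C 1 := fun u hu => by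
    rcases le_total u T with h8 | h8
    · exact (hC ⟨u, ⟨hu, h8⟩, rfl⟩).trans (le_max_left _ _)
    · exact (hT u h8).trans (le_max_right _ _)
  refine ⟨max C 1, fun x => ?_⟩
  rcases le_total 0 x with hx | hx
  · exact h7 x hx
  · simpa [he] using h7 (-x) (by linarith)

end RapidDecay

/-! ### Calculus of convolutions -/

theorem conv_comm (p q : ℝ → ℝ) : conv p q = conv q p := by
  ext x
  have := integral_sub_left_eq_self (fun u => q (x - u) * p u) volume x
  simp only [sub_sub_cancel] at this
  rw [conv, conv, ← this]
  exact integral_congr_ae (ae_of_all _ fun u => mul_comm _ _)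

theorem hasDerivAt_conv {p p' q : ℝ → ℝ} (hp : RapidDecay p) (hp' : RapidDecay p')
    (hd : ∀ x, HasDerivAt p (p' x) x) (hq : RapidDecay q) (x : ℝ) :
    HasDerivAt (conv p q) (conv p' q x) x := by
  obtain ⟨C, -, hC⟩ := hp'.bounded
  refine (hasDerivAt_integral_of_dominated_loc_of_deriv_le (bound := fun u => C * |q u|)
    (F' := fun x u => p' (x - u) * q u) (s := Set.univ) univ_mem ?_ ?_ ?_ ?_ ?_ ?_).2
  · exact Eventually.of_forall fun x => (hp.integrable_conv hq.integrable x).aestronglyMeasurable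
  · exact hp.integrable_conv hq.integrable x
  · exact (hp'.integrable_conv hq.integrable x).aestronglyMeasurable
  · refine ae_of_all _ fun u y _ => ?_
    rw [Real.norm_eq_abs, abs_mul]
    gcongr; exact hC _
  · exact hq.integrable.abs.const_mul C
  · exact ae_of_all _ fun u y _ => ((hd (y - u)).comp_sub_const y u).mul_const _

/-- `∫ (u G)' q = -∫ u G q'`. -/
theorem integral_deriv_id_mul {G G' q q' : ℝ → ℝ} {C C' : ℝ} (hG : RapidDecay G)
    (hd : ∀ u, HasDerivAt G (G' u) u) (hi : Integrable fun u => u * G' u)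
    (hq : ∀ u, HasDerivAt q (q' u) u) (hqC : ∀ u, |q u| ≤ C) (hqC' : ∀ u, |q' u| ≤ C') :
    ∫ u, (G u + u * G' u) * q u = -∫ u, u * G u * q' u := by
  have hqm : Measurable q :=
    (continuous_iff_continuousAt.2 fun u => (hq u).continuousAt).measurable
  have hqm' : Measurable q' := by
    have : q' = deriv q := funext fun u => (hq u).deriv.symm
    rw [this]; exact measurable_deriv q
  have hsum : Integrable fun u => G u + u * G' u := hG.integrable.add hi
  have := integral_mul_deriv_eq_deriv_mul_of_integrable (u := fun u => u * G u)
    (u' := fun u => G u + u * G' u) (v := q) (v' := q')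
    (fun u _ => ((hasDerivAt_id' u).mul (hd u)).congr_deriv (by simp)) (fun u _ => hq u)
    (hG.id_mul.integrable_mul_bdd hqm' hqC')
    (hsum.mul_bdd hqm.aestronglyMeasurable (ae_of_all _ hqC))
    (hG.id_mul.integrable_mul_bdd hqm hqC)
  rw [this, neg_neg]

theorem integral_eq_zero_of_odd {φ : ℝ → ℝ} (h : ∀ u, φ (-u) = -φ u) : ∫ u, φ u = 0 := by
  have h1 := integral_neg_eq_self φ volume
  simp only [h, integral_neg] at h1
  linarith

/-- `x (p * q) = (u p) * q + p * (u q)`. -/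
theorem mul_conv {p q : ℝ → ℝ} (hp : RapidDecay p) (hq : Integrable q)
    (hq' : Integrable fun u => u * q u) (x : ℝ) :
    x * conv p q x = conv (fun u => u * p u) q x + conv p (fun u => u * q u) x := by
  rw [conv, conv, conv, ← integral_add (hp.id_mul.integrable_conv hq x) (hp.integrable_conv hq' x),
    ← integral_const_mul]
  congr 1 with u
  ring

/-- Integration by parts. Mere integrability of q' matters for q = uL, whose derivative contains
K'', a function not assumed bounded. -/
theorem conv_deriv_left {p p' q q' : ℝ → ℝ} (hp : RapidDecay p) (hp' : RapidDecay p')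
    (hd : ∀ x, HasDerivAt p (p' x) x) (hq : RapidDecay q) (hq' : Integrable q')
    (hdq : ∀ x, HasDerivAt q (q' x) x) : conv p' q = conv p q' := by
  ext x
  have := integral_mul_deriv_eq_deriv_mul_of_integrable (u := fun u => p (x - u))
    (u' := fun u => -p' (x - u)) (v := q) (v' := q')
    (fun u _ => by simpa using (hd (x - u)).comp_const_sub x u) (fun u _ => hdq u)
    (hp.integrable_conv hq' x)
    ((hp'.integrable_conv hq.integrable x).neg.congr (ae_of_all _ fun u => by simp))
    (hp.integrable_conv hq.integrable x)
  rw [conv, conv, this, ← integral_neg]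
  simp

theorem conv_even {p q : ℝ → ℝ} (hp : ∀ u, p (-u) = p u) (hq : ∀ u, q (-u) = q u) (x : ℝ) :
    conv p q (-x) = conv p q x := by
  rw [conv, conv, ← integral_neg_eq_self]
  congr 1 with u
  rw [hq, ← hp]
  congr 2
  ring

/-- Fubini after the shear w = a + u. Growth of order four is allowed because the bias expansion
needs fourth moments of K * K. -/
theorem integral_mul_conv {p q φ : ℝ → ℝ} (hp : RapidDecay p) (hq : RapidDecay q)
    (hφ : Measurable φ) {C : ℝ} (hC : ∀ w, |φ w| ≤ C * (1 + w ^ 4)) :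
    ∫ w, φ w * conv p q w = ∫ u, q u * ∫ a, φ (a + u) * p a := by
  have hC0 : 0 ≤ C := by simpa using (abs_nonneg _).trans (hC 0)
  have hpm := hp.cont.measurable
  have hqm := hq.cont.measurable
  have hint : Integrable (fun z : ℝ × ℝ => q z.2 * (φ (z.1 + z.2) * p z.1))
      (volume.prod volume) := by
    have h1 : Integrable (fun z : ℝ × ℝ => C * (8 * (|p z.1| * |q z.2|
        + |z.1| ^ 4 * |p z.1| * |q z.2| + |p z.1| * (|z.2| ^ 4 * |q z.2|)))) :=
      ((((hp.abs.integrable.mul_prod hq.abs.integrable).add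
        ((hp.abs.abs_pow_mul 4).integrable.mul_prod hq.abs.integrable)).add
        (hp.abs.integrable.mul_prod (hq.abs.abs_pow_mul 4).integrable)).const_mul 8).const_mul C
    refine h1.mono' (by fun_prop) (ae_of_all _ fun z => ?_)
    obtain ⟨a, u⟩ := z
    simp only [Real.norm_eq_abs, abs_mul]
    -- The 8 comes from (a + u)⁴ ≤ 8(a⁴ + u⁴).
    have h2 : |φ (a + u)| ≤ C * (8 * (1 + |a| ^ 4 + |u| ^ 4)) := by
      refine (hC _).trans (mul_le_mul_of_nonneg_left ?_ hC0)
      have e1 : |a| ^ 4 = a ^ 4 := by rw [← abs_pow, abs_of_nonneg (by positivity)]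
      have e2 : |u| ^ 4 = u ^ 4 := by rw [← abs_pow, abs_of_nonneg (by positivity)]
      rw [e1, e2]
      nlinarith [sq_nonneg (a - u), sq_nonneg (a ^ 2 - u ^ 2), sq_nonneg (a + u),
        mul_nonneg (sq_nonneg (a - u)) (sq_nonneg (a - u)),
        mul_nonneg (sq_nonneg (a - u)) (sq_nonneg (a + u)), sq_nonneg (a*u)]
    calc |q u| * (|φ (a + u)| * |p a|)
        ≤ |q u| * (C * (8 * (1 + |a| ^ 4 + |u| ^ 4)) * |p a|) := by gcongr
      _ = _ := by ring
  have hint2 : Integrable (fun z : ℝ × ℝ => φ z.1 * (p (z.1 - z.2) * q z.2))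
      (volume.prod volume) := by
    have := (measurePreserving_sub_prod (volume : Measure ℝ) (volume : Measure ℝ)).integrable_comp
      hint.aestronglyMeasurable |>.2 hint
    refine this.congr (ae_of_all _ fun z => ?_)
    simp only [Function.comp, sub_add_cancel]
    ring
  calc ∫ w, φ w * conv p q w = ∫ w, ∫ u, φ w * (p (w - u) * q u) := by
        simp only [conv, integral_const_mul]
    _ = ∫ u, ∫ w, φ w * (p (w - u) * q u) := integral_integral_swap hint2
    _ = ∫ u, ∫ a, φ (a + u) * (p a * q u) := by
        congr 1 with u
        rw [← integral_add_right_eq_self _ u]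
        simp
    _ = _ := by
        congr 1 with u
        rw [← integral_const_mul]
        congr 1 with a
        ring

/-! ### Kernels differentiated in the bandwidth -/

theorem hasDerivAt_neg_inv_sq {h : ℝ} (hh : h ≠ 0) :
    HasDerivAt (fun h : ℝ => -(h ^ 2)⁻¹) (2 * (h ^ 3)⁻¹) h := by
  refine ((hasDerivAt_pow 2 h).inv (pow_ne_zero 2 hh)).neg.congr_deriv ?_
  field_simp
  norm_num
  ring

/-- The kernels that occur in the cross-validation criterion. -/
structure Admissible (G : ℝ → ℝ) : Prop where
  even : ∀ u, G (-u) = G u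
  diff : Differentiable ℝ G
  diff' : Differentiable ℝ (deriv G)
  rapid : RapidDecay G
  rapid' : RapidDecay (deriv G)
  int : Integrable fun u => u ^ 2 * deriv (deriv G) u

/-- `(u G)'`. -/
noncomputable def opV (G : ℝ → ℝ) (u : ℝ) : ℝ := G u + u * deriv G u

/-- `(u (G + (u G)'))'`. -/
noncomputable def opW (G : ℝ → ℝ) (u : ℝ) : ℝ :=
  2 * G u + 4 * (u * deriv G u) + u ^ 2 * deriv (deriv G) u

namespace Admissible

variable {G G₁ G₂ : ℝ → ℝ}

theorem deriv_lin (h₁ : Admissible G₁) (h₂ : Admissible G₂) (a b : ℝ) :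
    deriv (fun u => a * G₁ u + b * G₂ u) = fun u => a * deriv G₁ u + b * deriv G₂ u := by
  ext u
  exact (((h₁.diff u).hasDerivAt.const_mul a).add ((h₂.diff u).hasDerivAt.const_mul b)).deriv

theorem deriv_deriv_lin (h₁ : Admissible G₁) (h₂ : Admissible G₂) (a b : ℝ) :
    deriv (deriv fun u => a * G₁ u + b * G₂ u) =
      fun u => a * deriv (deriv G₁) u + b * deriv (deriv G₂) u := by
  rw [deriv_lin h₁ h₂]
  ext u
  exact (((h₁.diff' u).hasDerivAt.const_mul a).add ((h₂.diff' u).hasDerivAt.const_mul b)).deriv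

theorem lin (h₁ : Admissible G₁) (h₂ : Admissible G₂) (a b : ℝ) :
    Admissible fun u => a * G₁ u + b * G₂ u where
  even u := by simp only [h₁.even, h₂.even]
  diff := (h₁.diff.const_mul a).add (h₂.diff.const_mul b)
  diff' := by
    rw [deriv_lin h₁ h₂]
    exact (h₁.diff'.const_mul a).add (h₂.diff'.const_mul b)
  rapid := (h₁.rapid.const_mul a).add (h₂.rapid.const_mul b)
  rapid' := by
    rw [deriv_lin h₁ h₂]
    exact (h₁.rapid'.const_mul a).add (h₂.rapid'.const_mul b)
  int := by
    rw [deriv_deriv_lin h₁ h₂]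
    refine ((h₁.int.const_mul a).add (h₂.int.const_mul b)).congr (ae_of_all _ fun u => ?_)
    simp only [Pi.add_apply]
    ring

theorem opV_lin (h₁ : Admissible G₁) (h₂ : Admissible G₂) (a b u : ℝ) :
    opV (fun u => a * G₁ u + b * G₂ u) u = a * opV G₁ u + b * opV G₂ u := by
  rw [opV, deriv_lin h₁ h₂, opV, opV]
  ring

theorem opW_lin (h₁ : Admissible G₁) (h₂ : Admissible G₂) (a b u : ℝ) :
    opW (fun u => a * G₁ u + b * G₂ u) u = a * opW G₁ u + b * opW G₂ u := by
  rw [opW, deriv_deriv_lin h₁ h₂, deriv_lin h₁ h₂, opW, opW]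
  ring

theorem deriv_odd (hG : Admissible G) (u : ℝ) : deriv G (-u) = -deriv G u := by
  have h1 : (fun x => G (-x)) = G := funext hG.even
  have h2 := deriv_comp_neg G u
  rw [h1] at h2
  linarith

theorem deriv_deriv_even (hG : Admissible G) (u : ℝ) :
    deriv (deriv G) (-u) = deriv (deriv G) u := by
  have h1 : (fun x => deriv G (-x)) = fun x => -deriv G x := funext hG.deriv_odd
  have h2 := deriv_comp_neg (deriv G) u
  rw [h1, deriv.fun_neg] at h2
  linarith

theorem rapid_opV (hG : Admissible G) : RapidDecay (opV G) := hG.rapid.add hG.rapid'.id_mul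

theorem opV_even (hG : Admissible G) (u : ℝ) : opV G (-u) = opV G u := by
  rw [opV, opV, hG.even, hG.deriv_odd]
  ring

theorem opW_even (hG : Admissible G) (u : ℝ) : opW G (-u) = opW G u := by
  rw [opW, opW, hG.even, hG.deriv_odd, hG.deriv_deriv_even]
  ring

theorem hasDerivAt_opV (hG : Admissible G) (u : ℝ) :
    HasDerivAt (opV G) (2 * deriv G u + u * deriv (deriv G) u) u := by
  have := (hG.diff u).hasDerivAt.add ((hasDerivAt_id' u).mul (hG.diff' u).hasDerivAt)
  exact this.congr_deriv (by ring)

theorem opW_eq (hG : Admissible G) (u : ℝ) :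
    opW G u = 2 * opV G u + u * deriv (opV G) u := by
  rw [(hG.hasDerivAt_opV u).deriv, opV, opW]
  ring

theorem measurable_opW (hG : Admissible G) : Measurable (opW G) := by
  have h1 := hG.rapid.cont.measurable
  have h2 := measurable_deriv G
  have h3 := measurable_deriv (deriv G)
  unfold opW
  fun_prop

theorem integrable_opW (hG : Admissible G) : Integrable (opW G) :=
  ((hG.rapid.integrable.const_mul 2).add (hG.rapid'.id_mul.integrable.const_mul 4)).add hG.int

theorem hasDerivAt_scaled (hG : Admissible G) (d : ℝ) {h : ℝ} (hh : h ≠ 0) :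
    HasDerivAt (fun h => h⁻¹ * G (d / h)) (-(h ^ 2)⁻¹ * opV G (d / h)) h := by
  have h1 : HasDerivAt (fun h => d / h) (d * -(h ^ 2)⁻¹) h := by
    simpa only [div_eq_mul_inv] using (hasDerivAt_inv hh).const_mul d
  have h2 := (hasDerivAt_inv hh).mul ((hG.diff (d / h)).hasDerivAt.comp h h1)
  refine h2.congr_deriv ?_
  simp only [opV, Function.comp]
  field_simp
  ring

theorem hasDerivAt_scaled' (hG : Admissible G) (d : ℝ) {h : ℝ} (hh : h ≠ 0) :
    HasDerivAt (fun h => -(h ^ 2)⁻¹ * opV G (d / h)) ((h ^ 3)⁻¹ * opW G (d / h)) h := by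
  have h1 : HasDerivAt (fun h => d / h) (d * -(h ^ 2)⁻¹) h := by
    simpa only [div_eq_mul_inv] using (hasDerivAt_inv hh).const_mul d
  have h2 := (hasDerivAt_neg_inv_sq hh).mul ((hG.hasDerivAt_opV (d / h)).comp h h1)
  refine h2.congr_deriv ?_
  simp only [opV, opW, Function.comp]
  field_simp
  ring

theorem integrable_id_mul_deriv_opV (hG : Admissible G) :
    Integrable fun u => u * deriv (opV G) u := by
  refine ((hG.rapid'.id_mul.integrable.const_mul 2).add hG.int).congr (ae_of_all _ fun u => ?_)
  simp only [(hG.hasDerivAt_opV u).deriv, Pi.add_apply]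
  ring

theorem integral_opV_mul (hG : Admissible G) {q q' : ℝ → ℝ} {C C' : ℝ}
    (hq : ∀ u, HasDerivAt q (q' u) u) (hqC : ∀ u, |q u| ≤ C) (hqC' : ∀ u, |q' u| ≤ C') :
    ∫ u, opV G u * q u = -∫ u, u * G u * q' u :=
  integral_deriv_id_mul hG.rapid (fun u => (hG.diff u).hasDerivAt) hG.rapid'.id_mul.integrable
    hq hqC hqC'

theorem integral_opW_mul (hG : Admissible G) {q q' : ℝ → ℝ} {C C' : ℝ}
    (hq : ∀ u, HasDerivAt q (q' u) u) (hqC : ∀ u, |q u| ≤ C) (hqC' : ∀ u, |q' u| ≤ C') :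
    ∫ u, opW G u * q u = -∫ u, u * (G u + opV G u) * q' u := by
  rw [← integral_deriv_id_mul (hG.rapid.add hG.rapid_opV)
    (fun u => (hG.diff u).hasDerivAt.add (hG.hasDerivAt_opV u)) _ hq hqC hqC']
  · congr 1 with u
    rw [opV, opW]
    ring
  · refine (hG.rapid'.id_mul.integrable.add hG.integrable_id_mul_deriv_opV).congr
      (ae_of_all _ fun u => ?_)
    simp only [Pi.add_apply, (hG.hasDerivAt_opV u).deriv]
    ring

/-- With v = `opV G`, `opW G` is 2v + uv', and integrating by parts gives ∫ u v v' = -(1/2)∫ v². -/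
theorem integral_opV_mul_opW (hG : Admissible G) :
    ∫ u, opV G u * opW G u = 3 / 2 * ∫ u, opV G u ^ 2 := by
  obtain ⟨C, -, hC⟩ := hG.rapid_opV.bounded
  have hm := hG.rapid_opV.cont.aestronglyMeasurable (μ := volume)
  have hv2 : Integrable fun u => opV G u ^ 2 := by
    simpa only [sq] using (hG.rapid_opV.mul hG.rapid_opV).integrable
  have hi : Integrable fun u => u * deriv (opV G) u * opV G u :=
    hG.integrable_id_mul_deriv_opV.mul_bdd hm (ae_of_all _ hC)
  have hd : ∀ u, HasDerivAt (opV G) (deriv (opV G) u) u := fun u =>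
    (hG.hasDerivAt_opV u).differentiableAt.hasDerivAt
  have h1 := integral_mul_deriv_eq_deriv_mul_of_integrable (u := fun u => u * opV G u)
    (u' := fun u => opV G u + u * deriv (opV G) u) (v := opV G) (v' := deriv (opV G))
    (fun u _ => ((hasDerivAt_id' u).mul (hd u)).congr_deriv (by simp)) (fun u _ => hd u)
    (hi.congr (ae_of_all _ fun u => by simp only [Pi.mul_apply]; ring))
    ((hv2.add hi).congr (ae_of_all _ fun u => by simp only [Pi.mul_apply, Pi.add_apply]; ring))
    (hG.rapid_opV.id_mul.mul hG.rapid_opV).integrable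
  have h2 : ∫ u, u * opV G u * deriv (opV G) u = ∫ u, u * deriv (opV G) u * opV G u := by
    congr 1 with u; ring
  have h3 : ∫ u, (opV G u + u * deriv (opV G) u) * opV G u
      = (∫ u, opV G u ^ 2) + ∫ u, u * deriv (opV G) u * opV G u := by
    rw [← integral_add hv2 hi]
    congr 1 with u; ring
  have h4 : ∫ u, opV G u * opW G u
      = 2 * (∫ u, opV G u ^ 2) + ∫ u, u * deriv (opV G) u * opV G u := by
    rw [← integral_const_mul, ← integral_add (hv2.const_mul 2) hi]
    congr 1 with u
    rw [hG.opW_eq]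
    ring
  rw [h4]
  linarith

/-- If (uG)' vanished identically, uG would be constant, equal to its value 0 at the origin, so G
would vanish off the origin and have integral zero. -/
theorem integral_opV_sq_pos (hG : Admissible G) (h0 : ∫ u, G u ≠ 0) :
    0 < ∫ u, opV G u ^ 2 := by
  have hv2 : Integrable fun u => opV G u ^ 2 := by
    simpa only [sq] using (hG.rapid_opV.mul hG.rapid_opV).integrable
  refine lt_of_le_of_ne (integral_nonneg fun u => sq_nonneg _) fun h1 => h0 ?_
  have h2 := (integral_eq_zero_iff_of_nonneg (fun u => sq_nonneg _) hv2).1 h1.symm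
  have h3 : (fun u => opV G u ^ 2) = fun _ => 0 :=
    Continuous.ae_eq_iff_eq volume (hG.rapid_opV.cont.pow 2) continuous_const |>.1 h2
  have h4 : ∀ u, HasDerivAt (fun u => u * G u) 0 u := fun u => by
    refine ((hasDerivAt_id' u).mul (hG.diff u).hasDerivAt).congr_deriv ?_
    have := congrFun h3 u
    simp only [opV, ne_eq, OfNat.ofNat_ne_zero, not_false_eq_true, pow_eq_zero_iff] at this
    simpa using this
  have h5 : ∀ u, u * G u = 0 := fun u => by
    simpa using is_const_of_deriv_eq_zero (fun u => (h4 u).differentiableAt)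
      (fun u => (h4 u).deriv) u 0
  refine integral_eq_zero_of_ae ?_
  filter_upwards [compl_mem_ae_iff.2 (measure_singleton (μ := volume) (0 : ℝ))] with u hu
  exact (mul_eq_zero.1 (h5 u)).resolve_left hu

/-- The second derivative is taken with one derivative on each factor, so it is G' * G' and decays
rapidly although G'' itself may not. -/
theorem conv_self (hG : Admissible G) : Admissible (conv G G) := by
  have d1 : deriv (conv G G) = conv (deriv G) G := funext fun x =>
    (hasDerivAt_conv hG.rapid hG.rapid' (fun x => (hG.diff x).hasDerivAt) hG.rapid x).deriv
  have h2 : ∀ x, HasDerivAt (conv (deriv G) G) (conv (deriv G) (deriv G) x) x := fun x => by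
    rw [conv_comm (deriv G) G]
    exact hasDerivAt_conv hG.rapid hG.rapid' (fun x => (hG.diff x).hasDerivAt) hG.rapid' x
  have d2 : deriv (deriv (conv G G)) = conv (deriv G) (deriv G) := by
    rw [d1]; exact funext fun x => (h2 x).deriv
  refine ⟨conv_even hG.even hG.even, fun x => (hasDerivAt_conv hG.rapid hG.rapid'
    (fun x => (hG.diff x).hasDerivAt) hG.rapid x).differentiableAt, ?_, hG.rapid.conv hG.rapid,
    ?_, ?_⟩
  · rw [d1]; exact fun x => (h2 x).differentiableAt
  · rw [d1]; exact hG.rapid'.conv hG.rapid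
  · rw [d2]; exact ((hG.rapid'.conv hG.rapid').pow_mul 2).integrable

end Admissible

/-! ### Identification of V and W -/

/-- Multiplication by x acts on a convolution as a derivation, so xA' = (uK') * K + K' * (uK). The
first term is -B; moving the derivative in the second gives K * (uK)' = A - B. Hence (uA)' = 2A -
2B, while (uK)' = K - L. -/
theorem kerV_eq {K : ℝ → ℝ} (hK : Admissible K) :
    kerV K = opV fun u => 1 / 2 * conv K K u + (-1) * K u := by
  ext x
  have hd : ∀ x, HasDerivAt K (deriv K x) x := fun x => (hK.diff x).hasDerivAt
  have d1 : deriv (conv K K) x = conv (deriv K) K x :=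
    (hasDerivAt_conv hK.rapid hK.rapid' hd hK.rapid x).deriv
  have hL : kerL K = fun u => -(u * deriv K u) := funext fun u => by rw [kerL]; ring
  have e1 := mul_conv hK.rapid' hK.rapid.integrable hK.rapid.id_mul.integrable x
  have e2 : conv (deriv K) (fun u => u * K u) = conv K fun u => K u + u * deriv K u :=
    conv_deriv_left hK.rapid hK.rapid' hd hK.rapid.id_mul
      (hK.rapid.add hK.rapid'.id_mul).integrable
      (fun u => ((hasDerivAt_id' u).mul (hd u)).congr_deriv (by simp))
  have e3 : conv K (fun u => K u + u * deriv K u) x = conv K K x - conv K (kerL K) x := by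
    rw [conv, conv, conv, ← integral_sub (hK.rapid.integrable_conv hK.rapid.integrable x)
      (hK.rapid.integrable_conv (hL ▸ hK.rapid'.id_mul.neg.integrable) x), hL]
    congr 1 with u; ring
  have e4 : conv (fun u => u * deriv K u) K x = -conv K (kerL K) x := by
    rw [conv_comm, conv, conv, ← integral_neg, hL]
    congr 1 with u; ring
  rw [hK.conv_self.opV_lin hK, opV, opV, d1, e1, e2, e3, e4, kerV, kerL]
  ring

/-- Since `opW G` = 2V + xV', only xV' has to be found. The new ingredient is x(K' * L) = -C + B -
D, obtained by the derivation rule and a transfer of the derivative to uL. -/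
theorem kerW_eq {K : ℝ → ℝ} (hK : Admissible K) :
    kerW K = opW fun u => 1 / 2 * conv K K u + (-1) * K u := by
  ext x
  have hd : ∀ x, HasDerivAt K (deriv K x) x := fun x => (hK.diff x).hasDerivAt
  have hA := hasDerivAt_conv hK.rapid hK.rapid' hd hK.rapid x
  have hL : kerL K = fun u => -(u * deriv K u) := funext fun u => by rw [kerL]; ring
  have rL : RapidDecay (kerL K) := hL ▸ hK.rapid'.id_mul.neg
  have hB := hasDerivAt_conv hK.rapid hK.rapid' hd rL x
  have dL : ∀ u, HasDerivAt (kerL K) (-(deriv K u + u * deriv (deriv K) u)) u := fun u => by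
    rw [hL]
    exact (((hasDerivAt_id' u).mul (hK.diff' u).hasDerivAt).neg).congr_deriv (by simp)
  have iH : Integrable (kerH K) := by
    refine (hK.rapid'.id_mul.integrable.add hK.int).congr (ae_of_all _ fun u => ?_)
    simp only [kerH, (dL u).deriv, Pi.add_apply]
    ring
  have hg := hK.conv_self.lin hK (1 / 2) (-1)
  have e0 := kerV_eq hK
  -- The identity xA' = A - 2B is read off from the formula for V just proved.
  have eV : x * conv (deriv K) K x = conv K K x - 2 * conv K (kerL K) x := by
    have d1 : deriv (conv K K) x = conv (deriv K) K x := hA.deriv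
    have := congrFun e0 x
    rw [hK.conv_self.opV_lin hK, opV, opV, d1, kerV] at this
    rw [hL] at this ⊢
    linarith
  have e1 := mul_conv hK.rapid' rL.integrable rL.id_mul.integrable x
  have e2 : conv (deriv K) (fun u => u * kerL K u)
      = conv K fun u => kerL K u + u * deriv (kerL K) u := by
    refine conv_deriv_left hK.rapid hK.rapid' hd rL.id_mul (rL.integrable.sub iH |>.congr
      (ae_of_all _ fun u => ?_)) (fun u => ?_)
    · simp only [Pi.sub_apply, kerH]
      ring
    · exact ((hasDerivAt_id' u).mul (dL u).differentiableAt.hasDerivAt).congr_deriv (by simp)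
  have e3 : conv K (fun u => kerL K u + u * deriv (kerL K) u) x
      = conv K (kerL K) x - conv K (kerH K) x := by
    rw [conv, conv, conv, ← integral_sub (hK.rapid.integrable_conv rL.integrable x)
      (hK.rapid.integrable_conv iH x)]
    congr 1 with u
    rw [kerH]
    ring
  have e4 : conv (fun u => u * deriv K u) (kerL K) x = -conv (kerL K) (kerL K) x := by
    rw [conv, conv, ← integral_neg]
    congr 1 with u
    nth_rewrite 2 [hL]
    ring
  have e5 : deriv (kerV K) x = conv (deriv K) K x - conv (deriv K) (kerL K) x - deriv K x
      + deriv (kerL K) x :=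
    (((hA.sub hB).sub (hd x)).add (dL x).differentiableAt.hasDerivAt).deriv
  rw [hg.opW_eq, ← e0, e5, kerW]
  have e6 : x * (conv (deriv K) K x - conv (deriv K) (kerL K) x - deriv K x + deriv (kerL K) x)
     = x * conv (deriv K) K x - x * conv (deriv K) (kerL K) x - x * deriv K x
      + x * deriv (kerL K) x := by ring
  have e7 : kerH K x = -(x * deriv (kerL K) x) := by rw [kerH]; ring
  have e8 : kerL K x = -(x * deriv K x) := by rw [kerL]; ring
  rw [e6, eV, e1, e2, e3, e4, kerV, e7]
  linarith

/-! ### Moments and positivity for the kernel -/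

theorem admissible_of_isLittleO {K : ℝ → ℝ} (hKsymm : ∀ u, K (-u) = K u)
    (hKd : Differentiable ℝ K) (hKdd : Differentiable ℝ (deriv K)) {a₁ a₂ : ℝ}
    (ha₁ : 0 < a₁) (ha₂ : 0 < a₂)
    (hKdecay : K =o[atTop] fun u : ℝ => Real.exp (-a₁ * u ^ a₂))
    (hKdecay' : deriv K =o[atTop] fun u : ℝ => Real.exp (-a₁ * u ^ a₂))
    (hKint : Integrable fun u : ℝ => u ^ 2 * deriv (deriv K) u) : Admissible K where
  even := hKsymm
  diff := hKd
  diff' := hKdd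
  rapid := .of_even_of_isLittleO hKd.continuous (fun x => by rw [hKsymm]) ha₁ ha₂ hKdecay
  rapid' := .of_even_of_isLittleO hKdd.continuous (fun x => by
    have h1 : (fun x => K (-x)) = K := funext hKsymm
    have h2 := deriv_comp_neg K x
    rw [h1] at h2
    rw [h2, abs_neg]) ha₁ ha₂ hKdecay'
  int := hKint

/-- K * K is the density of a sum of two independent variables with density `K`. In the binomial
expansion of the fourth power the odd moments vanish by symmetry. -/
theorem integral_pow_four_mul_conv {K : ℝ → ℝ} (hK : Admissible K) (hd : IsDensity K) :
    ∫ u, u ^ 4 * conv K K u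
      = 2 * (∫ u, u ^ 4 * K u) + 6 * (∫ u, u ^ 2 * K u) ^ 2 := by
  have hi : ∀ k : ℕ, Integrable fun u => u ^ k * K u := fun k => (hK.rapid.pow_mul k).integrable
  have o1 : ∫ u, u * K u = 0 := integral_eq_zero_of_odd fun u => by rw [hK.even]; ring
  have o3 : ∫ u, u ^ 3 * K u = 0 := integral_eq_zero_of_odd fun u => by rw [hK.even]; ring
  rw [integral_mul_conv hK.rapid hK.rapid (by fun_prop) (C := 1)
    (fun w => by rw [abs_of_nonneg (by positivity)]; linarith)]
  have inner : ∀ u, ∫ a, (a + u) ^ 4 * K a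
      = (∫ a, a ^ 4 * K a) + 6 * u ^ 2 * (∫ a, a ^ 2 * K a) + u ^ 4 := fun u => by
    have e : (fun a => (a + u) ^ 4 * K a) = fun a => a ^ 4 * K a + 4 * u * (a ^ 3 * K a)
        + 6 * u ^ 2 * (a ^ 2 * K a) + 4 * u ^ 3 * (a * K a) + u ^ 4 * K a := by
      ext a; ring
    have i1 : Integrable fun u => u * K u := by simpa using hi 1
    rw [e, integral_add, integral_add, integral_add, integral_add, integral_const_mul,
      integral_const_mul, integral_const_mul, integral_const_mul, o1, o3, hd.integral_eq_one]
    · ring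
    all_goals
      first
      | exact (hi _).const_mul _
      | exact hd.integrable.const_mul _
      | exact i1.const_mul _
      | exact hi _
      | exact ((hi 4).add ((hi 3).const_mul _))
      | exact ((hi 4).add ((hi 3).const_mul _)).add ((hi 2).const_mul _)
      | exact (((hi 4).add ((hi 3).const_mul _)).add ((hi 2).const_mul _)).add (i1.const_mul _)
  simp only [inner]
  set m4 := ∫ a, a ^ 4 * K a with hm4
  set m2 := ∫ a, a ^ 2 * K a with hm2
  have e : (fun u => K u * (m4 + 6 * u ^ 2 * m2 + u ^ 4))
      = fun u => m4 * K u + 6 * m2 * (u ^ 2 * K u) + u ^ 4 * K u := by ext u; ring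
  rw [e, integral_add ((hd.integrable.const_mul _).fun_add ((hi 2).const_mul _)) (hi 4),
    integral_add (hd.integrable.const_mul _) ((hi 2).const_mul _), integral_const_mul,
    integral_const_mul, hd.integral_eq_one, ← hm4, ← hm2]
  ring

theorem integral_sq_mul_conv {K : ℝ → ℝ} (hK : Admissible K) (hd : IsDensity K) :
    ∫ u, u ^ 2 * conv K K u = 2 * ∫ u, u ^ 2 * K u := by
  have hi : ∀ k : ℕ, Integrable fun u => u ^ k * K u := fun k => (hK.rapid.pow_mul k).integrable
  have o1 : ∫ u, u * K u = 0 := integral_eq_zero_of_odd fun u => by rw [hK.even]; ring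
  have i1 : Integrable fun u => u * K u := by simpa using hi 1
  rw [integral_mul_conv hK.rapid hK.rapid (by fun_prop) (C := 1)
    (fun w => by rw [abs_of_nonneg (by positivity)]; nlinarith [sq_nonneg (w ^ 2 - 1)])]
  have inner : ∀ u, ∫ a, (a + u) ^ 2 * K a = (∫ a, a ^ 2 * K a) + u ^ 2 := fun u => by
    have e : (fun a => (a + u) ^ 2 * K a)
        = fun a => a ^ 2 * K a + 2 * u * (a * K a) + u ^ 2 * K a := by
      ext a; ring
    rw [e, integral_add ((hi 2).fun_add (i1.const_mul _)) (hd.integrable.const_mul _),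
      integral_add (hi 2) (i1.const_mul _), integral_const_mul,
      integral_const_mul, o1, hd.integral_eq_one]
    ring
  simp only [inner]
  set m2 := ∫ a, a ^ 2 * K a with hm2
  have e : (fun u => K u * (m2 + u ^ 2)) = fun u => m2 * K u + u ^ 2 * K u := by ext u; ring
  rw [e, integral_add (hd.integrable.const_mul _) (hi 2), integral_const_mul,
    hd.integral_eq_one, ← hm2]
  ring

theorem integral_conv {K : ℝ → ℝ} (hK : Admissible K) (hd : IsDensity K) :
    ∫ u, conv K K u = 1 := by
  have := integral_mul_conv hK.rapid hK.rapid (φ := fun _ => 1) (by fun_prop) (C := 1)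
    (fun w => by simp; positivity)
  simp only [one_mul, hd.integral_eq_one, mul_one] at this
  exact this

theorem IsDensity.exists_pos {K : ℝ → ℝ} (hd : IsDensity K) : ∃ u, u ≠ 0 ∧ 0 < K u := by
  by_contra! h
  have : ∫ u, K u = 0 := by
    refine integral_eq_zero_of_ae ?_
    filter_upwards [compl_mem_ae_iff.2 (measure_singleton (μ := volume) (0 : ℝ))] with u hu
    exact le_antisymm (h u hu) (hd.nonneg u)
  rw [hd.integral_eq_one] at this
  exact one_ne_zero this

theorem integral_pos_of_continuous {φ : ℝ → ℝ} (hc : Continuous φ) (h0 : ∀ u, 0 ≤ φ u)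
    (hi : Integrable φ) {u : ℝ} (hu : 0 < φ u) : 0 < ∫ u, φ u := by
  refine lt_of_le_of_ne (integral_nonneg h0) fun h1 => ?_
  have h2 := (integral_eq_zero_iff_of_nonneg h0 hi).1 h1.symm
  have h3 : φ = fun _ => 0 := Continuous.ae_eq_iff_eq volume hc continuous_const |>.1 h2
  rw [h3] at hu
  exact lt_irrefl _ hu

theorem IsDensity.integral_sq_pos {K : ℝ → ℝ} (hd : IsDensity K) (hc : Continuous K) {C : ℝ}
    (hC : ∀ u, |K u| ≤ C) : 0 < ∫ u, K u ^ 2 := by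
  obtain ⟨u, -, hu⟩ := hd.exists_pos
  refine integral_pos_of_continuous (hc.pow 2) (fun u => sq_nonneg _) ?_ (pow_pos hu 2)
  simpa only [sq] using hd.integrable.mul_bdd hc.aestronglyMeasurable (ae_of_all _ hC)

theorem Admissible.second_moment_pos {K : ℝ → ℝ} (hK : Admissible K) (hd : IsDensity K) :
    0 < ∫ u, u ^ 2 * K u := by
  obtain ⟨u, hu0, hu⟩ := hd.exists_pos
  exact integral_pos_of_continuous (hK.rapid.pow_mul 2).cont
    (fun u => mul_nonneg (sq_nonneg _) (hd.nonneg u)) (hK.rapid.pow_mul 2).integrable (u := u)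
    (by positivity)

theorem Admissible.conv_self_zero {K : ℝ → ℝ} (hK : Admissible K) :
    conv K K 0 = ∫ u, K u ^ 2 := by
  rw [conv]
  congr 1 with u
  rw [zero_sub, hK.even, sq]

/-! ### The smooth density and its autocorrelation -/

/-- Derivative of `∫ φ(u) q(h u) du` in the scale `h`. -/
theorem hasDerivAt_integral_dilate {φ q q' : ℝ → ℝ} {C C' : ℝ} (hφ : Integrable φ)
    (hφ' : Integrable fun u => u * φ u) (hq : ∀ s, HasDerivAt q (q' s) s)
    (hqC : ∀ s, |q s| ≤ C) (hqC' : ∀ s, |q' s| ≤ C') (h : ℝ) :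
    HasDerivAt (fun h => ∫ u, φ u * q (h * u)) (∫ u, u * φ u * q' (h * u)) h := by
  have hqm : Measurable q :=
    (continuous_iff_continuousAt.2 fun u => (hq u).continuousAt).measurable
  have hqm' : Measurable q' := by
    have : q' = deriv q := funext fun u => (hq u).deriv.symm
    rw [this]; exact measurable_deriv q
  refine (hasDerivAt_integral_of_dominated_loc_of_deriv_le (bound := fun u => |u * φ u| * C')
    (F' := fun h u => u * φ u * q' (h * u)) (s := Set.univ) univ_mem ?_ ?_ ?_ ?_ ?_ ?_).2
  · exact Eventually.of_forall fun x => hφ.aestronglyMeasurable.mul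
      (hqm.comp (measurable_const_mul x)).aestronglyMeasurable
  · exact hφ.mul_bdd (hqm.comp (measurable_const_mul h)).aestronglyMeasurable
      (ae_of_all _ fun u => hqC _)
  · exact hφ'.aestronglyMeasurable.mul
      (hqm'.comp (measurable_const_mul h)).aestronglyMeasurable
  · refine ae_of_all _ fun u y _ => ?_
    rw [Real.norm_eq_abs, abs_mul]
    gcongr; exact hqC' _
  · exact hφ'.abs.mul_const C'
  · refine ae_of_all _ fun u y _ => ?_
    have := ((hq (y * u)).comp y (hasDerivAt_mul_const u)).const_mul (φ u)
    exact this.congr_deriv (by ring)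

/-- Densities with three bounded derivatives and square integrable second derivative. -/
structure SmoothDensity (f : ℝ → ℝ) : Prop where
  dens : IsDensity f
  d0 : Differentiable ℝ f
  d1 : Differentiable ℝ (deriv f)
  d2 : Differentiable ℝ (deriv (deriv f))
  b0 : ∃ C, ∀ x, |f x| ≤ C
  b1 : ∃ C, ∀ x, |deriv f x| ≤ C
  b2 : ∃ C, ∀ x, |deriv (deriv f) x| ≤ C
  b3 : ∃ C, ∀ x, |deriv (deriv (deriv f)) x| ≤ C
  int : Integrable fun x => deriv (deriv f) x ^ 2

theorem abs_sub_le_of_deriv_bdd {q : ℝ → ℝ} {C : ℝ} (hq : Differentiable ℝ q)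
    (hC : ∀ x, |deriv q x| ≤ C) (x y : ℝ) : |q y - q x| ≤ C * |y - x| :=
  Convex.norm_image_sub_le_of_norm_deriv_le (s := Set.univ) (fun x _ => hq x) (fun x _ => hC x)
    convex_univ (Set.mem_univ x) (Set.mem_univ y)

/-- Boundedness of `f` itself is not a hypothesis. If |f'| ≤ C, then f(x) ≤ f(t) + C for t in [x,
x+1], and averaging over t gives f(x) ≤ 1 + C. -/
theorem SmoothDensity.of_contDiff {f : ℝ → ℝ} (hf : IsDensity f) (hfC : ContDiff ℝ 3 f)
    (hfb : ∀ k : ℕ, 1 ≤ k → k ≤ 3 → ∃ C : ℝ, ∀ x, |iteratedDeriv k f x| ≤ C)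
    (hfint : Integrable fun x => deriv (deriv f) x ^ 2) : SmoothDensity f := by
  have e1 : iteratedDeriv 1 f = deriv f := iteratedDeriv_one
  have e2 : iteratedDeriv 2 f = deriv (deriv f) := by rw [iteratedDeriv_succ, e1]
  have e3 : iteratedDeriv 3 f = deriv (deriv (deriv f)) := by rw [iteratedDeriv_succ, e2]
  have b1 := e1 ▸ hfb 1 le_rfl (by norm_num)
  have d0 : Differentiable ℝ f := hfC.differentiable (by norm_num)
  refine ⟨hf, d0, ?_, ?_, ?_, b1, e2 ▸ hfb 2 (by norm_num) (by norm_num),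
    e3 ▸ hfb 3 (by norm_num) le_rfl, hfint⟩
  · rw [← e1]; exact hfC.differentiable_iteratedDeriv 1 (by norm_num)
  · rw [← e2]; exact hfC.differentiable_iteratedDeriv 2 (by norm_num)
  · obtain ⟨C, hC⟩ := b1
    have hC0 : 0 ≤ C := (abs_nonneg _).trans (hC 0)
    refine ⟨1 + C, fun x => ?_⟩
    rw [abs_of_nonneg (hf.nonneg x)]
    have h1 : ∫ t in x..(x + 1), f x ≤ ∫ t in x..(x + 1), (f t + C) := by
      refine intervalIntegral.integral_mono_on (by linarith) intervalIntegrable_const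
        (hf.integrable.intervalIntegrable.add intervalIntegrable_const) fun t ht => ?_
      have h2 := abs_sub_le_of_deriv_bdd d0 hC t x
      have h3 : |x - t| ≤ 1 := by rw [abs_le]; constructor <;> linarith [ht.1, ht.2]
      have h4 := (abs_le.1 h2).2
      nlinarith
    have h5 : ∫ t in x..(x + 1), f t ≤ 1 := by
      rw [intervalIntegral.integral_of_le (by linarith), ← hf.integral_eq_one]
      exact setIntegral_le_integral hf.integrable (ae_of_all _ hf.nonneg)
    rw [intervalIntegral.integral_add hf.integrable.intervalIntegrable
      intervalIntegrable_const] at h1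
    simp at h1
    linarith

theorem integral_sub_two_mul_add {a b c : ℝ → ℝ} (ha : Integrable a) (hb : Integrable b)
    (hc : Integrable c) :
    ∫ x, (a x - 2 * b x + c x) = (∫ x, a x) - 2 * (∫ x, b x) + ∫ x, c x := by
  refine (integral_add (ha.sub (hb.const_mul 2)) hc).trans ?_
  rw [integral_sub' ha (hb.const_mul 2), integral_const_mul]

/-- `∫ q(y + s) f(y) dy`. -/
noncomputable def autocorr (q f : ℝ → ℝ) (s : ℝ) : ℝ := ∫ y, q (y + s) * f y

theorem abs_autocorr_le {q f : ℝ → ℝ} {C : ℝ} (hf : IsDensity f) (hC : ∀ x, |q x| ≤ C) (s : ℝ) :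
    |autocorr q f s| ≤ C := by
  have := norm_integral_le_of_norm_le (f := fun y => q (y + s) * f y) (μ := volume)
    (hf.integrable.const_mul C) (ae_of_all _ fun y => by
      rw [Real.norm_eq_abs, abs_mul, abs_of_nonneg (hf.nonneg y)]
      exact mul_le_mul_of_nonneg_right (hC _) (hf.nonneg y))
  rwa [integral_const_mul, hf.integral_eq_one, mul_one] at this

theorem hasDerivAt_autocorr {q f : ℝ → ℝ} {C C' : ℝ} (hf : IsDensity f)
    (hq : Differentiable ℝ q) (hqC : ∀ s, |q s| ≤ C) (hqC' : ∀ s, |deriv q s| ≤ C') (s : ℝ) :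
    HasDerivAt (autocorr q f) (autocorr (deriv q) f s) s := by
  have hqm := hq.continuous.measurable
  have hqm' := measurable_deriv q
  refine (hasDerivAt_integral_of_dominated_loc_of_deriv_le (bound := fun u => C' * |f u|)
    (F' := fun s y => deriv q (y + s) * f y) (s := Set.univ) univ_mem ?_ ?_ ?_ ?_ ?_ ?_).2
  · exact Eventually.of_forall fun x =>
      (hqm.comp (measurable_add_const x)).aestronglyMeasurable.mul
        hf.integrable.aestronglyMeasurable
  · exact hf.integrable.bdd_mul (hqm.comp (measurable_add_const s)).aestronglyMeasurable
      (ae_of_all _ fun u => hqC _)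
  · exact (hqm'.comp (measurable_add_const s)).aestronglyMeasurable.mul
        hf.integrable.aestronglyMeasurable
  · refine ae_of_all _ fun u y _ => ?_
    rw [Real.norm_eq_abs, abs_mul]
    gcongr; exact hqC' _
  · exact hf.integrable.abs.const_mul C'
  · exact ae_of_all _ fun u y _ => ((hq (u + y)).hasDerivAt.comp_const_add u y).mul_const _

theorem autocorr_neg (q f : ℝ → ℝ) (s : ℝ) : autocorr q f (-s) = autocorr f q s := by
  rw [autocorr, autocorr, ← integral_add_right_eq_self _ s]
  congr 1 with y
  rw [add_neg_cancel_right, mul_comm]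

theorem integrable_autocorr {f : ℝ → ℝ} (hf : IsDensity f) :
    Integrable (autocorr f f) ∧ ∫ s, autocorr f f s = 1 := by
  have h1 : Integrable (fun z : ℝ × ℝ => f (z.2 + z.1) * f z.2) (volume.prod volume) := by
    have h2 := hf.integrable.mul_prod hf.integrable
    have := (measurePreserving_add_prod (volume : Measure ℝ) (volume : Measure ℝ)).integrable_comp
      h2.aestronglyMeasurable |>.2 h2
    refine this.congr (ae_of_all _ fun z => ?_)
    simp [Function.comp, add_comm]
  refine ⟨h1.integral_prod_left, ?_⟩
  have h3 : ∫ s, autocorr f f s = ∫ y, ∫ s, f (y + s) * f y :=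
    integral_integral_swap h1
  simp only [integral_mul_const, integral_add_left_eq_self, hf.integral_eq_one, one_mul] at h3
  exact h3

theorem autocorr_nonneg {f : ℝ → ℝ} (hf : IsDensity f) (s : ℝ) : 0 ≤ autocorr f f s :=
  integral_nonneg fun _ => mul_nonneg (hf.nonneg _) (hf.nonneg _)

/-- The autocorrelation is itself a probability density, so its dilation u ↦ r(hu) has mass 1/h.
This governs the criterion at large bandwidths. -/
theorem abs_integral_mul_autocorr_le {f Q : ℝ → ℝ} {C : ℝ} (hf : IsDensity f)
    (hC : ∀ u, |Q u| ≤ C) {h : ℝ} (hh : 0 < h) :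
    |∫ u, Q u * autocorr f f (h * u)| ≤ C / h := by
  have h1 := (integrable_autocorr hf).1.comp_mul_left' hh.ne'
  have := norm_integral_le_of_norm_le (f := fun u => Q u * autocorr f f (h * u)) (μ := volume)
    (h1.const_mul C) (ae_of_all _ fun u => by
      rw [Real.norm_eq_abs, abs_mul, abs_of_nonneg (autocorr_nonneg hf _)]
      exact mul_le_mul_of_nonneg_right (hC _) (autocorr_nonneg hf _))
  rw [integral_const_mul, Measure.integral_comp_mul_left (autocorr f f) h,
    (integrable_autocorr hf).2, abs_of_pos (inv_pos.2 hh)] at this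
  simpa [div_eq_mul_inv] using this

namespace SmoothDensity

variable {f : ℝ → ℝ}

theorem integrable_shift_mul (hf : SmoothDensity f) (s t : ℝ) :
    Integrable fun y => f (y + s) * f (y + t) := by
  obtain ⟨F, hF⟩ := hf.b0
  exact (hf.dens.integrable.comp_add_right t).bdd_mul
    (hf.d0.continuous.comp (continuous_add_const s)).aestronglyMeasurable
    (ae_of_all _ fun u => hF _)

theorem integral_shift_mul (s t : ℝ) :
    ∫ y, f (y + s) * f (y + t) = autocorr f f (s - t) := by
  rw [autocorr, ← integral_add_right_eq_self (fun y => f (y + (s - t)) * f y) t]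
  congr 1 with y
  ring_nf

theorem continuous_autocorr (hf : SmoothDensity f) : Continuous (autocorr f f) := by
  obtain ⟨F, hF⟩ := hf.b0
  obtain ⟨F1, hF1⟩ := hf.b1
  exact continuous_iff_continuousAt.2 fun s =>
    (hasDerivAt_autocorr hf.dens hf.d0 hF hF1 s).continuousAt

/-- It shows that r is largest at 0 and that r(s) = r(0) only if s is a period of `f`. -/
theorem integral_sq_sub_shift (hf : SmoothDensity f) (s : ℝ) :
    ∫ y, (f (y + s) - f y) ^ 2 = 2 * autocorr f f 0 - 2 * autocorr f f s := by
  have e : (fun y => (f (y + s) - f y) ^ 2) = fun y => f (y + s) * f (y + s)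
      - 2 * (f (y + s) * f (y + 0)) + f (y + 0) * f (y + 0) := by
    ext y; rw [add_zero]; ring
  rw [e, integral_sub_two_mul_add (hf.integrable_shift_mul s s) (hf.integrable_shift_mul s 0)
    (hf.integrable_shift_mul 0 0), integral_shift_mul, integral_shift_mul, integral_shift_mul]
  simp only [sub_self, sub_zero]
  ring

theorem autocorr_zero_pos (hf : SmoothDensity f) : 0 < autocorr f f 0 := by
  obtain ⟨F, hF⟩ := hf.b0
  have := hf.dens.integral_sq_pos hf.d0.continuous hF
  simpa [autocorr, sq] using this

/-- For a positive period c the integral over [-nc, nc] is a multiple of n; since it converges, the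
multiple is zero, and then the total mass would be 0. -/
theorem not_periodic (hf : SmoothDensity f) {c : ℝ} (hc : c ≠ 0) : ¬ Function.Periodic f c := by
  intro hp
  wlog hc0 : 0 < c generalizing c
  · exact this (neg_ne_zero.2 hc) hp.neg (by
      have := lt_of_le_of_ne (not_lt.1 hc0) hc
      linarith)
  have h1 : ∀ n : ℕ, ∫ x in (-(n * c))..(n * c), f x = n * (2 * ∫ x in 0..c, f x) := fun n => by
    have := hp.intervalIntegral_add_zsmul_eq (2 * n) (-(n * c))
      (fun a b => hf.dens.integrable.intervalIntegrable)
    simp only [zsmul_eq_mul, Int.cast_mul, Int.cast_ofNat, Int.cast_natCast] at this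
    rw [show -(n * c) + 2 * n * c = (n * c : ℝ) by ring] at this
    have h0 := hp.intervalIntegral_add_eq (-(n * c)) 0
    rw [zero_add] at h0
    rw [this, h0]
    ring
  have hn : Tendsto (fun n : ℕ => (n : ℝ) * c) atTop atTop :=
    tendsto_natCast_atTop_atTop.atTop_mul_const hc0
  have h2 := intervalIntegral_tendsto_integral hf.dens.integrable
    (tendsto_neg_atTop_atBot.comp hn) hn
  simp only [Function.comp, h1, hf.dens.integral_eq_one] at h2
  have h3 := (h2.comp (tendsto_add_atTop_nat 1)).sub h2
  simp only [Function.comp, Nat.cast_add, Nat.cast_one, add_mul, add_sub_cancel_left, one_mul,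
    sub_self] at h3
  have h4 := tendsto_nhds_unique h3 tendsto_const_nhds
  rw [← h4] at h2
  simp only [mul_zero] at h2
  exact one_ne_zero (tendsto_nhds_unique h2 tendsto_const_nhds)

/-- Otherwise `f` is affine, hence constant because it is bounded, hence periodic. -/
theorem sq_deriv_pos (hf : SmoothDensity f) : 0 < ∫ x, deriv (deriv f) x ^ 2 := by
  by_contra h0
  have hz : ∀ x, deriv (deriv f) x = 0 := fun x => by
    by_contra hx
    exact h0 (integral_pos_of_continuous (hf.d2.continuous.pow 2) (fun u => sq_nonneg _) hf.int
      (u := x) (by positivity))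
  have h1 : ∀ x, deriv f x = deriv f 0 := fun x => is_const_of_deriv_eq_zero hf.d1 hz x 0
  have h2 : ∀ x, f x = f 0 + deriv f 0 * x := fun x => by
    have hd : ∀ x, HasDerivAt (fun x => f x - deriv f 0 * x) 0 x := fun x =>
      ((hf.d0 x).hasDerivAt.sub ((hasDerivAt_id' x).const_mul (deriv f 0))).congr_deriv
        (by rw [h1 x]; ring)
    have := is_const_of_deriv_eq_zero (fun x => (hd x).differentiableAt)
      (fun x => (hd x).deriv) x 0
    simp only [mul_zero, sub_zero] at this
    linarith
  have h3 : deriv f 0 = 0 := by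
    obtain ⟨F, hF⟩ := hf.b0
    by_contra h4
    have h5 := hF ((F + 1 + |f 0|) / deriv f 0)
    rw [h2, mul_div_cancel₀ _ h4] at h5
    have := (abs_le.1 h5).2
    linarith [neg_abs_le (f 0)]
  refine hf.not_periodic one_ne_zero fun x => ?_
  rw [h2, h2 x, h3]
  ring

/-! ### The integrated squared bias and its positivity -/

section bias

variable {K : ℝ → ℝ}

theorem integrable_smooth_prod (hf : SmoothDensity f) (hK : Admissible K) (hd : IsDensity K)
    (h : ℝ) :
    Integrable (fun z : ℝ × ℝ => K z.1 * f (z.2 + h * z.1)) (volume.prod volume) := by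
  have hKm := hK.rapid.cont
  have hfm := hf.d0.continuous
  refine (integrable_prod_iff (by fun_prop)).2 ⟨ae_of_all _ fun u =>
    (hf.dens.integrable.comp_add_right (h * u)).const_mul (K u), ?_⟩
  simp only [norm_mul, integral_const_mul, Real.norm_eq_abs, abs_of_nonneg (hf.dens.nonneg _)]
  have : ∀ u, ∫ y, f (y + h * u) = 1 := fun u => by
    rw [integral_add_right_eq_self, hf.dens.integral_eq_one]
  simp only [this, mul_one]
  exact hd.integrable.abs

theorem continuous_smooth (hf : SmoothDensity f) (hd : IsDensity K) (h : ℝ) :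
    Continuous fun y => ∫ u, K u * f (y + h * u) := by
  obtain ⟨F, hF⟩ := hf.b0
  have hc := hf.d0.continuous
  refine continuous_of_dominated (bound := fun u => |K u| * F) (fun y => ?_) (fun y => ?_)
    (hd.integrable.abs.mul_const F) (ae_of_all _ fun u => by fun_prop)
  · exact hd.integrable.aestronglyMeasurable.mul (by fun_prop)
  · refine ae_of_all _ fun u => ?_
    rw [Real.norm_eq_abs, abs_mul]
    gcongr; exact hF _

theorem abs_smooth_le {F : ℝ} (hd : IsDensity K) (hF : ∀ x, |f x| ≤ F) (h y : ℝ) :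
    |∫ u, K u * f (y + h * u)| ≤ F := by
  have := norm_integral_le_of_norm_le (f := fun u => K u * f (y + h * u)) (μ := volume)
    (hd.integrable.mul_const F) (ae_of_all _ fun u => by
      rw [Real.norm_eq_abs, abs_mul, abs_of_nonneg (hd.nonneg u)]
      exact mul_le_mul_of_nonneg_left (hF _) (hd.nonneg u))
  rwa [integral_mul_const, hd.integral_eq_one, one_mul] at this

theorem integral_smooth_mul (hf : SmoothDensity f) (hd : IsDensity K)
    {w : ℝ → ℝ} (hw : Integrable w) (h : ℝ) :
    ∫ y, (∫ u, K u * f (y + h * u)) * w y = ∫ u, K u * ∫ y, f (y + h * u) * w y := by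
  obtain ⟨F, hF⟩ := hf.b0
  have hc := hf.d0.continuous
  have hi : Integrable (fun z : ℝ × ℝ => f (z.1 + h * z.2) * (w z.1 * K z.2))
      (volume.prod volume) :=
    (hw.mul_prod hd.integrable).bdd_mul (by fun_prop) (ae_of_all _ fun z => hF _)
  calc ∫ y, (∫ u, K u * f (y + h * u)) * w y
      = ∫ y, ∫ u, f (y + h * u) * (w y * K u) := by
        congr 1 with y
        rw [← integral_mul_const]
        congr 1 with u
        ring
    _ = ∫ u, ∫ y, f (y + h * u) * (w y * K u) := integral_integral_swap hi
    _ = _ := by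
        congr 1 with u
        rw [← integral_const_mul]
        congr 1 with y
        ring

theorem sq_bias_eq (hf : SmoothDensity f) (hK : Admissible K) (hd : IsDensity K) (h : ℝ) :
    (∫ u, (conv K K u - 2 * K u) * autocorr f f (h * u)) + autocorr f f 0
      = ∫ y, ((∫ u, K u * f (y + h * u)) - f y) ^ 2 := by
  obtain ⟨F, hF⟩ := hf.b0
  have hF' := abs_autocorr_le hf.dens hF
  have hrm := hf.continuous_autocorr.measurable
  set k : ℝ → ℝ := fun y => ∫ u, K u * f (y + h * u) with hk
  have hkc : Continuous k := hf.continuous_smooth hd h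
  have hki : Integrable k := (hf.integrable_smooth_prod hK hd h).integral_prod_right
  have hkf : Integrable fun y => k y * f y :=
    hki.mul_bdd hf.d0.continuous.aestronglyMeasurable (ae_of_all _ hF)
  have hkC : ∀ y, |k y| ≤ F := fun y => abs_smooth_le hd hF h y
  have hkk : Integrable fun y => k y * k y :=
    hki.mul_bdd hkc.aestronglyMeasurable (ae_of_all _ hkC)
  have hff : Integrable fun y => f y * f y := by simpa using hf.integrable_shift_mul 0 0
  have e1 : ∫ y, k y * f y = ∫ u, K u * autocorr f f (h * u) :=
    hf.integral_smooth_mul hd hf.dens.integrable h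
  have e2 : ∫ y, k y * k y = ∫ u, conv K K u * autocorr f f (h * u) := by
    have s1 : ∀ u, ∫ y, f (y + h * u) * k y = ∫ v, K v * autocorr f f (h * (v + -u)) := fun u => by
      have := hf.integral_smooth_mul hd (hf.dens.integrable.comp_add_right (h * u)) h
      simp only [integral_shift_mul] at this
      calc ∫ y, f (y + h * u) * k y = ∫ y, k y * f (y + h * u) := by
            congr 1 with y; exact mul_comm _ _
        _ = _ := this
        _ = _ := by
            congr 1 with v
            ring_nf
    have s2 := integral_mul_conv hK.rapid hK.rapid (φ := fun s => autocorr f f (h * s))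
      (by fun_prop) (C := F) (fun w => (hF' _).trans (by
        have : 0 ≤ F := (abs_nonneg _).trans (hF 0)
        nlinarith [mul_nonneg this (by positivity : 0 ≤ w ^ 4)]))
    rw [hf.integral_smooth_mul hd hki h]
    simp only [s1, mul_comm (conv K K _), s2]
    -- The inner integral carries v - u where the convolution formula has v + u; replacing u by -u
    -- is harmless because `K` is even.
    rw [← integral_neg_eq_self]
    simp only [hK.even, neg_neg, mul_comm (K _)]
  have e3 : (fun y => (k y - f y) ^ 2) = fun y => k y * k y - 2 * (k y * f y) + f y * f y := by
    ext y; ring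
  have hrm' : Measurable fun u => autocorr f f (h * u) := by fun_prop
  have i1 := hK.conv_self.rapid.integrable_mul_bdd hrm' (fun u => hF' (h * u))
  have i2 := hK.rapid.integrable_mul_bdd hrm' (fun u => hF' (h * u))
  rw [e3, integral_sub_two_mul_add hkk hkf hff, e1, e2]
  have e4 : (fun u => (conv K K u - 2 * K u) * autocorr f f (h * u)) = fun u =>
      conv K K u * autocorr f f (h * u) - 2 * (K u * autocorr f f (h * u)) := by ext u; ring
  rw [e4, integral_sub i1 (i2.const_mul 2), integral_const_mul]
  simp [autocorr]

/-- Zero bias means that smoothing at scale h fixes `f`. Pairing with `f` gives ∫ K(u)(r(0) - r(hu))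
du = 0 with a nonnegative continuous integrand. So r(hu) = r(0) at some u ≠ 0 with K(u) > 0, and hu
would be a period of `f`. -/
theorem sq_bias_pos (hf : SmoothDensity f) (hK : Admissible K) (hd : IsDensity K) {h : ℝ}
    (hh : h ≠ 0) :
    0 < (∫ u, (conv K K u - 2 * K u) * autocorr f f (h * u)) + autocorr f f 0 := by
  obtain ⟨F, hF⟩ := hf.b0
  have hF' := abs_autocorr_le hf.dens hF
  have hrc := hf.continuous_autocorr
  have hKc := hK.rapid.cont
  rw [hf.sq_bias_eq hK hd]
  by_contra h0
  set k : ℝ → ℝ := fun y => ∫ u, K u * f (y + h * u) with hk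
  have hkc : Continuous k := hf.continuous_smooth hd h
  have hki : Integrable k := (hf.integrable_smooth_prod hK hd h).integral_prod_right
  have hkC : ∀ y, |k y| ≤ F := fun y => abs_smooth_le hd hF h y
  have hint : Integrable fun y => (k y - f y) ^ 2 := by
    have := (hki.sub hf.dens.integrable).mul_bdd (f := fun y => k y - f y)
      (g := fun y => k y - f y) (c := F + F)
      (hkc.sub hf.d0.continuous).aestronglyMeasurable
      (ae_of_all _ fun y => (abs_sub _ _).trans (add_le_add (hkC y) (hF y)))
    simpa only [sq] using this
  have hkf : k = f := funext fun y => by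
    by_contra hy
    exact h0 (integral_pos_of_continuous ((hkc.sub hf.d0.continuous).pow 2)
      (fun u => sq_nonneg _) hint (u := y) (sq_pos_iff.2 (sub_ne_zero.2 hy)))
  have e1 : autocorr f f 0 = ∫ u, K u * autocorr f f (h * u) := by
    have := hf.integral_smooth_mul hd hf.dens.integrable h
    change ∫ y, k y * f y = _ at this
    rw [hkf] at this
    simpa [autocorr] using this
  have hle : ∀ s, autocorr f f s ≤ autocorr f f 0 := fun s => by
    have h1 := hf.integral_sq_sub_shift s
    have h2 : 0 ≤ ∫ y, (f (y + s) - f y) ^ 2 := integral_nonneg fun y => sq_nonneg _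
    linarith
  have i2 : Integrable fun u => K u * autocorr f f (h * u) :=
    hK.rapid.integrable_mul_bdd (hrc.comp (continuous_const_mul h)).measurable
      (fun u => hF' (h * u))
  have e2 : ∫ u, K u * (autocorr f f 0 - autocorr f f (h * u)) = 0 := by
    simp only [mul_sub]
    rw [integral_sub (hd.integrable.mul_const _) i2, integral_mul_const, hd.integral_eq_one, ← e1]
    ring
  obtain ⟨u, hu0, hu⟩ := hd.exists_pos
  have e3 : autocorr f f (h * u) = autocorr f f 0 := by
    by_contra hne
    have hlt := sub_pos.2 (lt_of_le_of_ne (hle _) hne)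
    refine (integral_pos_of_continuous (φ := fun u =>
      K u * (autocorr f f 0 - autocorr f f (h * u))) (by fun_prop)
      (fun u => mul_nonneg (hd.nonneg u) (sub_nonneg.2 (hle _))) ?_ (mul_pos hu hlt)).ne' e2
    simp only [mul_sub]
    exact (hd.integrable.mul_const _).sub i2
  refine hf.not_periodic (mul_ne_zero hh hu0) fun y => ?_
  have e4 := hf.integral_sq_sub_shift (h * u)
  rw [e3, sub_self] at e4
  by_contra hy
  have hc := hf.d0.continuous
  refine (integral_pos_of_continuous (φ := fun y => (f (y + h * u) - f y) ^ 2) (by fun_prop)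
    (fun u => sq_nonneg _) ?_ (u := y) (sq_pos_iff.2 (sub_ne_zero.2 hy))).ne' e4
  refine (((hf.integrable_shift_mul (h * u) (h * u)).sub
    ((hf.integrable_shift_mul (h * u) 0).const_mul 2)).add (hf.integrable_shift_mul 0 0)).congr
    (ae_of_all _ fun y => ?_)
  simp only [Pi.add_apply, Pi.sub_apply, add_zero]
  ring

end bias

end SmoothDensity

/-! ### Autocorrelation of a square integrable function -/

section sqIntegrable

variable {p : ℝ → ℝ}

theorem integrable_shift_mul_of_sq (hp : Continuous p) (hi : Integrable fun y => p y ^ 2)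
    (s : ℝ) : Integrable fun y => p (y + s) * p y := by
  refine ((hi.comp_add_right s).add hi).mono' (by fun_prop) (ae_of_all _ fun y => ?_)
  simp only [Real.norm_eq_abs, Pi.add_apply, abs_le]
  constructor <;>
    nlinarith [sq_nonneg (p (y + s)), sq_nonneg (p y), sq_nonneg (p (y + s) - p y),
      sq_nonneg (p (y + s) + p y)]

theorem integral_abs_shift_mul_le (hp : Continuous p) (hi : Integrable fun y => p y ^ 2)
    (s : ℝ) : ∫ y, |p (y + s) * p y| ≤ ∫ y, p y ^ 2 := by
  have h1 : ∫ y, |p (y + s) * p y| ≤ ∫ y, (1 / 2 * p (y + s) ^ 2 + 1 / 2 * p y ^ 2) := by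
    refine integral_mono (integrable_shift_mul_of_sq hp hi s).abs
      (((hi.comp_add_right s).const_mul _).add (hi.const_mul _)) fun y => ?_
    simp only [abs_le]
    constructor <;>
      nlinarith [sq_nonneg (p (y + s) - p y), sq_nonneg (p (y + s) + p y)]
  rw [integral_add ((hi.comp_add_right s).const_mul _) (hi.const_mul _), integral_const_mul,
    integral_const_mul, integral_add_right_eq_self (fun y => p y ^ 2)] at h1
  linarith

theorem abs_autocorr_self_le (hp : Continuous p) (hi : Integrable fun y => p y ^ 2)
    (s : ℝ) : |autocorr p p s| ≤ ∫ y, p y ^ 2 :=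
  abs_integral_le_integral_abs.trans (integral_abs_shift_mul_le hp hi s)

/-- The integrand is p(y)(p(y+s) - p(y)). Where |p| > η, the Lipschitz bound C|s| costs one factor
|p|/η. Where |p| ≤ η, the weighted inequality ab ≤ a²/(2δ) + δb²/2 leaves the small tail of ∫p² and
a multiple of δ. -/
theorem abs_autocorr_self_sub_le {C : ℝ} (hp : Continuous p) (hi : Integrable fun y => p y ^ 2)
    (hC : ∀ x y, |p y - p x| ≤ C * |y - x|) {η δ : ℝ} (hη : 0 < η) (hδ : 0 < δ) (s : ℝ) :
    |autocorr p p s - ∫ y, p y ^ 2| ≤ C * |s| / η * (∫ y, p y ^ 2)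
      + 1 / (2 * δ) * (∫ y, {y | |p y| ≤ η}.indicator (fun y => p y ^ 2) y)
      + 2 * δ * ∫ y, p y ^ 2 := by
  have hms : MeasurableSet {y | |p y| ≤ η} := measurableSet_le (by fun_prop) (by fun_prop)
  have hI := hi.indicator hms
  have e1 : autocorr p p s - ∫ y, p y ^ 2 = ∫ y, (p (y + s) * p y - p y ^ 2) :=
    (integral_sub (integrable_shift_mul_of_sq hp hi s) hi).symm
  have hCs : ∀ y, |p (y + s) - p y| ≤ C * |s| := fun y => by simpa using hC y (y + s)
  have hC0 : 0 ≤ C * |s| := (abs_nonneg _).trans (hCs 0)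
  have hB : Integrable fun y => C * |s| / η * p y ^ 2
      + 1 / (2 * δ) * {y | |p y| ≤ η}.indicator (fun y => p y ^ 2) y
      + δ * (p (y + s) ^ 2 + p y ^ 2) :=
    ((hi.const_mul _).add (hI.const_mul _)).add (((hi.comp_add_right s).add hi).const_mul δ)
  have h2 := norm_integral_le_of_norm_le (f := fun y => p (y + s) * p y - p y ^ 2) (μ := volume)
    hB (ae_of_all _ fun y => by
      rw [Real.norm_eq_abs]
      have e2 : p (y + s) * p y - p y ^ 2 = p y * (p (y + s) - p y) := by ring
      have hd0 : 0 ≤ δ * (p (y + s) ^ 2 + p y ^ 2) := by positivity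
      rw [e2, abs_mul]
      by_cases hy : |p y| ≤ η
      · rw [Set.indicator_of_mem (by exact hy)]
        have h3 : |p y| * |p (y + s) - p y| ≤
            1 / (2 * δ) * p y ^ 2 + δ / 2 * (p (y + s) - p y) ^ 2 := by
          rw [← sq_abs (p y), ← sq_abs (p (y + s) - p y)]
          set a := |p y|
          set b := |p (y + s) - p y|
          have h4 : 1 / (2 * δ) * a ^ 2 + δ / 2 * b ^ 2 - a * b = (a - δ * b) ^ 2 / (2 * δ) := by
            field_simp
            ring
          have : 0 ≤ (a - δ * b) ^ 2 / (2 * δ) := by positivity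
          linarith
        have h5 : δ / 2 * (p (y + s) - p y) ^ 2 ≤ δ * (p (y + s) ^ 2 + p y ^ 2) := by
          nlinarith [sq_nonneg (p (y + s) + p y)]
        have h6 : 0 ≤ C * |s| / η * p y ^ 2 := by positivity
        linarith
      · rw [Set.indicator_of_notMem (by exact hy)]
        push Not at hy
        have h3 : |p y| * |p (y + s) - p y| ≤ C * |s| / η * p y ^ 2 := by
          rw [div_mul_eq_mul_div, le_div_iff₀ hη, ← sq_abs (p y)]
          calc |p y| * |p (y + s) - p y| * η ≤ |p y| * (C * |s|) * |p y| := by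
                gcongr; exact hCs y
            _ = _ := by ring
        linarith)
  rw [e1]
  refine h2.trans (le_of_eq ?_)
  rw [integral_add ((hi.const_mul _).fun_add (hI.const_mul _))
    (((hi.comp_add_right s).fun_add hi).const_mul δ), integral_add (hi.const_mul _)
    (hI.const_mul _), integral_const_mul, integral_const_mul, integral_const_mul,
    integral_add (hi.comp_add_right s) hi, integral_add_right_eq_self (fun y => p y ^ 2)]
  ring

theorem tendsto_autocorr_self {C : ℝ} (hp : Continuous p) (hi : Integrable fun y => p y ^ 2)
    (hC : ∀ x y, |p y - p x| ≤ C * |y - x|) :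
    Tendsto (autocorr p p) (nhds 0) (nhds (∫ y, p y ^ 2)) := by
  set R := ∫ y, p y ^ 2 with hR
  have hR0 : 0 ≤ R := integral_nonneg fun y => sq_nonneg _
  have hT : Tendsto (fun η : ℝ => ∫ y, {y | |p y| ≤ η}.indicator (fun y => p y ^ 2) y)
      (nhdsWithin 0 (Set.Ioi 0)) (nhds 0) := by
    have : ∫ _ : ℝ, (0 : ℝ) = 0 := by simp
    suffices h : Tendsto (fun η : ℝ => ∫ y, {y | |p y| ≤ η}.indicator (fun y => p y ^ 2) y)
      (nhdsWithin 0 (Set.Ioi 0)) (nhds (∫ _ : ℝ, (0 : ℝ))) by rwa [this] at h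
    refine tendsto_integral_filter_of_dominated_convergence (fun y => p y ^ 2) ?_ ?_ hi ?_
    · refine Eventually.of_forall fun η => (hi.indicator ?_).aestronglyMeasurable
      exact measurableSet_le (by fun_prop) (by fun_prop)
    · refine Eventually.of_forall fun η => ae_of_all _ fun y => ?_
      refine (norm_indicator_le_norm_self _ _).trans (le_of_eq ?_)
      simp
    · refine ae_of_all _ fun y => ?_
      rcases eq_or_ne (p y) 0 with h0 | h0
      · refine tendsto_const_nhds.congr fun η => ?_
        by_cases hy : y ∈ {y | |p y| ≤ η}
        · rw [Set.indicator_of_mem hy, h0]; simp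
        · rw [Set.indicator_of_notMem hy]
      · refine tendsto_const_nhds.congr' ?_
        have : ∀ᶠ η : ℝ in nhdsWithin 0 (Set.Ioi 0), η < |p y| :=
          (eventually_lt_nhds (abs_pos.2 h0)).filter_mono nhdsWithin_le_nhds
        filter_upwards [this] with η hη
        rw [Set.indicator_of_notMem]
        simpa using hη
  rw [Metric.tendsto_nhds]
  intro ε hε
  -- The parameters are fixed in the order δ, η, s: each of the three terms of the bound is then
  -- below ε/3.
  obtain ⟨δ, hδ, hδε⟩ : ∃ δ, 0 < δ ∧ 2 * δ * R < ε / 3 := by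
    refine ⟨ε / (6 * (R + 1)) / 2, by positivity, ?_⟩
    have : 2 * (ε / (6 * (R + 1)) / 2) * R = ε / 6 * (R / (R + 1)) := by field_simp
    rw [this]
    have : R / (R + 1) ≤ 1 := by rw [div_le_one (by positivity)]; linarith
    nlinarith
  obtain ⟨η, hη1, hη⟩ : ∃ η, 1 / (2 * δ) *
      (∫ y, {y | |p y| ≤ η}.indicator (fun y => p y ^ 2) y) < ε / 3 ∧ 0 < η := by
    have h1 := (hT.const_mul (1 / (2 * δ))).eventually_lt_const
      (u := ε / 3) (by rw [mul_zero]; positivity)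
    exact (h1.and self_mem_nhdsWithin).exists
  have h2 : Tendsto (fun s : ℝ => C * |s| / η * R) (nhds 0) (nhds 0) := by
    have : Continuous fun s : ℝ => C * |s| / η * R := by fun_prop
    simpa using this.tendsto 0
  filter_upwards [h2.eventually_lt_const (u := ε / 3) (by positivity)] with s hs
  rw [Real.dist_eq]
  linarith [abs_autocorr_self_sub_le hp hi hC hη hδ s]

theorem measurable_autocorr_self (hp : Continuous p) : Measurable (autocorr p p) := by
  have : StronglyMeasurable (Function.uncurry fun s y : ℝ => p (y + s) * p y) := by
    unfold Function.uncurry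
    exact Continuous.stronglyMeasurable (by fun_prop)
  exact this.integral_prod_right.measurable

theorem integrable_prod_shift_mul (hp : Continuous p) (hi : Integrable fun y => p y ^ 2)
    (s : ℝ) : Integrable (fun z : ℝ × ℝ => (1 - z.1) * (p (z.2 + z.1 * s) * p z.2))
      ((volume.restrict (Set.Ioc (0 : ℝ) 1)).prod volume) := by
  have hm : AEStronglyMeasurable (fun z : ℝ × ℝ => (1 - z.1) * (p (z.2 + z.1 * s) * p z.2))
      ((volume.restrict (Set.Ioc (0 : ℝ) 1)).prod volume) :=
    Continuous.aestronglyMeasurable (by fun_prop)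
  refine (integrable_prod_iff hm).2 ⟨ae_of_all _ fun t =>
    (integrable_shift_mul_of_sq hp hi (t * s)).const_mul (1 - t), ?_⟩
  refine (integrable_const (∫ y, p y ^ 2)).mono' hm.norm.integral_prod_right' ?_
  refine (ae_restrict_iff' measurableSet_Ioc).2 (ae_of_all _ fun t ht => ?_)
  rw [Real.norm_eq_abs, abs_of_nonneg (integral_nonneg fun y => norm_nonneg _)]
  simp only [norm_mul, integral_const_mul]
  have h1 := integral_abs_shift_mul_le hp hi (t * s)
  simp only [abs_mul] at h1
  simp only [Real.norm_eq_abs]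
  have h2 : |1 - t| ≤ 1 := by rw [abs_le]; constructor <;> linarith [ht.1, ht.2]
  calc |1 - t| * ∫ y, |p (y + t * s)| * |p y| ≤ 1 * ∫ y, p y ^ 2 := by
        refine mul_le_mul h2 h1 (integral_nonneg fun y => by positivity) zero_le_one
    _ = _ := one_mul _

end sqIntegrable

/-! ### Expansion of the squared bias at zero bandwidth -/

namespace SmoothDensity

variable {f : ℝ → ℝ}

theorem hasDerivAt_r (hf : SmoothDensity f) (s : ℝ) :
    HasDerivAt (autocorr f f) (autocorr (deriv f) f s) s := by
  obtain ⟨C, hC⟩ := hf.b0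
  obtain ⟨D, hD⟩ := hf.b1
  exact hasDerivAt_autocorr hf.dens hf.d0 hC hD s

theorem hasDerivAt_r1 (hf : SmoothDensity f) (s : ℝ) :
    HasDerivAt (autocorr (deriv f) f) (autocorr (deriv (deriv f)) f s) s := by
  obtain ⟨C, hC⟩ := hf.b1
  obtain ⟨D, hD⟩ := hf.b2
  exact hasDerivAt_autocorr hf.dens hf.d1 hC hD s

theorem continuous_r2 (hf : SmoothDensity f) : Continuous (autocorr (deriv (deriv f)) f) := by
  obtain ⟨C, hC⟩ := hf.b2
  obtain ⟨D, hD⟩ := hf.b3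
  exact continuous_iff_continuousAt.2 fun s =>
    (hasDerivAt_autocorr hf.dens hf.d2 hC hD s).continuousAt

theorem r2_even (hf : SmoothDensity f) (s : ℝ) :
    autocorr (deriv (deriv f)) f (-s) = autocorr (deriv (deriv f)) f s := by
  have d1 : deriv (autocorr f f) = autocorr (deriv f) f := funext fun s => (hf.hasDerivAt_r s).deriv
  have d2 : deriv (autocorr (deriv f) f) = autocorr (deriv (deriv f)) f :=
    funext fun s => (hf.hasDerivAt_r1 s).deriv
  have h1 : ∀ s, autocorr (deriv f) f (-s) = -autocorr (deriv f) f s := fun s => by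
    have h2 := deriv_comp_neg (autocorr f f) s
    rw [funext (autocorr_neg f f), d1] at h2
    linarith
  have h2 := deriv_comp_neg (autocorr (deriv f) f) s
  rw [funext h1, deriv.fun_neg, d2] at h2
  linarith

theorem taylor_integral (hf : SmoothDensity f) (y s : ℝ) :
    f (y + s) - f y - s * deriv f y
      = ∫ t in Set.Ioc (0 : ℝ) 1, s ^ 2 * ((1 - t) * deriv (deriv f) (y + t * s)) := by
  have hc := hf.d2.continuous
  have h1 : ∀ t, HasDerivAt (fun t => (1 - t) * s * deriv f (y + t * s) + f (y + t * s))
      (s ^ 2 * ((1 - t) * deriv (deriv f) (y + t * s))) t := fun t => by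
    have e : HasDerivAt (fun t => y + t * s) s t := (hasDerivAt_mul_const s).const_add y
    have e1 := (hf.d1 (y + t * s)).hasDerivAt.comp t e
    have e0 := (hf.d0 (y + t * s)).hasDerivAt.comp t e
    have e2 : HasDerivAt (fun t : ℝ => (1 - t) * s) (-1 * s) t :=
      ((hasDerivAt_id' t).const_sub 1).mul_const s
    refine ((e2.mul e1).add e0).congr_deriv ?_
    simp only [Function.comp]
    ring
  have h2 := intervalIntegral.integral_eq_sub_of_hasDerivAt (a := 0) (b := 1)
    (fun t _ => h1 t) (Continuous.intervalIntegrable (by fun_prop) _ _)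
  rw [intervalIntegral.integral_of_le zero_le_one] at h2
  rw [h2]
  simp
  ring

/-- Since r'' is even, twice the left side is the second symmetric difference of r'', that is, of
`f` tested against f''. The terms ±s f' cancel there, and the integral Taylor remainders of `f`
leave only autocorrelations of f''. No fourth derivative is needed. -/
theorem r2_sub_r2_zero (hf : SmoothDensity f) (s : ℝ) :
    autocorr (deriv (deriv f)) f s - autocorr (deriv (deriv f)) f 0
      = s ^ 2 * ∫ t in Set.Ioc (0 : ℝ) 1,
        (1 - t) * autocorr (deriv (deriv f)) (deriv (deriv f)) (t * s) := by
  set p := deriv (deriv f) with hpdef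
  have hp : Continuous p := hf.d2.continuous
  have hi : Integrable fun y => p y ^ 2 := hf.int
  obtain ⟨C, hC⟩ := hf.b2
  have hsh : ∀ s, Integrable fun y => f (y + s) * p y := fun s =>
    (hf.dens.integrable.comp_add_right s).mul_bdd hp.aestronglyMeasurable (ae_of_all _ hC)
  have e0 : ∀ s, autocorr p f s = ∫ y, f (y + s) * p y := fun s => by
    rw [← hf.r2_even, ← hpdef, autocorr_neg, autocorr]
  have swap : ∀ s, ∫ y, (∫ t in Set.Ioc (0 : ℝ) 1, s ^ 2 * ((1 - t) * p (y + t * s))) * p y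
      = s ^ 2 * ∫ t in Set.Ioc (0 : ℝ) 1, (1 - t) * autocorr p p (t * s) := fun s => by
    have h1 := integral_integral_swap (f := fun t y : ℝ => (1 - t) * (p (y + t * s) * p y))
      (integrable_prod_shift_mul hp hi s)
    simp only [integral_const_mul] at h1
    have h2 : ∫ t in Set.Ioc (0 : ℝ) 1, (1 - t) * autocorr p p (t * s)
      = ∫ t in Set.Ioc (0 : ℝ) 1, (1 - t) * ∫ y, p (y + t * s) * p y := rfl
    rw [h2, h1, ← integral_const_mul]
    congr 1 with y
    rw [integral_const_mul, mul_assoc, ← integral_mul_const]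
    congr 2 with t
    ring
  have key : 2 * (autocorr p f s - autocorr p f 0)
      = ∫ y, ((f (y + s) - f y - s * deriv f y) + (f (y + -s) - f y - -s * deriv f y)) * p y := by
    have h3 : autocorr p f s - 2 * autocorr p f 0 + autocorr p f (-s)
        = 2 * (autocorr p f s - autocorr p f 0) := by rw [hf.r2_even]; ring
    rw [← h3, e0, e0, e0, ← integral_sub_two_mul_add (hsh s) (hsh 0) (hsh (-s))]
    congr 1 with y
    rw [add_zero]
    ring
  have hint : ∀ s, Integrable fun y =>
      (∫ t in Set.Ioc (0 : ℝ) 1, s ^ 2 * ((1 - t) * p (y + t * s))) * p y := fun s => by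
    have := (integrable_prod_shift_mul hp hi s).integral_prod_right.const_mul (s ^ 2)
    refine this.congr (ae_of_all _ fun y => ?_)
    simp only
    rw [← integral_mul_const, ← integral_const_mul]
    congr 1 with t
    ring
  simp only [taylor_integral hf, add_mul] at key
  rw [integral_add (hint s) (hint (-s)), swap, swap] at key
  simp only [mul_neg, autocorr_neg, neg_sq] at key
  linarith

theorem abs_r2_sub_le (hf : SmoothDensity f) (s : ℝ) :
    |autocorr (deriv (deriv f)) f s - autocorr (deriv (deriv f)) f 0|
      ≤ s ^ 2 * ∫ x, deriv (deriv f) x ^ 2 := by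
  rw [r2_sub_r2_zero hf, abs_mul, abs_of_nonneg (sq_nonneg s)]
  refine mul_le_mul_of_nonneg_left ?_ (sq_nonneg s)
  have := norm_setIntegral_le_of_norm_le_const (μ := volume) (s := Set.Ioc (0 : ℝ) 1)
    (C := ∫ x, deriv (deriv f) x ^ 2)
    (f := fun t => (1 - t) * autocorr (deriv (deriv f)) (deriv (deriv f)) (t * s))
    (by simp) (fun t ht => by
      have h2 : |1 - t| ≤ 1 := by rw [abs_le]; constructor <;> linarith [ht.1, ht.2]
      rw [Real.norm_eq_abs, abs_mul, ← one_mul (∫ x, deriv (deriv f) x ^ 2)]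
      exact mul_le_mul h2 (abs_autocorr_self_le hf.d2.continuous hf.int _) (abs_nonneg _)
        zero_le_one)
  simpa using this

theorem tendsto_r2_sub_div (hf : SmoothDensity f) :
    Tendsto (fun s => (autocorr (deriv (deriv f)) f s - autocorr (deriv (deriv f)) f 0) / s ^ 2)
      (nhdsWithin 0 {0}ᶜ) (nhds ((∫ x, deriv (deriv f) x ^ 2) / 2)) := by
  set p := deriv (deriv f) with hpdef
  set R := ∫ x, p x ^ 2 with hR
  have hp : Continuous p := hf.d2.continuous
  obtain ⟨C, hC⟩ := hf.b3
  have hG := tendsto_autocorr_self hp hf.int (abs_sub_le_of_deriv_bdd hf.d2 hC)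
  have hGm := measurable_autocorr_self hp
  have e1 : ∫ t in Set.Ioc (0 : ℝ) 1, (1 - t) * R = R / 2 := by
    rw [← intervalIntegral.integral_of_le zero_le_one, intervalIntegral.integral_mul_const,
      intervalIntegral.integral_sub intervalIntegrable_const intervalIntegral.intervalIntegrable_id]
    simp
    ring
  have h1 : Tendsto (fun s => ∫ t in Set.Ioc (0 : ℝ) 1, (1 - t) * autocorr p p (t * s))
      (nhdsWithin 0 {0}ᶜ) (nhds (R / 2)) := by
    rw [← e1]
    refine tendsto_integral_filter_of_dominated_convergence (fun _ => R)
      (Eventually.of_forall fun s => by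
        exact Measurable.aestronglyMeasurable (by fun_prop))
      (Eventually.of_forall fun s => (ae_restrict_iff' measurableSet_Ioc).2
        (ae_of_all _ fun t ht => ?_)) (integrable_const R) (ae_of_all _ fun t => ?_)
    · have h2 : |1 - t| ≤ 1 := by rw [abs_le]; constructor <;> linarith [ht.1, ht.2]
      rw [Real.norm_eq_abs, abs_mul, ← one_mul R]
      exact mul_le_mul h2 (abs_autocorr_self_le hp hf.int _) (abs_nonneg _) zero_le_one
    · refine (hG.comp ?_).const_mul (1 - t)
      have : Continuous fun s : ℝ => t * s := by fun_prop
      simpa using (this.tendsto 0).mono_left nhdsWithin_le_nhds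
  refine h1.congr' ?_
  filter_upwards [self_mem_nhdsWithin] with s hs
  rw [r2_sub_r2_zero hf, mul_div_cancel_left₀ _ (pow_ne_zero 2 hs)]

/-- Leading term of the second derivative of the integrated squared bias. -/
theorem tendsto_sq_bias_deriv2 (hf : SmoothDensity f) {K : ℝ → ℝ} (hK : Admissible K)
    (hd : IsDensity K) :
    Tendsto (fun h => (∫ u, u ^ 2 * (conv K K u - 2 * K u)
        * autocorr (deriv (deriv f)) f (h * u)) / h ^ 2)
      (nhdsWithin 0 (Set.Ioi 0))
      (nhds (3 * ((∫ u, u ^ 2 * K u) ^ 2 * ∫ x, deriv (deriv f) x ^ 2))) := by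
  set Q : ℝ → ℝ := fun u => conv K K u - 2 * K u with hQdef
  have hQ : RapidDecay Q := hK.conv_self.rapid.sub (hK.rapid.const_mul 2)
  set r2 := autocorr (deriv (deriv f)) f with hr2
  set R := ∫ x, deriv (deriv f) x ^ 2 with hR
  have hrc : Continuous r2 := hf.continuous_r2
  have hsplit : ∀ m : ℕ, ∫ u, u ^ m * Q u
      = (∫ u, u ^ m * conv K K u) - 2 * ∫ u, u ^ m * K u := fun m => by
    rw [← integral_const_mul, ← integral_sub (hK.conv_self.rapid.pow_mul m).integrable
      ((hK.rapid.pow_mul m).integrable.const_mul 2)]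
    congr 1 with u
    rw [hQdef]
    ring
  -- K * K has twice the second moment of K, so r''(0) can be subtracted at no cost and the fourth
  -- moment decides the limit.
  have m2 : ∫ u, u ^ 2 * Q u = 0 := by
    rw [hsplit, integral_sq_mul_conv hK hd, sub_self]
  have m4 : ∫ u, u ^ 4 * Q u = 6 * (∫ u, u ^ 2 * K u) ^ 2 := by
    rw [hsplit, integral_pow_four_mul_conv hK hd]
    ring
  obtain ⟨C, hC⟩ := hf.b2
  have hrC : ∀ s, |r2 s| ≤ C := abs_autocorr_le hf.dens hC
  have h1 : Tendsto (fun h => ∫ u, u ^ 4 * Q u * ((r2 (h * u) - r2 0) / (h * u) ^ 2))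
      (nhdsWithin 0 (Set.Ioi 0)) (nhds (∫ u, u ^ 4 * Q u * (R / 2))) := by
    refine tendsto_integral_filter_of_dominated_convergence (fun u => |u ^ 4 * Q u| * R)
      (Eventually.of_forall fun h => ?_) (Eventually.of_forall fun h => ae_of_all _ fun u => ?_)
      ((hQ.pow_mul 4).integrable.abs.mul_const R) ?_
    · have := hQ.cont.measurable
      have := hrc.measurable
      exact Measurable.aestronglyMeasurable (by fun_prop)
    · rw [Real.norm_eq_abs, abs_mul]
      refine mul_le_mul_of_nonneg_left ?_ (abs_nonneg _)
      rw [abs_div, abs_of_nonneg (sq_nonneg (h * u))]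
      exact div_le_of_le_mul₀ (sq_nonneg _) (integral_nonneg fun _ => sq_nonneg _)
        ((hf.abs_r2_sub_le (h * u)).trans (le_of_eq (mul_comm _ _)))
    · filter_upwards [compl_mem_ae_iff.2 (measure_singleton (μ := volume) (0 : ℝ))] with u hu
      refine (hf.tendsto_r2_sub_div.comp ?_).const_mul _
      refine tendsto_nhdsWithin_iff.2 ⟨?_, ?_⟩
      · have : Continuous fun h : ℝ => h * u := by fun_prop
        simpa using (this.tendsto 0).mono_left nhdsWithin_le_nhds
      · filter_upwards [self_mem_nhdsWithin] with h hh
        exact mul_ne_zero (ne_of_gt hh) hu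
  rw [integral_mul_const, m4] at h1
  have e : 6 * (∫ u, u ^ 2 * K u) ^ 2 * (R / 2) = 3 * ((∫ u, u ^ 2 * K u) ^ 2 * R) := by ring
  rw [e] at h1
  refine h1.congr' ?_
  filter_upwards [self_mem_nhdsWithin] with h hh
  have hh0 : h ≠ 0 := ne_of_gt hh
  have i1 : Integrable fun u => u ^ 2 * Q u * r2 (h * u) :=
    (hQ.pow_mul 2).integrable_mul_bdd (hrc.comp (continuous_const_mul h)).measurable
      (fun u => hrC _)
  have e2 : ∫ u, u ^ 2 * Q u * r2 (h * u) = ∫ u, u ^ 2 * Q u * (r2 (h * u) - r2 0) := by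
    simp only [mul_sub]
    rw [integral_sub i1 ((hQ.pow_mul 2).integrable.mul_const _), integral_mul_const, m2]
    ring
  rw [e2, ← integral_div]
  congr 1 with u
  rcases eq_or_ne u 0 with rfl | hu
  · simp
  · field_simp

end SmoothDensity

/-! ### Minimizers of a risk made of variance and squared bias -/

/-- The risk `A₀ / (n h) - a(h) / n + b(h)`: variance plus squared bias. -/
noncomputable def risk (A₀ : ℝ) (a b : ℝ → ℝ) (n : ℕ) (h : ℝ) : ℝ :=
  A₀ / (n * h) - a h / n + b h

/-- The analytic properties of the mean integrated squared error that determine the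
behaviour of its minimizers. -/
structure RiskProfile (A₀ r₀ β : ℝ) (a a₁ a₂ b b₁ b₂ : ℝ → ℝ) : Prop where
  A₀_pos : 0 < A₀
  r₀_pos : 0 < r₀
  β_pos : 0 < β
  da : ∀ h, HasDerivAt a (a₁ h) h
  da₁ : ∀ h, HasDerivAt a₁ (a₂ h) h
  db : ∀ h, HasDerivAt b (b₁ h) h
  db₁ : ∀ h, HasDerivAt b₁ (b₂ h) h
  a_bdd : ∃ C, ∀ h, |a h| ≤ C
  a₂_bdd : ∃ C, ∀ h, |a₂ h| ≤ C
  a_le : ∃ C, ∀ h, 0 < h → |a h| ≤ C / h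
  b_le : ∃ C, ∀ h, 0 < h → |b h - r₀| ≤ C / h
  b_zero : b 0 = 0
  b₁_zero : b₁ 0 = 0
  b_pos : ∀ h, 0 < h → 0 < b h
  b₂_lim : Tendsto (fun h => b₂ h / h ^ 2) (𝓝[>] 0) (𝓝 (3 * β))

namespace RiskProfile

variable {A₀ r₀ β : ℝ} {a a₁ a₂ b b₁ b₂ : ℝ → ℝ}

theorem hasDerivAt_risk (H : RiskProfile A₀ r₀ β a a₁ a₂ b b₁ b₂) (n : ℕ) {h : ℝ} (hh : h ≠ 0) :
    HasDerivAt (risk A₀ a b n) (-(A₀ / (n * h ^ 2)) - a₁ h / n + b₁ h) h := by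
  have e : risk A₀ a b n = fun h => A₀ / n * h⁻¹ - a h / n + b h := by
    ext h; rw [risk, div_mul_eq_div_div, div_eq_mul_inv (A₀ / n)]
  rw [e]
  refine ((((hasDerivAt_inv hh).const_mul (A₀ / n)).sub ((H.da h).div_const n)).add
    (H.db h)).congr_deriv ?_
  rw [div_mul_eq_div_div, div_eq_mul_inv (A₀ / n)]
  ring

theorem hasDerivAt_risk' (H : RiskProfile A₀ r₀ β a a₁ a₂ b b₁ b₂) (n : ℕ) {h : ℝ}
    (hh : h ≠ 0) :
    HasDerivAt (fun h => -(A₀ / (n * h ^ 2)) - a₁ h / n + b₁ h)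
      (2 * A₀ / (n * h ^ 3) - a₂ h / n + b₂ h) h := by
  have e : (fun h => -(A₀ / (n * h ^ 2)) - a₁ h / n + b₁ h)
      = fun h => A₀ / n * -(h ^ 2)⁻¹ - a₁ h / n + b₁ h := by
    ext h; rw [div_mul_eq_div_div, div_eq_mul_inv (A₀ / n)]; ring
  rw [e]
  refine ((((hasDerivAt_neg_inv_sq hh).const_mul (A₀ / n)).sub ((H.da₁ h).div_const n)).add
    (H.db₁ h)).congr_deriv ?_
  rw [div_mul_eq_div_div, div_eq_mul_inv _ (h ^ 3)]
  ring

theorem continuous_b (H : RiskProfile A₀ r₀ β a a₁ a₂ b b₁ b₂) : Continuous b :=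
  continuous_iff_continuousAt.2 fun h => (H.db h).continuousAt

theorem exists_b_lt (H : RiskProfile A₀ r₀ β a a₁ a₂ b b₁ b₂) {ε : ℝ} (hε : 0 < ε) :
    ∃ h, 0 < h ∧ b h < ε := by
  have h1 : Tendsto b (𝓝[>] 0) (𝓝 0) := by
    have := H.continuous_b.tendsto 0
    rw [H.b_zero] at this
    exact this.mono_left nhdsWithin_le_nhds
  have h2 : ∀ᶠ h : ℝ in 𝓝[>] 0, 0 < h := self_mem_nhdsWithin
  exact (h2.and (h1.eventually_lt_const hε)).exists

theorem tendsto_risk_const (A₀ : ℝ) (a b : ℝ → ℝ) (h : ℝ) :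
    Tendsto (fun n => risk A₀ a b n h) atTop (𝓝 (b h)) := by
  have h1 := ((tendsto_const_div_atTop_nhds_zero_nat (A₀ / h)).sub
    (tendsto_const_div_atTop_nhds_zero_nat (a h))).add_const (b h)
  rw [sub_zero, zero_add] at h1
  refine h1.congr fun n => ?_
  rw [risk, div_div, mul_comm h]

/-- At some fixed bandwidth the risk is eventually below r₀/2. It exceeds that level near 0, through
A₀/(nh), and near infinity, where b tends to r₀, so a minimum over a compact interval is global. -/
theorem eventually_exists_min (H : RiskProfile A₀ r₀ β a a₁ a₂ b b₁ b₂) :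
    ∀ᶠ n : ℕ in atTop, ∃ h, IsOptimalBandwidth (risk A₀ a b n) h := by
  obtain ⟨hs, hs0, hs1⟩ := H.exists_b_lt (half_pos H.r₀_pos)
  obtain ⟨C, hC⟩ := H.a_bdd
  obtain ⟨D, hD⟩ := H.a_le
  obtain ⟨E, hE⟩ := H.b_le
  have hrp := H.r₀_pos
  filter_upwards [(tendsto_risk_const A₀ a b hs).eventually_lt_const hs1, eventually_ge_atTop 1]
    with n hn hn1
  have hn1' : (1 : ℝ) ≤ n := by exact_mod_cast hn1
  have hn0 : (0 : ℝ) < n := by linarith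
  have small : ∀ᶠ h : ℝ in 𝓝[>] 0, r₀ / 2 ≤ risk A₀ a b n h := by
    have h1 : Tendsto (fun h : ℝ => A₀ / n * h⁻¹ - C / n) (𝓝[>] 0) atTop :=
      tendsto_atTop_add_const_right _ _
        (tendsto_inv_nhdsGT_zero.const_mul_atTop (div_pos H.A₀_pos hn0))
    filter_upwards [h1.eventually_ge_atTop (r₀ / 2), self_mem_nhdsWithin] with h h2 h3
    have h4 : a h / n ≤ C / n := by
      gcongr; exact (le_abs_self _).trans (hC h)
    rw [risk, div_mul_eq_div_div, div_eq_mul_inv (A₀ / n)]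
    linarith [H.b_pos h h3]
  have large : ∀ᶠ h : ℝ in atTop, r₀ / 2 ≤ risk A₀ a b n h := by
    have h1 : Tendsto (fun h : ℝ => (|D| + E) / h) atTop (𝓝 0) :=
      tendsto_const_nhds.div_atTop tendsto_id
    filter_upwards [h1.eventually_lt_const (half_pos hrp), eventually_gt_atTop 0] with h h2 h3
    have h4 : a h / n ≤ |D| / h := by
      calc a h / n ≤ |a h| / n := by gcongr; exact le_abs_self _
        _ ≤ |a h| := div_le_self (abs_nonneg _) hn1'
        _ ≤ D / h := hD h h3
        _ ≤ |D| / h := by gcongr; exact le_abs_self _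
    have h5 := (abs_le.1 (hE h h3)).1
    rw [add_div] at h2
    have h6 : 0 < A₀ / (n * h) := div_pos H.A₀_pos (by positivity)
    rw [risk]
    linarith
  obtain ⟨δ, hδ0, hδ⟩ := (mem_nhdsGT_iff_exists_Ioc_subset (a := (0:ℝ))).1 small
  obtain ⟨T, hT⟩ := eventually_atTop.1 large
  have hδ0' : (0:ℝ) < δ := hδ0
  have hcont : ContinuousOn (risk A₀ a b n) (Set.Icc (min δ hs) (max T hs)) := fun h hh =>
    (H.hasDerivAt_risk n
      (ne_of_gt (lt_of_lt_of_le (lt_min hδ0' hs0) hh.1))).continuousAt.continuousWithinAt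
  obtain ⟨h₁, hh₁, hmin⟩ := isCompact_Icc.exists_isMinOn
    ⟨hs, min_le_right _ _, le_max_right _ _⟩ hcont
  have hle : risk A₀ a b n h₁ ≤ risk A₀ a b n hs := hmin ⟨min_le_right _ _, le_max_right _ _⟩
  refine ⟨h₁, lt_of_lt_of_le (lt_min hδ0' hs0) hh₁.1, fun h hh => ?_⟩
  simp only [Set.mem_Ioi] at hh
  change risk A₀ a b n h₁ ≤ risk A₀ a b n h
  rcases lt_or_ge h (min δ hs) with h1 | h1
  · have : r₀ / 2 ≤ risk A₀ a b n h := hδ ⟨hh, h1.le.trans (min_le_left _ _)⟩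
    linarith
  · rcases le_or_gt h (max T hs) with h2 | h2
    · exact hmin ⟨h1, h2⟩
    · have := hT h ((le_max_left _ _).trans h2.le)
      linarith

theorem exists_b_ge (H : RiskProfile A₀ r₀ β a a₁ a₂ b b₁ b₂) {η : ℝ} (hη : 0 < η) :
    ∃ m, 0 < m ∧ ∀ h, η ≤ h → m ≤ b h := by
  obtain ⟨E, hE⟩ := H.b_le
  have hrp := H.r₀_pos
  have large : ∀ᶠ h : ℝ in atTop, r₀ / 2 ≤ b h := by
    have h1 : Tendsto (fun h : ℝ => E / h) atTop (𝓝 0) := tendsto_const_nhds.div_atTop tendsto_id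
    filter_upwards [h1.eventually_lt_const (half_pos hrp), eventually_gt_atTop 0] with h h2 h3
    have h5 := (abs_le.1 (hE h h3)).1
    linarith
  obtain ⟨T, hT⟩ := eventually_atTop.1 large
  obtain ⟨h₁, hh₁, hmin⟩ := isCompact_Icc.exists_isMinOn (s := Set.Icc η (max T η))
    ⟨η, le_rfl, le_max_right _ _⟩ H.continuous_b.continuousOn
  refine ⟨min (b h₁) (r₀ / 2), lt_min (H.b_pos _ (hη.trans_le hh₁.1)) (by positivity),
    fun h hh => ?_⟩
  rcases le_or_gt h (max T η) with h2 | h2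
  · exact (min_le_left _ _).trans (hmin ⟨hh, h2⟩)
  · exact (min_le_right _ _).trans (hT h ((le_max_left _ _).trans h2.le))

section minimizers

variable {h₀ : ℕ → ℝ}

/-- On [η, ∞) the bias b stays above some m > 0, and the risk there is at least m - C/n. A fixed h'
with b(h') < m does better for large n. -/
theorem tendsto_min (H : RiskProfile A₀ r₀ β a a₁ a₂ b b₁ b₂)
    (hmin : ∀ᶠ n in atTop, IsOptimalBandwidth (risk A₀ a b n) (h₀ n)) :
    Tendsto h₀ atTop (𝓝[>] 0) := by
  have hpos : ∀ᶠ n in atTop, 0 < h₀ n := hmin.mono fun n h => h.1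
  refine tendsto_nhdsWithin_iff.2 ⟨?_, hpos⟩
  rw [Metric.tendsto_nhds]
  intro η hη
  obtain ⟨m, hm, hbm⟩ := H.exists_b_ge hη
  obtain ⟨h', hh', hb'⟩ := H.exists_b_lt hm
  obtain ⟨C, hC⟩ := H.a_bdd
  have h1 := (tendsto_risk_const A₀ a b h').add (tendsto_const_div_atTop_nhds_zero_nat C)
  rw [add_zero] at h1
  filter_upwards [h1.eventually_lt_const hb', hmin, eventually_ge_atTop 1] with n h2 h3 hn
  have hn0 : (0 : ℝ) < n := by exact_mod_cast hn
  have h3p := h3.1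
  rw [Real.dist_eq, sub_zero, abs_of_pos h3p]
  by_contra h4
  have h5 : risk A₀ a b n (h₀ n) ≤ risk A₀ a b n h' := h3.2 hh'
  have h6 : b (h₀ n) - C / n ≤ risk A₀ a b n (h₀ n) := by
    have h7 : a (h₀ n) / n ≤ C / n := by gcongr; exact (le_abs_self _).trans (hC _)
    have h8 : 0 < A₀ / (n * h₀ n) := div_pos H.A₀_pos (by positivity)
    rw [risk]
    linarith
  linarith [hbm (h₀ n) (not_lt.1 h4)]

theorem deriv_eq_zero (H : RiskProfile A₀ r₀ β a a₁ a₂ b b₁ b₂) {n : ℕ} {h : ℝ}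
    (hmin : IsOptimalBandwidth (risk A₀ a b n) h) :
    -(A₀ / (n * h ^ 2)) - a₁ h / n + b₁ h = 0 :=
  (hmin.2.isLocalMin (Ioi_mem_nhds hmin.1)).hasDerivAt_eq_zero
    (H.hasDerivAt_risk n hmin.1.ne')

theorem tendsto_b₁_div (H : RiskProfile A₀ r₀ β a a₁ a₂ b b₁ b₂) :
    Tendsto (fun h => b₁ h / h ^ 3) (𝓝[>] 0) (𝓝 β) := by
  have hpos : ∀ᶠ h : ℝ in 𝓝[>] 0, 0 < h := self_mem_nhdsWithin
  refine HasDerivAt.lhopital_zero_nhdsGT (f' := b₂) (g' := fun h => 3 * h ^ 2)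
    (Eventually.of_forall H.db₁) (Eventually.of_forall fun h => by
      simpa using hasDerivAt_pow 3 h) (hpos.mono fun h hh => by positivity) ?_ ?_ ?_
  · have := (H.db₁ 0).continuousAt.tendsto
    rw [H.b₁_zero] at this
    exact this.mono_left nhdsWithin_le_nhds
  · have : Continuous fun h : ℝ => h ^ 3 := by fun_prop
    simpa using (this.tendsto 0).mono_left nhdsWithin_le_nhds
  · have h1 := H.b₂_lim.div_const 3
    rw [mul_div_cancel_left₀ β three_ne_zero] at h1
    refine h1.congr fun h => ?_
    rw [div_div, mul_comm]

/-- Multiplied by nh², the first-order condition reads nh⁵ · b₁(h)/h³ = A₀ + h² a₁(h), and b₁(h)/h³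
tends to β. -/
theorem tendsto_mul_pow_five (H : RiskProfile A₀ r₀ β a a₁ a₂ b b₁ b₂)
    (hmin : ∀ᶠ n in atTop, IsOptimalBandwidth (risk A₀ a b n) (h₀ n)) :
    Tendsto (fun n : ℕ => n * h₀ n ^ 5) atTop (𝓝 (A₀ / β)) := by
  have h0 := H.tendsto_min hmin
  have h0' : Tendsto h₀ atTop (𝓝 0) := h0.mono_right nhdsWithin_le_nhds
  have hb := H.tendsto_b₁_div.comp h0
  have ha : Tendsto (fun n => A₀ + h₀ n ^ 2 * a₁ (h₀ n)) atTop (𝓝 A₀) := by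
    have := ((h0'.pow 2).mul ((H.da₁ 0).continuousAt.tendsto.comp h0')).const_add A₀
    simpa using this
  refine (ha.div hb H.β_pos.ne').congr' ?_
  filter_upwards [hmin, hb.eventually_ne H.β_pos.ne', eventually_ge_atTop 1] with n hn hne hn1
  have hn0 : (n : ℝ) ≠ 0 := by exact_mod_cast (by omega : n ≠ 0)
  have hh := hn.1.ne'
  have h1 := H.deriv_eq_zero hn
  simp only [Function.comp] at hne ⊢
  simp only [Pi.div_apply, Function.comp]
  rw [div_eq_iff hne]
  field_simp at h1 ⊢
  linarith

/-- The variance contributes 2A₀; the bias contributes nh⁵ · b₂(h)/h², which tends to (A₀/β)(3β) =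
3A₀. -/
theorem tendsto_deriv2 (H : RiskProfile A₀ r₀ β a a₁ a₂ b b₁ b₂)
    (hmin : ∀ᶠ n in atTop, IsOptimalBandwidth (risk A₀ a b n) (h₀ n)) :
    Tendsto (fun n : ℕ => n * h₀ n ^ 3
        * (2 * A₀ / (n * h₀ n ^ 3) - a₂ (h₀ n) / n + b₂ (h₀ n)))
      atTop (𝓝 (5 * A₀)) := by
  have h0 := H.tendsto_min hmin
  have h0' : Tendsto h₀ atTop (𝓝 0) := h0.mono_right nhdsWithin_le_nhds
  obtain ⟨C, hC⟩ := H.a₂_bdd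
  have ha : Tendsto (fun n => h₀ n ^ 3 * a₂ (h₀ n)) atTop (𝓝 0) := by
    have h1 := h0'.pow 3
    simp only [ne_eq, OfNat.ofNat_ne_zero, not_false_eq_true, zero_pow] at h1
    exact h1.zero_mul_isBoundedUnder_le
      (isBoundedUnder_of ⟨C, fun n => hC _⟩)
  have hb := (H.tendsto_mul_pow_five hmin).mul (H.b₂_lim.comp h0)
  have hs := (ha.const_sub (2 * A₀)).add hb
  have e : 2 * A₀ - 0 + A₀ / β * (3 * β) = 5 * A₀ := by
    have := H.β_pos.ne'
    field_simp
    ring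
  rw [e] at hs
  refine hs.congr' ?_
  filter_upwards [hmin, eventually_ge_atTop 1] with n hn hn1
  have hn0 : (n : ℝ) ≠ 0 := by exact_mod_cast (by omega : n ≠ 0)
  have hh := hn.1.ne'
  simp only [Function.comp]
  field_simp

end minimizers

end RiskProfile

theorem riskProfile {f K : ℝ → ℝ} (hf : SmoothDensity f) (hK : Admissible K) (hd : IsDensity K) :
    RiskProfile (conv K K 0) (autocorr f f 0)
      ((∫ u, u ^ 2 * K u) ^ 2 * ∫ x, deriv (deriv f) x ^ 2)
      (fun h => ∫ u, conv K K u * autocorr f f (h * u))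
      (fun h => ∫ u, u * conv K K u * autocorr (deriv f) f (h * u))
      (fun h => ∫ u, u ^ 2 * conv K K u * autocorr (deriv (deriv f)) f (h * u))
      (fun h => (∫ u, (conv K K u - 2 * K u) * autocorr f f (h * u)) + autocorr f f 0)
      (fun h => ∫ u, u * (conv K K u - 2 * K u) * autocorr (deriv f) f (h * u))
      (fun h => ∫ u, u ^ 2 * (conv K K u - 2 * K u) * autocorr (deriv (deriv f)) f (h * u)) := by
  have hA : RapidDecay (conv K K) := hK.conv_self.rapid
  have hQ : RapidDecay fun u => conv K K u - 2 * K u := hA.sub (hK.rapid.const_mul 2)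
  obtain ⟨F, hF⟩ := hf.b0
  obtain ⟨F₁, hF₁⟩ := hf.b1
  obtain ⟨F₂, hF₂⟩ := hf.b2
  have hr := abs_autocorr_le hf.dens hF
  have hr₁ := abs_autocorr_le hf.dens hF₁
  have hr₂ := abs_autocorr_le hf.dens hF₂
  obtain ⟨CK, -, hCK⟩ := hK.rapid.bounded
  have first : ∀ {p : ℝ → ℝ}, RapidDecay p → ∀ h, HasDerivAt
      (fun h => ∫ u, p u * autocorr f f (h * u)) (∫ u, u * p u * autocorr (deriv f) f (h * u)) h :=
    fun hp h => hasDerivAt_integral_dilate hp.integrable hp.id_mul.integrable hf.hasDerivAt_r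
      hr hr₁ h
  have second : ∀ {p : ℝ → ℝ}, RapidDecay p → ∀ h, HasDerivAt
      (fun h => ∫ u, u * p u * autocorr (deriv f) f (h * u))
      (∫ u, u ^ 2 * p u * autocorr (deriv (deriv f)) f (h * u)) h := fun {p} hp h => by
    have := hasDerivAt_integral_dilate hp.id_mul.integrable hp.id_mul.id_mul.integrable
      hf.hasDerivAt_r1 hr₁ hr₂ h
    refine this.congr_deriv ?_
    congr 1 with u
    ring
  have bdd : ∀ {p q : ℝ → ℝ} {C : ℝ}, RapidDecay p → (∀ s, |q s| ≤ C) → ∀ h,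
      |∫ u, p u * q (h * u)| ≤ (∫ u, |p u|) * C := fun {p q C} hp hq h => by
    have := norm_integral_le_of_norm_le (f := fun u => p u * q (h * u)) (μ := volume)
      (hp.integrable.abs.mul_const C) (ae_of_all _ fun u => by
        rw [Real.norm_eq_abs, abs_mul]
        exact mul_le_mul_of_nonneg_left (hq _) (abs_nonneg _))
    rwa [integral_mul_const] at this
  refine ⟨?_, hf.autocorr_zero_pos, ?_, first hA, second hA, fun h => (first hQ h).add_const _,
    second hQ, ⟨_, bdd hA hr⟩, ⟨_, bdd (hA.pow_mul 2) hr₂⟩, ?_, ?_, ?_, ?_, ?_,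
    hf.tendsto_sq_bias_deriv2 hK hd⟩
  · rw [hK.conv_self_zero]
    exact hd.integral_sq_pos hK.diff.continuous hCK
  · have := hK.second_moment_pos hd
    have := hf.sq_deriv_pos
    positivity
  · obtain ⟨C, -, hC⟩ := hA.bounded
    exact ⟨C, fun h hh => abs_integral_mul_autocorr_le hf.dens hC hh⟩
  · obtain ⟨C, -, hC⟩ := hQ.bounded
    refine ⟨C, fun h hh => ?_⟩
    simp only [add_sub_cancel_right]
    exact abs_integral_mul_autocorr_le hf.dens hC hh
  -- At h = 0 the factor r(0) comes out, and A - 2K has integral 1 - 2 = -1.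
  · simp only [zero_mul, integral_mul_const]
    rw [integral_sub hA.integrable (hd.integrable.const_mul 2), integral_const_mul,
      integral_conv hK hd, hd.integral_eq_one]
    ring
  · simp only [zero_mul, integral_mul_const]
    rw [integral_eq_zero_of_odd, zero_mul]
    intro u
    rw [hK.even, hK.conv_self.even]
    ring
  · exact fun h hh => hf.sq_bias_pos hK hd hh.ne'

/-! ### Covariances of pair sums -/

section ustat

variable {Ω : Type*} [MeasurableSpace Ω] {P : Measure Ω}
  {X : ℕ → Ω → ℝ} {μ : Measure ℝ} {S T : ℝ → ℝ → ℝ}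

theorem integral_disjoint (hXm : ∀ i, Measurable (X i)) (hXi : iIndepFun X P)
    (hSm : Measurable fun z : ℝ × ℝ => S z.1 z.2) (hTm : Measurable fun z : ℝ × ℝ => T z.1 z.2)
    {i j k l : ℕ} (hik : i ≠ k) (hil : i ≠ l) (hjk : j ≠ k) (hjl : j ≠ l) :
    ∫ ω, S (X i ω) (X j ω) * T (X k ω) (X l ω) ∂P
      = (∫ ω, S (X i ω) (X j ω) ∂P) * ∫ ω, T (X k ω) (X l ω) ∂P := by
  have h1 := (hXi.indepFun_prodMk_prodMk hXm i j k l hik hil hjk hjl).comp hSm hTm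
  exact h1.integral_fun_mul_eq_mul_integral
    (hSm.comp ((hXm i).prodMk (hXm j))).aestronglyMeasurable
    (hTm.comp ((hXm k).prodMk (hXm l))).aestronglyMeasurable

variable [IsProbabilityMeasure P]

theorem map_pair (hXm : ∀ i, Measurable (X i)) (hXi : iIndepFun X P) (hμ : ∀ i, P.map (X i) = μ)
    {i j : ℕ} (hij : i ≠ j) :
    P.map (fun ω => (X i ω, X j ω)) = μ.prod μ := by
  rw [(indepFun_iff_map_prod_eq_prod_map_map (hXm i).aemeasurable (hXm j).aemeasurable).1
    (hXi.indepFun hij), hμ, hμ]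

theorem map_triple (hXm : ∀ i, Measurable (X i)) (hXi : iIndepFun X P)
    (hμ : ∀ i, P.map (X i) = μ) {i j k : ℕ} (hij : i ≠ j) (hik : i ≠ k) (hjk : j ≠ k) :
    P.map (fun ω => ((X i ω, X j ω), X k ω)) = (μ.prod μ).prod μ := by
  rw [(indepFun_iff_map_prod_eq_prod_map_map ((hXm i).prodMk (hXm j)).aemeasurable
    (hXm k).aemeasurable).1 (hXi.indepFun_prodMk hXm i j k hik hjk), map_pair hXm hXi hμ hij, hμ]

theorem integral_pair (hXm : ∀ i, Measurable (X i)) (hXi : iIndepFun X P)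
    (hμ : ∀ i, P.map (X i) = μ) (hT : Measurable fun z : ℝ × ℝ => T z.1 z.2)
    {i j : ℕ} (hij : i ≠ j) :
    ∫ ω, T (X i ω) (X j ω) ∂P = ∫ z, T z.1 z.2 ∂(μ.prod μ) := by
  rw [← map_pair hXm hXi hμ hij, integral_map ((hXm i).prodMk (hXm j)).aemeasurable
    hT.aestronglyMeasurable]

theorem integrable_pair (hXm : ∀ i, Measurable (X i)) (hXi : iIndepFun X P)
    (hμ : ∀ i, P.map (X i) = μ) (hTi : Integrable (fun z : ℝ × ℝ => T z.1 z.2) (μ.prod μ))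
    {i j : ℕ} (hij : i ≠ j) : Integrable (fun ω => T (X i ω) (X j ω)) P := by
  rw [← map_pair hXm hXi hμ hij] at hTi
  exact hTi.comp_measurable ((hXm i).prodMk (hXm j))

variable [IsProbabilityMeasure μ]

theorem abs_integral_prod_le {s : ℝ} (hSi : Integrable (fun z : ℝ × ℝ => S z.1 z.2) (μ.prod μ))
    (hs : ∀ x, |∫ y, S x y ∂μ| ≤ s) : |∫ z, S z.1 z.2 ∂(μ.prod μ)| ≤ s := by
  rw [integral_prod _ hSi]
  simpa using norm_integral_le_of_norm_le_const (μ := μ)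
    (f := fun x => ∫ y, S x y ∂μ) (ae_of_all _ hs)

/-- Given the shared variable the two factors are independent, so the expectation is that of a
product of two projections. Only S has to be bounded: T will be built from `opW`, which contains K''
and is merely integrable. -/
theorem abs_integral_shared_le (hXm : ∀ i, Measurable (X i)) (hXi : iIndepFun X P)
    (hμ : ∀ i, P.map (X i) = μ) {B s t : ℝ}
    (hSm : Measurable fun z : ℝ × ℝ => S z.1 z.2) (hSB : ∀ x y, |S x y| ≤ B)
    (hTm : Measurable fun z : ℝ × ℝ => T z.1 z.2)
    (hTi : Integrable (fun z : ℝ × ℝ => T z.1 z.2) (μ.prod μ))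
    (hs : ∀ x, |∫ y, S x y ∂μ| ≤ s) (ht : ∀ x, |∫ y, T x y ∂μ| ≤ t)
    {i j k : ℕ} (hij : i ≠ j) (hik : i ≠ k) (hjk : j ≠ k) :
    |∫ ω, S (X i ω) (X j ω) * T (X i ω) (X k ω) ∂P| ≤ s * t := by
  have hs0 : 0 ≤ s := (abs_nonneg _).trans (hs 0)
  have hm : Measurable fun z : (ℝ × ℝ) × ℝ => S z.1.1 z.1.2 * T z.1.1 z.2 :=
    (hSm.comp measurable_fst).mul
      (hTm.comp ((measurable_fst.comp measurable_fst).prodMk measurable_snd))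
  have hXt : Measurable fun ω => ((X i ω, X j ω), X k ω) :=
    ((hXm i).prodMk (hXm j)).prodMk (hXm k)
  have hiP : Integrable (fun ω => S (X i ω) (X j ω) * T (X i ω) (X k ω)) P :=
    (integrable_pair hXm hXi hμ hTi hik).bdd_mul
      (hSm.comp ((hXm i).prodMk (hXm j))).aestronglyMeasurable (ae_of_all _ fun ω => hSB _ _)
  have hi : Integrable (fun z : (ℝ × ℝ) × ℝ => S z.1.1 z.1.2 * T z.1.1 z.2)
      ((μ.prod μ).prod μ) := by
    rw [← map_triple hXm hXi hμ hij hik hjk]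
    exact (integrable_map_measure hm.aestronglyMeasurable hXt.aemeasurable).2 hiP
  have e1 : ∫ ω, S (X i ω) (X j ω) * T (X i ω) (X k ω) ∂P
      = ∫ z : (ℝ × ℝ) × ℝ, S z.1.1 z.1.2 * T z.1.1 z.2 ∂((μ.prod μ).prod μ) := by
    rw [← map_triple hXm hXi hμ hij hik hjk, integral_map hXt.aemeasurable
      hm.aestronglyMeasurable]
  have hi2 := hi.integral_prod_left
  rw [e1, integral_prod _ hi]
  simp only [integral_const_mul] at hi2 ⊢
  rw [integral_prod _ hi2]
  simp only [integral_mul_const]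
  have := norm_integral_le_of_norm_le_const (μ := μ)
    (f := fun x => (∫ y, S x y ∂μ) * ∫ y, T x y ∂μ) (C := s * t) (ae_of_all _ fun x => by
      rw [Real.norm_eq_abs, abs_mul]
      exact mul_le_mul (hs x) (ht x) (abs_nonneg _) hs0)
  simpa using this

/-- The cases go by the number of common indices. Two give ∫ST, by symmetry also for the swapped
pair; one gives two quantities of size at most st, whence 2st; none gives zero by independence. The
four indicators on the right count coincidences. -/
theorem abs_cov_sub_le (hXm : ∀ i, Measurable (X i)) (hXi : iIndepFun X P)
    (hμ : ∀ i, P.map (X i) = μ) {B s t : ℝ}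
    (hSm : Measurable fun z : ℝ × ℝ => S z.1 z.2) (hSB : ∀ x y, |S x y| ≤ B)
    (hSs : ∀ x y, S x y = S y x) (hTs : ∀ x y, T x y = T y x)
    (hTm : Measurable fun z : ℝ × ℝ => T z.1 z.2)
    (hTi : Integrable (fun z : ℝ × ℝ => T z.1 z.2) (μ.prod μ))
    (hs : ∀ x, |∫ y, S x y ∂μ| ≤ s) (ht : ∀ x, |∫ y, T x y ∂μ| ≤ t)
    {i j k l : ℕ} (hij : i ≠ j) (hkl : k ≠ l) :
    |(∫ ω, S (X i ω) (X j ω) * T (X k ω) (X l ω) ∂P)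
      - (∫ z, S z.1 z.2 ∂(μ.prod μ)) * (∫ z, T z.1 z.2 ∂(μ.prod μ))
      - (if k = i ∧ l = j then ∫ z, S z.1 z.2 * T z.1 z.2 ∂(μ.prod μ) else 0)
      - (if k = j ∧ l = i then ∫ z, S z.1 z.2 * T z.1 z.2 ∂(μ.prod μ) else 0)|
      ≤ 2 * s * t * ((if k = i then 1 else 0) + (if k = j then 1 else 0)
        + (if l = i then 1 else 0) + (if l = j then 1 else 0)) := by
  have hs0 : 0 ≤ s := (abs_nonneg _).trans (hs 0)
  have ht0 : 0 ≤ t := (abs_nonneg _).trans (ht 0)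
  have hst : 0 ≤ s * t := mul_nonneg hs0 ht0
  have hSi : Integrable (fun z : ℝ × ℝ => S z.1 z.2) (μ.prod μ) :=
    (integrable_const B).mono' hSm.aestronglyMeasurable (ae_of_all _ fun z => hSB _ _)
  have hES := abs_integral_prod_le hSi hs
  have hET := abs_integral_prod_le hTi ht
  have hEE : |(∫ z, S z.1 z.2 ∂(μ.prod μ)) * (∫ z, T z.1 z.2 ∂(μ.prod μ))| ≤ s * t := by
    rw [abs_mul]
    exact mul_le_mul hES hET (abs_nonneg _) hs0
  have hSTm : Measurable fun z : ℝ × ℝ => S z.1 z.2 * T z.1 z.2 := hSm.mul hTm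
  have hshared := fun {i j k : ℕ} => abs_integral_shared_le hXm hXi hμ hSm hSB hTm hTi hs ht
    (i := i) (j := j) (k := k)
  have shared : ∀ {I : ℝ}, |I| ≤ s * t →
      |I - (∫ z, S z.1 z.2 ∂(μ.prod μ)) * (∫ z, T z.1 z.2 ∂(μ.prod μ))| ≤ 2 * s * t :=
    fun {I} hI => (abs_sub _ _).trans (by linarith)
  by_cases h1 : k = i
  · subst h1
    by_cases h2 : l = j
    · subst h2
      rw [integral_pair (T := fun x y => S x y * T x y) hXm hXi hμ hSTm hij]
      simp only [and_self, if_true, hkl, hkl.symm, if_false]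
      rw [abs_le] at hEE ⊢
      constructor <;> linarith
    · simp only [h2, hij, hkl.symm, and_false, if_true, if_false, sub_zero, add_zero,
        mul_one]
      exact shared (hshared hij hkl (Ne.symm h2))
  · by_cases h2 : k = j
    · subst h2
      by_cases h3 : l = i
      · subst h3
        simp only [hTs (X k _)]
        rw [integral_pair (T := fun x y => S x y * T x y) hXm hXi hμ hSTm hij]
        simp only [and_self, if_true, hkl, hkl.symm, if_false]
        rw [abs_le] at hEE ⊢
        constructor <;> linarith
      · simp only [h1, h3, hkl.symm, and_false, if_true, if_false, sub_zero, add_zero,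
          zero_add, mul_one]
        simp only [hSs (X i _)]
        exact shared (hshared hij.symm hkl (Ne.symm h3))
    · simp only [h1, h2, false_and, if_false, sub_zero, zero_add]
      by_cases h3 : l = i
      · subst h3
        simp only [hij, if_true, if_false, add_zero, mul_one]
        simp only [hTs (X k _)]
        exact shared (hshared hij hkl.symm (Ne.symm h2))
      · by_cases h4 : l = j
        · subst h4
          simp only [hij.symm, if_true, if_false, zero_add, mul_one]
          simp only [hTs (X k _), hSs (X i _)]
          exact shared (hshared hij.symm hkl.symm (Ne.symm h1))
        · rw [integral_disjoint hXm hXi hSm hTm (Ne.symm h1) (Ne.symm h3) (Ne.symm h2)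
            (Ne.symm h4), integral_pair hXm hXi hμ hSm hij, integral_pair hXm hXi hμ hTm hkl]
          simp [h3, h4]

theorem abs_sum_cov_sub_le (hXm : ∀ i, Measurable (X i)) (hXi : iIndepFun X P)
    (hμ : ∀ i, P.map (X i) = μ) {B s t : ℝ}
    (hSm : Measurable fun z : ℝ × ℝ => S z.1 z.2) (hSB : ∀ x y, |S x y| ≤ B)
    (hSs : ∀ x y, S x y = S y x) (hTs : ∀ x y, T x y = T y x)
    (hTm : Measurable fun z : ℝ × ℝ => T z.1 z.2)
    (hTi : Integrable (fun z : ℝ × ℝ => T z.1 z.2) (μ.prod μ))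
    (hs : ∀ x, |∫ y, S x y ∂μ| ≤ s) (ht : ∀ x, |∫ y, T x y ∂μ| ≤ t) {n : ℕ} (hn : 1 ≤ n) :
    |(∑ p ∈ (Finset.univ : Finset (Fin n)).offDiag,
        ∑ q ∈ (Finset.univ : Finset (Fin n)).offDiag,
        ((∫ ω, S (X p.1 ω) (X p.2 ω) * T (X q.1 ω) (X q.2 ω) ∂P)
          - (∫ z, S z.1 z.2 ∂(μ.prod μ)) * (∫ z, T z.1 z.2 ∂(μ.prod μ))))
      - 2 * ((n : ℝ) * (n - 1)) * ∫ z, S z.1 z.2 * T z.1 z.2 ∂(μ.prod μ)|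
      ≤ 8 * s * t * n * ((n : ℝ) * (n - 1)) := by
  set J := ∫ z, S z.1 z.2 * T z.1 z.2 ∂(μ.prod μ) with hJ
  set E := (∫ z, S z.1 z.2 ∂(μ.prod μ)) * (∫ z, T z.1 z.2 ∂(μ.prod μ)) with hE
  set D := (Finset.univ : Finset (Fin n)).offDiag with hD
  have hst : 0 ≤ 2 * s * t := by
    have := (abs_nonneg _).trans (hs 0)
    have := (abs_nonneg _).trans (ht 0)
    positivity
  have hcard : (D.card : ℝ) = n * (n - 1) := by
    rw [hD, Finset.offDiag_card, Finset.card_univ, Fintype.card_fin, Nat.cast_sub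
      (Nat.le_mul_of_pos_left n hn)]
    push_cast
    ring
  have inner : ∀ p ∈ D, |(∑ q ∈ D, ((∫ ω, S (X p.1 ω) (X p.2 ω) * T (X q.1 ω) (X q.2 ω) ∂P)
      - E)) - 2 * J| ≤ 8 * s * t * n := fun p hp => by
    have hp' : p.1 ≠ p.2 := (Finset.mem_offDiag.1 hp).2.2
    have hsum : ∑ q ∈ D, ((if q = p then J else 0) + (if q = p.swap then J else 0)) = 2 * J := by
      have hps : p.swap ∈ D :=
        Finset.mem_offDiag.2 ⟨Finset.mem_univ _, Finset.mem_univ _, hp'.symm⟩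
      rw [Finset.sum_add_distrib, Finset.sum_ite_eq', Finset.sum_ite_eq', if_pos hp, if_pos hps]
      ring
    -- Dropping the restriction to distinct indices, each of the four coincidences occurs for
    -- exactly n pairs q. With the factor 2st this gives the constant 8.
    have hcount : ∑ q ∈ D, ((if q.1 = p.1 then (1 : ℝ) else 0) + (if q.1 = p.2 then 1 else 0)
        + (if q.2 = p.1 then 1 else 0) + (if q.2 = p.2 then 1 else 0)) ≤ 4 * n := by
      calc _ ≤ ∑ q : Fin n × Fin n, ((if q.1 = p.1 then (1 : ℝ) else 0)
            + (if q.1 = p.2 then 1 else 0)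
            + (if q.2 = p.1 then 1 else 0) + (if q.2 = p.2 then 1 else 0)) :=
            Finset.sum_le_sum_of_subset_of_nonneg (Finset.subset_univ _)
              fun q _ _ => by positivity
        _ = 4 * n := by
            have k₁ : ∀ a : Fin n, ∑ q : Fin n × Fin n, (if q.1 = a then (1 : ℝ) else 0) = n :=
              fun a => by rw [Fintype.sum_prod_type_right]; simp
            have k₂ : ∀ a : Fin n, ∑ q : Fin n × Fin n, (if q.2 = a then (1 : ℝ) else 0) = n :=
              fun a => by rw [Fintype.sum_prod_type]; simp
            rw [Finset.sum_add_distrib, Finset.sum_add_distrib, Finset.sum_add_distrib,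
              k₁, k₁, k₂, k₂]
            ring
    rw [← hsum, ← Finset.sum_sub_distrib]
    refine (Finset.abs_sum_le_sum_abs _ _).trans ?_
    have hle : ∀ q ∈ D, |(∫ ω, S (X p.1 ω) (X p.2 ω) * T (X q.1 ω) (X q.2 ω) ∂P) - E
        - ((if q = p then J else 0) + (if q = p.swap then J else 0))|
        ≤ 2 * s * t * ((if q.1 = p.1 then (1 : ℝ) else 0) + (if q.1 = p.2 then 1 else 0)
        + (if q.2 = p.1 then 1 else 0) + (if q.2 = p.2 then 1 else 0)) := fun q hq => by
      have hq' : q.1 ≠ q.2 := (Finset.mem_offDiag.1 hq).2.2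
      have := abs_cov_sub_le hXm hXi hμ hSm hSB hSs hTs hTm hTi hs ht
        (i := p.1) (j := p.2) (k := q.1) (l := q.2) (Fin.val_ne_of_ne hp') (Fin.val_ne_of_ne hq')
      simp only [Fin.val_inj] at this
      rw [← sub_sub]
      simpa only [Prod.ext_iff, Prod.fst_swap, Prod.snd_swap] using this
    refine (Finset.sum_le_sum hle).trans ?_
    rw [← Finset.mul_sum]
    calc _ ≤ 2 * s * t * (4 * n) := mul_le_mul_of_nonneg_left hcount hst
      _ = _ := by ring
  have e : 2 * ((n : ℝ) * (n - 1)) * J = ∑ p ∈ D, 2 * J := by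
    rw [Finset.sum_const, nsmul_eq_mul, hcard]
    ring
  rw [e, ← Finset.sum_sub_distrib]
  refine (Finset.abs_sum_le_sum_abs _ _).trans ((Finset.sum_le_sum inner).trans (le_of_eq ?_))
  rw [Finset.sum_const, nsmul_eq_mul, hcard]
  ring

/-- The covariance of two affine functions of pair sums, the first of which has mean zero. -/
theorem integral_affine_mul (hXm : ∀ i, Measurable (X i)) (hXi : iIndepFun X P)
    (hμ : ∀ i, P.map (X i) = μ) {B : ℝ}
    (hSm : Measurable fun z : ℝ × ℝ => S z.1 z.2) (hSB : ∀ x y, |S x y| ≤ B)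
    (hTm : Measurable fun z : ℝ × ℝ => T z.1 z.2)
    (hTi : Integrable (fun z : ℝ × ℝ => T z.1 z.2) (μ.prod μ)) {n : ℕ} (c₁ c₂ α γ : ℝ) :
    Integrable (fun ω => (c₁ + α * ∑ p ∈ (Finset.univ : Finset (Fin n)).offDiag,
        S (X p.1 ω) (X p.2 ω)) * (c₂ + γ * ∑ q ∈ (Finset.univ : Finset (Fin n)).offDiag,
        T (X q.1 ω) (X q.2 ω))) P ∧
    ((c₁ + α * ((Finset.univ : Finset (Fin n)).offDiag.card
        * ∫ z, S z.1 z.2 ∂(μ.prod μ)) = 0) →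
      ∫ ω, (c₁ + α * ∑ p ∈ (Finset.univ : Finset (Fin n)).offDiag,
        S (X p.1 ω) (X p.2 ω)) * (c₂ + γ * ∑ q ∈ (Finset.univ : Finset (Fin n)).offDiag,
        T (X q.1 ω) (X q.2 ω)) ∂P
      = α * γ * ∑ p ∈ (Finset.univ : Finset (Fin n)).offDiag,
        ∑ q ∈ (Finset.univ : Finset (Fin n)).offDiag,
        ((∫ ω, S (X p.1 ω) (X p.2 ω) * T (X q.1 ω) (X q.2 ω) ∂P)
          - (∫ z, S z.1 z.2 ∂(μ.prod μ)) * (∫ z, T z.1 z.2 ∂(μ.prod μ)))) := by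
  set D := (Finset.univ : Finset (Fin n)).offDiag with hD
  have hne : ∀ p ∈ D, (p.1 : ℕ) ≠ p.2 := fun p hp =>
    Fin.val_ne_of_ne (Finset.mem_offDiag.1 hp).2.2
  have hSi : Integrable (fun z : ℝ × ℝ => S z.1 z.2) (μ.prod μ) :=
    (integrable_const B).mono' hSm.aestronglyMeasurable (ae_of_all _ fun z => hSB _ _)
  have iS : ∀ p ∈ D, Integrable (fun ω => S (X p.1 ω) (X p.2 ω)) P := fun p hp =>
    integrable_pair hXm hXi hμ hSi (hne p hp)
  have iT : ∀ p ∈ D, Integrable (fun ω => T (X p.1 ω) (X p.2 ω)) P := fun p hp =>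
    integrable_pair hXm hXi hμ hTi (hne p hp)
  have iST : ∀ p ∈ D, ∀ q ∈ D,
      Integrable (fun ω => S (X p.1 ω) (X p.2 ω) * T (X q.1 ω) (X q.2 ω)) P := fun p hp q hq =>
    (iT q hq).bdd_mul (iS p hp).aestronglyMeasurable (ae_of_all _ fun ω => hSB _ _)
  have e : (fun ω => (c₁ + α * ∑ p ∈ D, S (X p.1 ω) (X p.2 ω))
        * (c₂ + γ * ∑ q ∈ D, T (X q.1 ω) (X q.2 ω)))
      = fun ω => (c₁ * c₂ + c₁ * γ * ∑ q ∈ D, T (X q.1 ω) (X q.2 ω))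
        + (α * c₂ * (∑ p ∈ D, S (X p.1 ω) (X p.2 ω))
        + α * γ * ∑ p ∈ D, ∑ q ∈ D, S (X p.1 ω) (X p.2 ω) * T (X q.1 ω) (X q.2 ω)) := by
    ext ω
    rw [← Finset.sum_mul_sum]
    ring
  have j1 : Integrable (fun ω => c₁ * c₂ + c₁ * γ * ∑ q ∈ D, T (X q.1 ω) (X q.2 ω)) P :=
    (integrable_const _).add ((integrable_finsetSum D iT).const_mul _)
  have j2 : Integrable (fun ω => α * c₂ * ∑ p ∈ D, S (X p.1 ω) (X p.2 ω)) P :=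
    (integrable_finsetSum D iS).const_mul _
  have j3 : Integrable (fun ω => α * γ * ∑ p ∈ D, ∑ q ∈ D,
      S (X p.1 ω) (X p.2 ω) * T (X q.1 ω) (X q.2 ω)) P :=
    (integrable_finsetSum D fun p hp => integrable_finsetSum D (iST p hp)).const_mul _
  have j23 := j2.fun_add j3
  refine ⟨e ▸ j1.add j23, fun h0 => ?_⟩
  rw [e, integral_add j1 j23, integral_add (integrable_const _)
    ((integrable_finsetSum D iT).const_mul _), integral_add j2 j3]
  simp only [integral_const_mul]
  rw [integral_finsetSum D iT, integral_finsetSum D iS, integral_finsetSum D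
    fun p hp => integrable_finsetSum D (iST p hp)]
  have eS : ∑ p ∈ D, ∫ ω, S (X p.1 ω) (X p.2 ω) ∂P
      = D.card * ∫ z, S z.1 z.2 ∂(μ.prod μ) := by
    rw [Finset.sum_congr rfl fun p hp => integral_pair hXm hXi hμ hSm (hne p hp),
      Finset.sum_const, nsmul_eq_mul]
  have eT : ∑ p ∈ D, ∫ ω, T (X p.1 ω) (X p.2 ω) ∂P
      = D.card * ∫ z, T z.1 z.2 ∂(μ.prod μ) := by
    rw [Finset.sum_congr rfl fun p hp => integral_pair hXm hXi hμ hTm (hne p hp),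
      Finset.sum_const, nsmul_eq_mul]
  have eST : ∑ p ∈ D, ∫ ω, ∑ q ∈ D, S (X p.1 ω) (X p.2 ω) * T (X q.1 ω) (X q.2 ω) ∂P
      = ∑ p ∈ D, ∑ q ∈ D, ∫ ω, S (X p.1 ω) (X p.2 ω) * T (X q.1 ω) (X q.2 ω) ∂P :=
    Finset.sum_congr rfl fun p hp => integral_finsetSum D (iST p hp)
  rw [eS, eT, eST]
  simp only [Finset.sum_sub_distrib, Finset.sum_const, nsmul_eq_mul, integral_const,
    probReal_univ, smul_eq_mul, one_mul]
  -- The two sides differ by the product of the means of the two affine factors, and the first mean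
  -- is zero.
  linear_combination (c₂ + γ * (D.card * ∫ z, T z.1 z.2 ∂(μ.prod μ))) * h0

end ustat

/-! ### The cross-validation criterion as a pair sum -/

theorem sum_offDiag_eq {n : ℕ} (F : Fin n → Fin n → ℝ) :
    ∑ p ∈ (Finset.univ : Finset (Fin n)).offDiag, F p.1 p.2
      = ∑ i, ∑ j ∈ Finset.univ.erase i, F i j :=
  Finset.sum_finset_product' _ _ _ fun p => by
    simp [Finset.mem_offDiag, eq_comm]

theorem sum_sum_eq {n : ℕ} (F : Fin n → Fin n → ℝ) :
    ∑ i, ∑ j, F i j = (∑ i, F i i) + ∑ p ∈ (Finset.univ : Finset (Fin n)).offDiag, F p.1 p.2 := by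
  rw [sum_offDiag_eq, ← Finset.sum_add_distrib]
  exact Finset.sum_congr rfl fun i _ => (Finset.add_sum_erase _ _ (Finset.mem_univ i)).symm

theorem card_offDiag_fin {n : ℕ} :
    ((Finset.univ : Finset (Fin n)).offDiag.card : ℝ) = n * (n - 1) := by
  rw [Finset.offDiag_card, Finset.card_univ, Fintype.card_fin, Nat.cast_sub (Nat.le_mul_self n)]
  push_cast
  ring

/-- The kernel such that the criterion is `A(0) / (n h)` plus the sum over pairs of
its rescaled values. -/
noncomputable def pairKernel (K : ℝ → ℝ) (n : ℕ) (u : ℝ) : ℝ :=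
  (1 - 1 / (n : ℝ)) / 2 * conv K K u + (-1) * K u

theorem Admissible.pairKernel {K : ℝ → ℝ} (hK : Admissible K) (n : ℕ) :
    Admissible (pairKernel K n) :=
  hK.conv_self.lin hK _ _

theorem integral_comp_sub_div (g : ℝ → ℝ) (y : ℝ) {h : ℝ} (hh : 0 < h) :
    ∫ t, g ((t - y) / h) = h * ∫ u, g u := by
  rw [integral_sub_right_eq_self (fun t => g (t / h)), Measure.integral_comp_div, abs_of_pos hh,
    smul_eq_mul]

theorem integral_comp_sub_left_div (g : ℝ → ℝ) (x : ℝ) {h : ℝ} (hh : 0 < h) :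
    ∫ t, g ((x - t) / h) = h * ∫ u, g u := by
  rw [integral_sub_left_eq_self (fun t => g (t / h)), Measure.integral_comp_div, abs_of_pos hh,
    smul_eq_mul]

section criterion

variable {K : ℝ → ℝ} {n : ℕ}

theorem integral_mul_kernel (hK : Admissible K) (x y : ℝ) {h : ℝ} (hh : 0 < h) :
    ∫ t, K ((t - x) / h) * K ((t - y) / h) = h * conv K K ((x - y) / h) := by
  rw [conv, ← integral_comp_sub_div _ y hh]
  congr 1 with t
  rw [← hK.even ((t - x) / h)]
  congr 2
  ring

theorem integrable_mul_kernel (hK : Admissible K) (x y : ℝ) {h : ℝ} (hh : 0 < h) :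
    Integrable fun t => K ((t - x) / h) * K ((t - y) / h) := by
  obtain ⟨C, -, hC⟩ := hK.rapid.bounded
  have hc := hK.rapid.cont
  exact ((hK.rapid.integrable.comp_div hh.ne').comp_sub_right y).bdd_mul
    (Continuous.aestronglyMeasurable (by fun_prop)) (ae_of_all _ fun t => hC _)

theorem kde_sq (x : Fin n → ℝ) (h t : ℝ) :
    kde K x h t ^ 2
      = (1 / ((n : ℝ) * h)) ^ 2 * ∑ i, ∑ j, K ((t - x i) / h) * K ((t - x j) / h) := by
  rw [kde, mul_pow, sq (∑ j, _), Finset.sum_mul_sum]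

theorem integrable_kde_sq (hK : Admissible K) (x : Fin n → ℝ) {h : ℝ} (hh : 0 < h) :
    Integrable fun t => kde K x h t ^ 2 := by
  simp only [kde_sq]
  exact (integrable_finsetSum _ fun i _ => integrable_finsetSum _ fun j _ =>
    integrable_mul_kernel hK (x i) (x j) hh).const_mul _

theorem integral_kde_sq (hK : Admissible K) (x : Fin n → ℝ) {h : ℝ} (hh : 0 < h) :
    ∫ t, kde K x h t ^ 2 = conv K K 0 / (n * h)
      + 1 / ((n : ℝ) ^ 2 * h) * ∑ p ∈ (Finset.univ : Finset (Fin n)).offDiag,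
        conv K K ((x p.1 - x p.2) / h) := by
  simp only [kde_sq]
  rw [integral_const_mul, integral_finsetSum _ fun i _ => integrable_finsetSum _ fun j _ =>
    integrable_mul_kernel hK (x i) (x j) hh]
  have e : ∀ i, ∫ t, ∑ j, K ((t - x i) / h) * K ((t - x j) / h)
      = ∑ j, h * conv K K ((x i - x j) / h) := fun i => by
    rw [integral_finsetSum _ fun j _ => integrable_mul_kernel hK (x i) (x j) hh]
    exact Finset.sum_congr rfl fun j _ => integral_mul_kernel hK _ _ hh
  simp only [e]
  rw [sum_sum_eq fun i j => h * conv K K ((x i - x j) / h)]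
  simp only [sub_self, zero_div, Finset.sum_const, Finset.card_univ, Fintype.card_fin,
    nsmul_eq_mul, ← Finset.mul_sum]
  rcases eq_or_ne n 0 with rfl | hn
  · simp
  · have : (n : ℝ) ≠ 0 := by exact_mod_cast hn
    field_simp

/-- Off the diagonal the integral of the squared estimate has weight 1/n² on K * K and the
leave-one-out term has weight 2/(n(n-1)) on K. Taking 2/(n(n-1)) out of both leaves (1 - 1/n)/2 on K
* K, which is the form of `pairKernel`. -/
theorem CV_eq (hK : Admissible K) (x : Fin n → ℝ) {h : ℝ} (hh : 0 < h) :
    CV K x h = conv K K 0 / n * h⁻¹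
      + 2 / ((n : ℝ) * (n - 1)) * ∑ p ∈ (Finset.univ : Finset (Fin n)).offDiag,
        h⁻¹ * pairKernel K n ((x p.1 - x p.2) / h) := by
  have e : 2 / (n : ℝ) * ∑ i, kdeLeaveOut K x i h (x i)
      = 2 / (n : ℝ) * (1 / (((n : ℝ) - 1) * h)) *
        ∑ p ∈ (Finset.univ : Finset (Fin n)).offDiag, K ((x p.1 - x p.2) / h) := by
    rw [sum_offDiag_eq fun i j => K ((x i - x j) / h), mul_assoc]
    congr 1
    rw [Finset.mul_sum]
    rfl
  rw [CV, integral_kde_sq hK x hh, e, Finset.mul_sum, Finset.mul_sum, Finset.mul_sum,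
    add_sub_assoc, ← Finset.sum_sub_distrib]
  congr 1
  · rw [div_mul_eq_div_div, div_eq_mul_inv (_ / _)]
  · refine Finset.sum_congr rfl fun p hp => ?_
    have hp' : p.1 ≠ p.2 := (Finset.mem_offDiag.1 hp).2.2
    -- A pair of distinct indices exists here, so the denominators are nonzero; for n < 2 both pair
    -- sums are empty.
    have hn : 2 ≤ n := by
      have h1 := Fin.val_ne_of_ne hp'
      have h2 := p.1.isLt
      have h3 := p.2.isLt
      omega
    have hn' : (2 : ℝ) ≤ n := by exact_mod_cast hn
    have hn0 : (n : ℝ) ≠ 0 := by linarith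
    have hn1 : (n : ℝ) - 1 ≠ 0 := by linarith
    rw [pairKernel]
    field_simp
    ring

theorem hasDerivAt_CV (hK : Admissible K) (x : Fin n → ℝ) {h : ℝ} (hh : 0 < h) :
    HasDerivAt (CV K x) (-(conv K K 0 / n * (h ^ 2)⁻¹)
      + -(2 / ((n : ℝ) * (n - 1)) * (h ^ 2)⁻¹) *
        ∑ p ∈ (Finset.univ : Finset (Fin n)).offDiag,
          opV (pairKernel K n) ((x p.1 - x p.2) / h)) h := by
  have h1 := ((hasDerivAt_inv hh.ne').const_mul (conv K K 0 / n)).add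
    ((HasDerivAt.fun_sum (u := (Finset.univ : Finset (Fin n)).offDiag) fun p _ =>
      (hK.pairKernel n).hasDerivAt_scaled (x p.1 - x p.2) hh.ne').const_mul
        (2 / ((n : ℝ) * (n - 1))))
  refine (h1.congr_of_eventuallyEq ?_).congr_deriv ?_
  · filter_upwards [Ioi_mem_nhds hh] with y hy
    exact CV_eq hK x hy
  · rw [← Finset.mul_sum]
    ring

theorem hasDerivAt_deriv_CV (hK : Admissible K) (x : Fin n → ℝ) {h : ℝ} (hh : 0 < h) :
    HasDerivAt (deriv (CV K x)) (2 * (conv K K 0 / n * (h ^ 3)⁻¹)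
      + 2 / ((n : ℝ) * (n - 1)) * (h ^ 3)⁻¹ *
        ∑ p ∈ (Finset.univ : Finset (Fin n)).offDiag,
          opW (pairKernel K n) ((x p.1 - x p.2) / h)) h := by
  have h1 := ((hasDerivAt_neg_inv_sq hh.ne').const_mul (conv K K 0 / n)).add
    ((HasDerivAt.fun_sum (u := (Finset.univ : Finset (Fin n)).offDiag) fun p _ =>
      (hK.pairKernel n).hasDerivAt_scaled' (x p.1 - x p.2) hh.ne').const_mul
        (2 / ((n : ℝ) * (n - 1))))
  refine (h1.congr_of_eventuallyEq ?_).congr_deriv ?_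
  · filter_upwards [Ioi_mem_nhds hh] with y hy
    rw [(hasDerivAt_CV hK x hy).deriv]
    simp only [Pi.add_apply]
    rw [← Finset.mul_sum]
    ring
  · rw [← Finset.mul_sum]
    ring

end criterion

/-! ### Integration against the law of the sample -/

/-- The law with density `f`. -/
noncomputable def law (f : ℝ → ℝ) : Measure ℝ := volume.withDensity fun x => ENNReal.ofReal (f x)

section law

variable {f : ℝ → ℝ}

theorem SmoothDensity.integral_law (hf : SmoothDensity f) (g : ℝ → ℝ) :
    ∫ x, g x ∂(law f) = ∫ x, f x * g x := by
  have hm := hf.d0.continuous.measurable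
  rw [law, integral_withDensity_eq_integral_toReal_smul (by fun_prop)
    (ae_of_all _ fun x => ENNReal.ofReal_lt_top)]
  simp only [ENNReal.toReal_ofReal (hf.dens.nonneg _), smul_eq_mul]

theorem SmoothDensity.integrable_law (hf : SmoothDensity f) {g : ℝ → ℝ} (hg : Integrable g) :
    Integrable g (law f) := by
  have hm := hf.d0.continuous.measurable
  obtain ⟨F, hF⟩ := hf.b0
  rw [law, integrable_withDensity_iff_integrable_smul' (by fun_prop)
    (ae_of_all _ fun x => ENNReal.ofReal_lt_top)]
  simp only [ENNReal.toReal_ofReal (hf.dens.nonneg _), smul_eq_mul]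
  exact hg.bdd_mul hm.aestronglyMeasurable (ae_of_all _ hF)

theorem SmoothDensity.isProbabilityMeasure_law (hf : SmoothDensity f) :
    IsProbabilityMeasure (law f) := by
  refine ⟨?_⟩
  rw [law, withDensity_apply _ MeasurableSet.univ, Measure.restrict_univ,
    ← ofReal_integral_eq_lintegral_ofReal hf.dens.integrable (ae_of_all _ hf.dens.nonneg),
    hf.dens.integral_eq_one, ENNReal.ofReal_one]

theorem SmoothDensity.integral_slice (hf : SmoothDensity f) (φ : ℝ → ℝ) (x : ℝ) {h : ℝ}
    (hh : 0 < h) :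
    ∫ y, φ ((x - y) / h) ∂(law f) = h * ∫ u, φ u * f (x - h * u) := by
  rw [hf.integral_law, ← integral_comp_sub_left_div _ x hh]
  congr 1 with y
  rw [mul_div_cancel₀ _ hh.ne', sub_sub_cancel, mul_comm]

theorem SmoothDensity.integrable_pair_law (hf : SmoothDensity f) {φ : ℝ → ℝ}
    (hφm : Measurable φ) (hφ : Integrable φ) {h : ℝ} (hh : 0 < h) :
    Integrable (fun z : ℝ × ℝ => φ ((z.1 - z.2) / h)) ((law f).prod (law f)) := by
  have := hf.isProbabilityMeasure_law
  obtain ⟨F, hF⟩ := hf.b0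
  have hm : AEStronglyMeasurable (fun z : ℝ × ℝ => φ ((z.1 - z.2) / h))
      ((law f).prod (law f)) := Measurable.aestronglyMeasurable (by fun_prop)
  refine (integrable_prod_iff hm).2 ⟨ae_of_all _ fun x =>
    hf.integrable_law ((hφ.comp_div hh.ne').comp_sub_left x), ?_⟩
  refine (integrable_const (h * ∫ u, |φ u| * F)).mono' hm.norm.integral_prod_right'
    (ae_of_all _ fun x => ?_)
  rw [Real.norm_eq_abs, abs_of_nonneg (integral_nonneg fun y => norm_nonneg _)]
  simp only [Real.norm_eq_abs]
  rw [hf.integral_slice (fun u => |φ u|) x hh]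
  refine mul_le_mul_of_nonneg_left (integral_mono_of_nonneg (ae_of_all _ fun u =>
    mul_nonneg (abs_nonneg _) (hf.dens.nonneg _)) (hφ.abs.mul_const F) (ae_of_all _ fun u => ?_))
    hh.le
  exact mul_le_mul_of_nonneg_left ((le_abs_self _).trans (hF _)) (abs_nonneg _)

theorem SmoothDensity.integral_pair_law (hf : SmoothDensity f) {φ : ℝ → ℝ}
    (hφm : Measurable φ) (hφ : Integrable φ) {h : ℝ} (hh : 0 < h) :
    ∫ z : ℝ × ℝ, φ ((z.1 - z.2) / h) ∂((law f).prod (law f))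
      = h * ∫ u, φ u * autocorr f f (h * u) := by
  have := hf.isProbabilityMeasure_law
  obtain ⟨F, hF⟩ := hf.b0
  have hc := hf.d0.continuous
  rw [integral_prod _ (hf.integrable_pair_law hφm hφ hh)]
  simp only [hf.integral_slice φ _ hh, integral_const_mul]
  congr 1
  rw [hf.integral_law]
  have hi : Integrable (fun z : ℝ × ℝ => f (z.1 - h * z.2) * (f z.1 * φ z.2))
      (volume.prod volume) :=
    (hf.dens.integrable.mul_prod hφ).bdd_mul (by fun_prop) (ae_of_all _ fun z => hF _)
  calc ∫ x, f x * ∫ u, φ u * f (x - h * u)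
      = ∫ x, ∫ u, f (x - h * u) * (f x * φ u) := by
        congr 1 with x
        rw [← integral_const_mul]
        congr 1 with u
        ring
    _ = ∫ u, ∫ x, f (x - h * u) * (f x * φ u) := integral_integral_swap hi
    _ = _ := by
        congr 1 with u
        rw [← autocorr_neg, autocorr, ← integral_const_mul]
        congr 1 with x
        rw [← sub_eq_add_neg]
        ring

end law

/-! ### The mean integrated squared error -/

section mise

variable {Ω : Type*} [MeasurableSpace Ω] {P : Measure Ω} [IsProbabilityMeasure P]
  {X : ℕ → Ω → ℝ} {K f : ℝ → ℝ}

theorem MISE_zero (h : ℝ) : MISE P X K f 0 h = ∫ t, f t ^ 2 := by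
  simp [MISE, ISE, kde]

theorem ISE_eq (hf : SmoothDensity f) (hK : Admissible K) {n : ℕ}
    (x : Fin n → ℝ) {h : ℝ} (hh : 0 < h) :
    ISE K f x h = conv K K 0 / (n * h)
      + 1 / ((n : ℝ) ^ 2 * h) * (∑ p ∈ (Finset.univ : Finset (Fin n)).offDiag,
        conv K K ((x p.1 - x p.2) / h))
      - 2 / (n : ℝ) * (∑ i, ∫ u, K u * f (x i + h * u)) + autocorr f f 0 := by
  obtain ⟨F, hF⟩ := hf.b0
  have hff : Integrable fun t => f t * f t := by simpa using hf.integrable_shift_mul 0 0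
  have hKf : ∀ y, Integrable fun t => K ((t - y) / h) * f t := fun y =>
    ((hK.rapid.integrable.comp_div hh.ne').comp_sub_right y).mul_bdd
      hf.d0.continuous.aestronglyMeasurable (ae_of_all _ hF)
  have e1 : ∀ y, ∫ t, K ((t - y) / h) * f t = h * ∫ u, K u * f (y + h * u) := fun y => by
    rw [← integral_comp_sub_div _ y hh]
    congr 1 with t
    rw [mul_div_cancel₀ _ hh.ne', add_sub_cancel]
  have hkf : Integrable fun t => kde K x h t * f t := by
    simp only [kde, mul_assoc, Finset.sum_mul]
    exact (integrable_finsetSum _ fun i _ => hKf (x i)).const_mul _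
  have e2 : ∫ t, kde K x h t * f t = 1 / (n : ℝ) * ∑ i, ∫ u, K u * f (x i + h * u) := by
    simp only [kde, mul_assoc, Finset.sum_mul]
    rw [integral_const_mul, integral_finsetSum _ fun i _ => hKf (x i)]
    simp only [e1]
    rw [← Finset.mul_sum, ← mul_assoc, one_div_mul_eq_div, div_mul_cancel_right₀ hh.ne', one_div]
  have e3 : (fun t => (kde K x h t - f t) ^ 2)
      = fun t => kde K x h t ^ 2 - 2 * (kde K x h t * f t) + f t * f t := by ext t; ring
  rw [ISE, e3, integral_sub_two_mul_add (integrable_kde_sq hK x hh) hkf hff,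
    integral_kde_sq hK x hh, e2]
  simp only [autocorr, add_zero]
  ring

/-- The n(n-1) off-diagonal pairs, divided by n², weigh 1 - 1/n. The 1 joins the cross term and ∫f²
to form the squared bias, and the -1/n is the correction to the variance. -/
theorem MISE_eq_risk (hf : SmoothDensity f) (hK : Admissible K) (hd : IsDensity K)
    (hXm : ∀ i, Measurable (X i)) (hXi : iIndepFun X P) (hXd : ∀ i, P.map (X i) = law f)
    {n : ℕ} (hn : 1 ≤ n) {h : ℝ} (hh : 0 < h) :
    MISE P X K f n h = risk (conv K K 0) (fun h => ∫ u, conv K K u * autocorr f f (h * u))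
      (fun h => (∫ u, (conv K K u - 2 * K u) * autocorr f f (h * u)) + autocorr f f 0) n h := by
  have := hf.isProbabilityMeasure_law
  obtain ⟨F, hF⟩ := hf.b0
  have hF' := abs_autocorr_le hf.dens hF
  have hA : RapidDecay (conv K K) := hK.conv_self.rapid
  have hAm := hA.cont.measurable
  have hkc := hf.continuous_smooth hd h
  have hki : Integrable fun y => ∫ u, K u * f (y + h * u) :=
    (hf.integrable_smooth_prod hK hd h).integral_prod_right
  have hne : ∀ p ∈ (Finset.univ : Finset (Fin n)).offDiag, (p.1 : ℕ) ≠ p.2 := fun p hp =>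
    Fin.val_ne_of_ne (Finset.mem_offDiag.1 hp).2.2
  have iA : ∀ p ∈ (Finset.univ : Finset (Fin n)).offDiag,
      Integrable (fun ω => conv K K ((X p.1 ω - X p.2 ω) / h)) P := fun p hp =>
    integrable_pair (T := fun x y => conv K K ((x - y) / h)) hXm hXi hXd
      (hf.integrable_pair_law hAm hA.integrable hh) (hne p hp)
  have eA : ∀ p ∈ (Finset.univ : Finset (Fin n)).offDiag,
      ∫ ω, conv K K ((X p.1 ω - X p.2 ω) / h) ∂P
        = h * ∫ u, conv K K u * autocorr f f (h * u) := fun p hp => by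
    rw [integral_pair (T := fun x y => conv K K ((x - y) / h)) hXm hXi hXd (by fun_prop)
      (hne p hp), hf.integral_pair_law hAm hA.integrable hh]
  have iK : ∀ i : Fin n, Integrable (fun ω => ∫ u, K u * f (X i ω + h * u)) P := fun i => by
    have := hf.integrable_law hki
    rw [← hXd i] at this
    exact this.comp_measurable (hXm i)
  have eK : ∀ i : Fin n, ∫ ω, (∫ u, K u * f (X i ω + h * u)) ∂P
      = ∫ u, K u * autocorr f f (h * u) := fun i => by
    have h1 := integral_map (μ := P) (hXm i).aemeasurable
      (hkc.aestronglyMeasurable (μ := P.map (X i)))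
    rw [← h1, hXd i, hf.integral_law]
    simp only [mul_comm (f _)]
    exact hf.integral_smooth_mul hd hf.dens.integrable h
  have hn0 : (n : ℝ) ≠ 0 := by exact_mod_cast (by omega : n ≠ 0)
  have e0 : MISE P X K f n h = conv K K 0 / (n * h)
      + 1 / ((n : ℝ) ^ 2 * h) * (n * (n - 1) * (h * ∫ u, conv K K u * autocorr f f (h * u)))
      - 2 / (n : ℝ) * (n * ∫ u, K u * autocorr f f (h * u)) + autocorr f f 0 := by
    have i1 := (integrable_finsetSum _ iA).const_mul (1 / ((n : ℝ) ^ 2 * h))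
    have i2 := (integrable_finsetSum Finset.univ fun i _ => iK i).const_mul (2 / (n : ℝ))
    have i3 := (integrable_const (μ := P) (conv K K 0 / (n * h))).fun_add i1
    rw [MISE]
    simp only [ISE_eq hf hK _ hh, sample]
    refine (integral_add (i3.sub i2) (integrable_const _)).trans ?_
    rw [integral_sub' i3 i2,
      integral_add (integrable_const _) i1, integral_const_mul, integral_const_mul,
      integral_finsetSum _ iA, integral_finsetSum _ fun i _ => iK i, Finset.sum_congr rfl eA,
      Finset.sum_congr rfl fun i _ => eK i, Finset.sum_const, Finset.sum_const, nsmul_eq_mul,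
      nsmul_eq_mul, card_offDiag_fin]
    simp
  have hrm : Measurable fun u => autocorr f f (h * u) :=
    (hf.continuous_autocorr.comp (continuous_const_mul h)).measurable
  have j1 := hA.integrable_mul_bdd hrm (fun u => hF' (h * u))
  have j2 := hK.rapid.integrable_mul_bdd hrm (fun u => hF' (h * u))
  have e1 : ∫ u, (conv K K u - 2 * K u) * autocorr f f (h * u)
      = (∫ u, conv K K u * autocorr f f (h * u)) - 2 * ∫ u, K u * autocorr f f (h * u) := by
    rw [← integral_const_mul, ← integral_sub j1 (j2.const_mul 2)]
    congr 1 with u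
    ring
  rw [e0, risk, e1]
  field_simp
  ring

end mise

/-! ### Projections of the pair kernels -/

theorem abs_taylor_le {q : ℝ → ℝ} {F : ℝ} (hq : Differentiable ℝ q)
    (hF : ∀ x y, |deriv q y - deriv q x| ≤ F * |y - x|) (x y : ℝ) :
    |q y - q x - deriv q x * (y - x)| ≤ F * (y - x) ^ 2 := by
  have hF0 : 0 ≤ F := by
    have := (abs_nonneg _).trans (hF 0 1)
    simpa using this
  have hd : ∀ z, HasDerivAt (fun z => q z - deriv q x * z) (deriv q z - deriv q x) z := fun z =>
    ((hq z).hasDerivAt.sub ((hasDerivAt_id' z).const_mul (deriv q x))).congr_deriv (by ring)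
  have h1 := Convex.norm_image_sub_le_of_norm_hasDerivWithin_le (s := Set.uIcc x y)
    (C := F * |y - x|) (fun z _ => (hd z).hasDerivWithinAt) (fun z hz => (hF x z).trans
      (mul_le_mul_of_nonneg_left (Set.abs_sub_left_of_mem_uIcc hz) hF0)) (convex_uIcc x y)
    Set.left_mem_uIcc Set.right_mem_uIcc
  simp only [Real.norm_eq_abs] at h1
  calc |q y - q x - deriv q x * (y - x)|
      = |q y - deriv q x * y - (q x - deriv q x * x)| := by congr 1; ring
    _ ≤ F * |y - x| * |y - x| := h1
    _ = F * (y - x) ^ 2 := by rw [mul_assoc, abs_mul_abs_self, sq]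

namespace SmoothDensity

variable {f : ℝ → ℝ}

theorem hasDerivAt_reflect (hf : SmoothDensity f) (x h u : ℝ) :
    HasDerivAt (fun u => f (x - h * u)) (-h * deriv f (x - h * u)) u := by
  have h1 : HasDerivAt (fun u => x - h * u) (-h) u :=
    ((hasDerivAt_const_mul h).const_sub x)
  exact ((hf.d0 (x - h * u)).hasDerivAt.comp u h1).congr_deriv (by ring)

/-- One factor h is explicit. Because uE is odd, f'(x) may be subtracted from f'(x - hu), and the
difference is at most a multiple of h|u|, which supplies the second. -/
theorem abs_integral_even_le (hf : SmoothDensity f) {E : ℝ → ℝ} (hE : RapidDecay E)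
    (he : ∀ u, E (-u) = E u) : ∃ C, 0 ≤ C ∧ ∀ x h, 0 < h →
      |∫ u, u * E u * (-h * deriv f (x - h * u))| ≤ C * h ^ 2 := by
  obtain ⟨F₂, hF₂⟩ := hf.b2
  have hF0 : 0 ≤ F₂ := (abs_nonneg _).trans (hF₂ 0)
  obtain ⟨F₁, hF₁⟩ := hf.b1
  have ho : ∫ u, u * E u = 0 := integral_eq_zero_of_odd fun u => by rw [he]; ring
  refine ⟨∫ u, F₂ * (|u| ^ 2 * |E u|), integral_nonneg fun u => by positivity, fun x h hh => ?_⟩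
  have hdc := hf.d1.continuous
  have i1 : Integrable fun u => u * E u * deriv f (x - h * u) :=
    hE.id_mul.integrable_mul_bdd (by fun_prop) (fun u => hF₁ _)
  have e : ∫ u, u * E u * (-h * deriv f (x - h * u))
      = ∫ u, -h * (u * E u * (deriv f (x - h * u) - deriv f x)) := by
    have e1 : ∫ u, u * E u * (-h * deriv f (x - h * u))
        = ∫ u, -h * (u * E u * deriv f (x - h * u)) := by congr 1 with u; ring
    rw [e1, integral_const_mul, integral_const_mul]
    simp only [mul_sub]
    rw [integral_sub i1 (hE.id_mul.integrable.mul_const _), integral_mul_const, ho]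
    ring
  rw [e, ← integral_mul_const, ← Real.norm_eq_abs]
  refine norm_integral_le_of_norm_le
    (((hE.abs.abs_pow_mul 2).integrable.const_mul F₂).mul_const _) (ae_of_all _ fun u => ?_)
  have h2 := abs_sub_le_of_deriv_bdd hf.d1 hF₂ x (x - h * u)
  rw [sub_sub_cancel_left, abs_neg, abs_mul, abs_of_pos hh] at h2
  rw [Real.norm_eq_abs, abs_mul, abs_mul, abs_mul, abs_neg, abs_of_pos hh]
  calc h * (|u| * |E u| * |deriv f (x - h * u) - deriv f x|)
      ≤ h * (|u| * |E u| * (F₂ * (h * |u|))) := by gcongr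
    _ = _ := by ring

theorem abs_integral_opV_le (hf : SmoothDensity f) {G : ℝ → ℝ} (hG : Admissible G) :
    ∃ C, 0 ≤ C ∧ ∀ x h, 0 < h → |∫ u, opV G u * f (x - h * u)| ≤ C * h ^ 2 := by
  obtain ⟨F, hF⟩ := hf.b0
  obtain ⟨F₁, hF₁⟩ := hf.b1
  obtain ⟨C, hC0, hC⟩ := hf.abs_integral_even_le hG.rapid hG.even
  refine ⟨C, hC0, fun x h hh => ?_⟩
  rw [hG.integral_opV_mul (fun u => hf.hasDerivAt_reflect x h u) (fun u => hF _)
    (C' := |h| * F₁) (fun u => by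
      rw [abs_mul, abs_neg]
      exact mul_le_mul_of_nonneg_left (hF₁ _) (abs_nonneg _)), abs_neg]
  exact hC x h hh

theorem abs_integral_opW_le (hf : SmoothDensity f) {G : ℝ → ℝ} (hG : Admissible G) :
    ∃ C, 0 ≤ C ∧ ∀ x h, 0 < h → |∫ u, opW G u * f (x - h * u)| ≤ C * h ^ 2 := by
  obtain ⟨F, hF⟩ := hf.b0
  obtain ⟨F₁, hF₁⟩ := hf.b1
  obtain ⟨C, hC0, hC⟩ := hf.abs_integral_even_le (hG.rapid.add hG.rapid_opV)
    (fun u => by rw [hG.even, hG.opV_even])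
  refine ⟨C, hC0, fun x h hh => ?_⟩
  rw [hG.integral_opW_mul (fun u => hf.hasDerivAt_reflect x h u) (fun u => hF _)
    (C' := |h| * F₁) (fun u => by
      rw [abs_mul, abs_neg]
      exact mul_le_mul_of_nonneg_left (hF₁ _) (abs_nonneg _)), abs_neg]
  exact hC x h hh

/-- Improvement of `abs_integral_opV_le` for kernels with vanishing second moment. -/
theorem abs_integral_opV_le_cube (hf : SmoothDensity f) {G : ℝ → ℝ} (hG : Admissible G)
    (hm : ∫ u, u ^ 2 * G u = 0) :
    ∃ C, 0 ≤ C ∧ ∀ x h, 0 < h → |∫ u, opV G u * f (x - h * u)| ≤ C * h ^ 3 := by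
  obtain ⟨F, hF⟩ := hf.b0
  obtain ⟨F₁, hF₁⟩ := hf.b1
  obtain ⟨F₃, hF₃⟩ := hf.b3
  have hF0 : 0 ≤ F₃ := (abs_nonneg _).trans (hF₃ 0)
  have ho : ∫ u, u * G u = 0 := integral_eq_zero_of_odd fun u => by rw [hG.even]; ring
  have hdc := hf.d1.continuous
  refine ⟨∫ u, F₃ * (|u| ^ 3 * |G u|), integral_nonneg fun u => by positivity, fun x h hh => ?_⟩
  rw [hG.integral_opV_mul (fun u => hf.hasDerivAt_reflect x h u) (fun u => hF _)
    (C' := |h| * F₁) (fun u => by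
      rw [abs_mul, abs_neg]
      exact mul_le_mul_of_nonneg_left (hF₁ _) (abs_nonneg _)), abs_neg]
  have i1 : Integrable fun u => u * G u * deriv f (x - h * u) :=
    hG.rapid.id_mul.integrable_mul_bdd (by fun_prop) (fun u => hF₁ _)
  have i2 : Integrable fun u => deriv f x * (u * G u) := hG.rapid.id_mul.integrable.const_mul _
  have i3 : Integrable fun u => h * deriv (deriv f) x * (u ^ 2 * G u) :=
    (hG.rapid.pow_mul 2).integrable.const_mul _
  -- The first moment of G vanishes by parity and the second by hypothesis, so the whole first-order
  -- Taylor polynomial of f' at x can be subtracted; the remainder is at most F₃h²u².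
  have e : ∫ u, u * G u * (-h * deriv f (x - h * u))
      = ∫ u, -h * (u * G u * (deriv f (x - h * u) - deriv f x
        - deriv (deriv f) x * (x - h * u - x))) := by
    have e1 : ∫ u, u * G u * (-h * deriv f (x - h * u))
        = ∫ u, -h * (u * G u * deriv f (x - h * u)) := by congr 1 with u; ring
    have e2 : (fun u => u * G u * (deriv f (x - h * u) - deriv f x
        - deriv (deriv f) x * (x - h * u - x)))
        = fun u => (u * G u * deriv f (x - h * u) - deriv f x * (u * G u))
          + h * deriv (deriv f) x * (u ^ 2 * G u) := by ext u; ring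
    rw [e1, integral_const_mul, integral_const_mul, e2, integral_add (by exact i1.sub i2) i3,
      integral_sub i1 i2, integral_const_mul, integral_const_mul, ho, hm]
    ring
  rw [e, ← integral_mul_const, ← Real.norm_eq_abs]
  refine norm_integral_le_of_norm_le
    (((hG.rapid.abs.abs_pow_mul 3).integrable.const_mul F₃).mul_const _)
    (ae_of_all _ fun u => ?_)
  have h2 := abs_taylor_le hf.d1 (abs_sub_le_of_deriv_bdd hf.d2 hF₃) x (x - h * u)
  rw [Real.norm_eq_abs, abs_mul, abs_mul, abs_mul, abs_neg, abs_of_pos hh]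
  calc h * (|u| * |G u| * |deriv f (x - h * u) - deriv f x
        - deriv (deriv f) x * (x - h * u - x)|)
      ≤ h * (|u| * |G u| * (F₃ * (x - h * u - x) ^ 2)) := by gcongr
    _ = h * (|u| * |G u| * (F₃ * (h ^ 2 * |u| ^ 2))) := by rw [sq_abs]; ring
    _ = _ := by ring

theorem integrable_mul_reflect (hf : SmoothDensity f) {φ : ℝ → ℝ} (hφ : Integrable φ) (x h : ℝ) :
    Integrable fun u => φ u * f (x - h * u) := by
  obtain ⟨F, hF⟩ := hf.b0
  have hc := hf.d0.continuous
  exact hφ.mul_bdd (Continuous.aestronglyMeasurable (by fun_prop)) (ae_of_all _ fun u => hF _)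

end SmoothDensity

/-! ### The pair kernel for large samples -/

section pairKernel

variable {K f : ℝ → ℝ}

/-- The limit of `pairKernel K n`. -/
noncomputable def limKernel (K : ℝ → ℝ) (u : ℝ) : ℝ := 1 / 2 * conv K K u + (-1) * K u

theorem Admissible.limKernel (hK : Admissible K) : Admissible (limKernel K) :=
  hK.conv_self.lin hK _ _

theorem opV_pairKernel (hK : Admissible K) (n : ℕ) (u : ℝ) :
    opV (pairKernel K n) u = opV (limKernel K) u - 1 / (n : ℝ) * (1 / 2 * opV (conv K K) u) := by
  have h1 : opV (pairKernel K n) u = _ := hK.conv_self.opV_lin hK ((1 - 1 / (n : ℝ)) / 2) (-1) u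
  have h2 : opV (limKernel K) u = _ := hK.conv_self.opV_lin hK (1 / 2) (-1) u
  rw [h1, h2]
  ring

theorem opW_pairKernel (hK : Admissible K) (n : ℕ) (u : ℝ) :
    opW (pairKernel K n) u = opW (limKernel K) u - 1 / (n : ℝ) * (1 / 2 * opW (conv K K) u) := by
  have h1 : opW (pairKernel K n) u = _ := hK.conv_self.opW_lin hK ((1 - 1 / (n : ℝ)) / 2) (-1) u
  have h2 : opW (limKernel K) u = _ := hK.conv_self.opW_lin hK (1 / 2) (-1) u
  rw [h1, h2]
  ring

/-- This cancellation gains the extra power of h in the projection of CV', without which the pairs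
with one common index would not be negligible. -/
theorem integral_sq_mul_limKernel (hK : Admissible K) (hd : IsDensity K) :
    ∫ u, u ^ 2 * limKernel K u = 0 := by
  have e : (fun u => u ^ 2 * limKernel K u)
      = fun u => 1 / 2 * (u ^ 2 * conv K K u) - u ^ 2 * K u := by
    ext u; rw [KernelCV.limKernel]; ring
  rw [e, integral_sub ((hK.conv_self.rapid.pow_mul 2).integrable.const_mul _)
    (hK.rapid.pow_mul 2).integrable, integral_const_mul, integral_sq_mul_conv hK hd]
  ring

theorem integral_limKernel (hK : Admissible K) (hd : IsDensity K) :
    ∫ u, limKernel K u = -(1 / 2) := by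
  have e : (fun u => limKernel K u) = fun u => 1 / 2 * conv K K u - K u := by
    ext u; rw [KernelCV.limKernel]; ring
  rw [e, integral_sub (hK.conv_self.rapid.integrable.const_mul _) hd.integrable,
    integral_const_mul, integral_conv hK hd, hd.integral_eq_one]
  ring

theorem integral_kerV_mul_kerW_pos (hK : Admissible K) (hd : IsDensity K) :
    0 < ∫ u, kerV K u * kerW K u := by
  have h1 : kerV K = opV (limKernel K) := kerV_eq hK
  have h2 : kerW K = opW (limKernel K) := kerW_eq hK
  rw [h1, h2, hK.limKernel.integral_opV_mul_opW]
  have := hK.limKernel.integral_opV_sq_pos (by rw [integral_limKernel hK hd]; norm_num)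
  linarith

/-- The limit kernel gives h³. The correction, a multiple of (K * K)/n, has a nonvanishing second
moment and gives only h²/n. -/
theorem exists_slice_opV_le (hf : SmoothDensity f) (hK : Admissible K) (hd : IsDensity K) :
    ∃ C, 0 ≤ C ∧ ∀ (n : ℕ) (x h : ℝ), 0 < h →
      |∫ u, opV (pairKernel K n) u * f (x - h * u)| ≤ C * (h ^ 3 + h ^ 2 / n) := by
  obtain ⟨C₁, h1, hC₁⟩ := hf.abs_integral_opV_le_cube hK.limKernel
    (integral_sq_mul_limKernel hK hd)
  obtain ⟨C₂, h2, hC₂⟩ := hf.abs_integral_opV_le hK.conv_self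
  refine ⟨C₁ + C₂, by positivity, fun n x h hh => ?_⟩
  have e : ∫ u, opV (pairKernel K n) u * f (x - h * u)
      = (∫ u, opV (limKernel K) u * f (x - h * u))
        - 1 / (n : ℝ) * (1 / 2) * ∫ u, opV (conv K K) u * f (x - h * u) := by
    rw [← integral_const_mul, ← integral_sub
      (hf.integrable_mul_reflect hK.limKernel.rapid_opV.integrable x h)
      ((hf.integrable_mul_reflect hK.conv_self.rapid_opV.integrable x h).const_mul _)]
    congr 1 with u
    rw [opV_pairKernel hK]
    ring
  rw [e]
  have h3 : |1 / (n : ℝ) * (1 / 2) * ∫ u, opV (conv K K) u * f (x - h * u)|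
      ≤ C₂ * (h ^ 2 / n) := by
    rw [abs_mul, abs_of_nonneg (by positivity)]
    calc 1 / (n : ℝ) * (1 / 2) * |∫ u, opV (conv K K) u * f (x - h * u)|
        ≤ 1 / (n : ℝ) * 1 * (C₂ * h ^ 2) := by
          gcongr
          · norm_num
          · exact hC₂ x h hh
      _ = _ := by ring
  refine (abs_sub _ _).trans ((add_le_add (hC₁ x h hh) h3).trans ?_)
  have p1 : 0 ≤ C₂ * h ^ 3 := by positivity
  have p2 : 0 ≤ C₁ * (h ^ 2 / n) := by positivity
  nlinarith

theorem exists_slice_opW_le (hf : SmoothDensity f) (hK : Admissible K) :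
    ∃ C, 0 ≤ C ∧ ∀ (n : ℕ) (x h : ℝ), 0 < h →
      |∫ u, opW (pairKernel K n) u * f (x - h * u)| ≤ C * h ^ 2 := by
  obtain ⟨C₁, h1, hC₁⟩ := hf.abs_integral_opW_le hK.limKernel
  obtain ⟨C₂, h2, hC₂⟩ := hf.abs_integral_opW_le hK.conv_self
  refine ⟨C₁ + C₂, by positivity, fun n x h hh => ?_⟩
  have e : ∫ u, opW (pairKernel K n) u * f (x - h * u)
      = (∫ u, opW (limKernel K) u * f (x - h * u))
        - 1 / (n : ℝ) * (1 / 2) * ∫ u, opW (conv K K) u * f (x - h * u) := by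
    rw [← integral_const_mul, ← integral_sub
      (hf.integrable_mul_reflect hK.limKernel.integrable_opW x h)
      ((hf.integrable_mul_reflect hK.conv_self.integrable_opW x h).const_mul _)]
    congr 1 with u
    rw [opW_pairKernel hK]
    ring
  rw [e]
  have hn : 1 / (n : ℝ) * (1 / 2) ≤ 1 := by
    rcases eq_or_ne n 0 with rfl | hn
    · simp
    · have : (1 : ℝ) ≤ n := by exact_mod_cast Nat.one_le_iff_ne_zero.2 hn
      have : 1 / (n : ℝ) ≤ 1 := by rw [div_le_one (by linarith)]; exact this
      linarith
  have h3 : |1 / (n : ℝ) * (1 / 2) * ∫ u, opW (conv K K) u * f (x - h * u)| ≤ C₂ * h ^ 2 := by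
    rw [abs_mul, abs_of_nonneg (by positivity)]
    calc 1 / (n : ℝ) * (1 / 2) * |∫ u, opW (conv K K) u * f (x - h * u)|
        ≤ 1 * (C₂ * h ^ 2) := by
          gcongr
          exact hC₂ x h hh
      _ = _ := by ring
  refine (abs_sub _ _).trans ((add_le_add (hC₁ x h hh) h3).trans (le_of_eq ?_))
  ring

theorem tendsto_integral_dilate (hf : SmoothDensity f) {φ : ℝ → ℝ} (hφ : Integrable φ)
    {h₀ : ℕ → ℝ} (h0 : Tendsto h₀ atTop (𝓝 0)) :
    Tendsto (fun n => ∫ u, φ u * autocorr f f (h₀ n * u)) atTop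
      (𝓝 ((∫ u, φ u) * autocorr f f 0)) := by
  obtain ⟨F, hF⟩ := hf.b0
  have hc := hf.continuous_autocorr
  rw [← integral_mul_const]
  refine tendsto_integral_of_dominated_convergence (fun u => |φ u| * F) (fun n => ?_)
    (hφ.abs.mul_const F) (fun n => ae_of_all _ fun u => ?_) (ae_of_all _ fun u => ?_)
  · exact hφ.aestronglyMeasurable.mul (Continuous.aestronglyMeasurable (by fun_prop))
  · rw [Real.norm_eq_abs, abs_mul]
    exact mul_le_mul_of_nonneg_left (abs_autocorr_le hf.dens hF _) (abs_nonneg _)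
  · have h1 : Tendsto (fun n => h₀ n * u) atTop (𝓝 0) := by simpa using h0.mul_const u
    exact ((hc.tendsto 0).comp h1).const_mul (φ u)

/-- The product is a quadratic polynomial in 1/n whose coefficients are integrable because `opV` is
bounded and `opW` integrable. Only the constant coefficient survives. -/
theorem tendsto_integral_opV_mul_opW (hf : SmoothDensity f) (hK : Admissible K)
    {h₀ : ℕ → ℝ} (h0 : Tendsto h₀ atTop (𝓝 0)) :
    Tendsto (fun n => ∫ u, opV (pairKernel K n) u * opW (pairKernel K n) u
        * autocorr f f (h₀ n * u)) atTop
      (𝓝 ((∫ u, kerV K u * kerW K u) * autocorr f f 0)) := by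
  have e1 : kerV K = opV (limKernel K) := kerV_eq hK
  have e2 : kerW K = opW (limKernel K) := kerW_eq hK
  rw [e1, e2]
  obtain ⟨F, hF⟩ := hf.b0
  have hF' := abs_autocorr_le hf.dens hF
  have hc := hf.continuous_autocorr
  have hprod : ∀ {G G' : ℝ → ℝ}, Admissible G → Admissible G' →
      Integrable fun u => opV G u * opW G' u := fun hG hG' => by
    obtain ⟨C, -, hC⟩ := hG.rapid_opV.bounded
    exact hG'.integrable_opW.bdd_mul hG.rapid_opV.cont.aestronglyMeasurable (ae_of_all _ hC)
  have hbd : ∀ {φ : ℝ → ℝ}, Integrable φ → ∀ h,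
      Integrable fun u => φ u * autocorr f f (h * u) := fun hφ h =>
    hφ.mul_bdd (Continuous.aestronglyMeasurable (by fun_prop)) (ae_of_all _ fun u => hF' _)
  have i1 := hprod hK.limKernel hK.limKernel
  have i2 := (hprod hK.limKernel hK.conv_self).fun_add (hprod hK.conv_self hK.limKernel)
  have i3 := hprod hK.conv_self hK.conv_self
  have hn : Tendsto (fun n : ℕ => 1 / (n : ℝ)) atTop (𝓝 0) := tendsto_one_div_atTop_nhds_zero_nat
  have t := ((tendsto_integral_dilate hf i1 h0).add
    ((hn.mul (tendsto_integral_dilate hf i2 h0)).const_mul (-(1 / 2)))).add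
    (((hn.mul hn).mul (tendsto_integral_dilate hf i3 h0)).const_mul (1 / 4))
  simp only [zero_mul, mul_zero, add_zero] at t
  refine t.congr fun n => ?_
  rw [← integral_const_mul, ← integral_const_mul, ← integral_const_mul, ← integral_const_mul,
    ← integral_add (hbd i1 _) (((hbd i2 _).const_mul _).const_mul _), ← integral_add
    ((hbd i1 _).fun_add (((hbd i2 _).const_mul _).const_mul _))
    (((hbd i3 _).const_mul _).const_mul _)]
  congr 1 with u
  rw [opV_pairKernel hK, opW_pairKernel hK]
  ring

end pairKernel

/-! ### The covariance at the optimal bandwidth and the expansion -/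

section main

variable {Ω : Type*} [MeasurableSpace Ω] {P : Measure Ω} [IsProbabilityMeasure P]
  {X : ℕ → Ω → ℝ} {K f : ℝ → ℝ}

theorem integrable_deriv_CV_mul (hf : SmoothDensity f) (hK : Admissible K)
    (hXm : ∀ i, Measurable (X i)) (hXi : iIndepFun X P) (hXd : ∀ i, P.map (X i) = law f)
    (n : ℕ) {h : ℝ} (hh : 0 < h) :
    Integrable (fun ω => deriv (CV K (sample X n ω)) h *
      deriv (deriv (CV K (sample X n ω))) h) P := by
  have := hf.isProbabilityMeasure_law
  obtain ⟨B, -, hB⟩ := (hK.pairKernel n).rapid_opV.bounded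
  have hVm := (hK.pairKernel n).rapid_opV.cont.measurable
  have hWm := (hK.pairKernel n).measurable_opW
  simp only [fun ω => (hasDerivAt_CV hK (sample X n ω) hh).deriv,
    fun ω => (hasDerivAt_deriv_CV hK (sample X n ω) hh).deriv]
  exact (integral_affine_mul (S := fun x y => opV (pairKernel K n) ((x - y) / h))
    (T := fun x y => opW (pairKernel K n) ((x - y) / h)) hXm hXi hXd (by fun_prop)
    (fun x y => hB _) (by fun_prop)
    (hf.integrable_pair_law hWm (hK.pairKernel n).integrable_opW hh) _ _ _ _).1

/-- Up to its leading term, the covariance of the first two derivatives of the criterion is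
controlled by the projections of the two pair sums. -/
theorem abs_integral_deriv_CV_mul_le (hf : SmoothDensity f) (hK : Admissible K)
    (hXm : ∀ i, Measurable (X i)) (hXi : iIndepFun X P)
    (hXd : ∀ i, P.map (X i) = law f) {n : ℕ} (hn : 2 ≤ n) {h : ℝ} (hh : 0 < h)
    (hfoc : -(conv K K 0 / (n * h ^ 2))
      - (∫ u, u * conv K K u * autocorr (deriv f) f (h * u)) / n
      + ∫ u, u * (conv K K u - 2 * K u) * autocorr (deriv f) f (h * u) = 0)
    {s t : ℝ} (hs : ∀ x, |∫ u, opV (pairKernel K n) u * f (x - h * u)| ≤ s)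
    (ht : ∀ x, |∫ u, opW (pairKernel K n) u * f (x - h * u)| ≤ t) :
    |(n : ℝ) ^ 2 * h ^ 4 * (∫ ω, deriv (CV K (sample X n ω)) h *
        deriv (deriv (CV K (sample X n ω))) h ∂P)
      + 8 * (n / (n - 1)) * ∫ u, opV (pairKernel K n) u * opW (pairKernel K n) u
        * autocorr f f (h * u)| ≤ 64 * (n * h * (s * t)) := by
  have := hf.isProbabilityMeasure_law
  have hp := hK.pairKernel n
  obtain ⟨B, -, hB⟩ := hp.rapid_opV.bounded
  obtain ⟨F, hF⟩ := hf.b0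
  obtain ⟨F₁, hF₁⟩ := hf.b1
  have hVm := hp.rapid_opV.cont.measurable
  have hWm := hp.measurable_opW
  have hn' : (2 : ℝ) ≤ n := by exact_mod_cast hn
  have hn0 : (0 : ℝ) < n := by linarith
  have hn1 : (0 : ℝ) < n - 1 := by linarith
  have hst : 0 ≤ s * t :=
    mul_nonneg ((abs_nonneg _).trans (hs 0)) ((abs_nonneg _).trans (ht 0))
  have hTi := hf.integrable_pair_law hWm hp.integrable_opW hh
  have hSm : Measurable fun z : ℝ × ℝ => opV (pairKernel K n) ((z.1 - z.2) / h) := by fun_prop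
  have hTm : Measurable fun z : ℝ × ℝ => opW (pairKernel K n) ((z.1 - z.2) / h) := by fun_prop
  have hVW : Integrable fun u => opV (pairKernel K n) u * opW (pairKernel K n) u :=
    hp.integrable_opW.bdd_mul hp.rapid_opV.cont.aestronglyMeasurable (ae_of_all _ hB)
  have key := (integral_affine_mul (S := fun x y => opV (pairKernel K n) ((x - y) / h))
    (T := fun x y => opW (pairKernel K n) ((x - y) / h)) hXm hXi hXd (n := n) hSm
    (fun x y => hB _) hTm hTi (-(conv K K 0 / n * (h ^ 2)⁻¹))
    (2 * (conv K K 0 / n * (h ^ 3)⁻¹)) (-(2 / ((n : ℝ) * (n - 1)) * (h ^ 2)⁻¹))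
    (2 / ((n : ℝ) * (n - 1)) * (h ^ 3)⁻¹)).2
  have bound := abs_sum_cov_sub_le (S := fun x y => opV (pairKernel K n) ((x - y) / h))
    (T := fun x y => opW (pairKernel K n) ((x - y) / h)) hXm hXi hXd (n := n) hSm
    (fun x y => hB _)
    (fun x y => by rw [← hp.opV_even, ← neg_div, neg_sub])
    (fun x y => by rw [← hp.opW_even, ← neg_div, neg_sub]) hTm hTi
    (s := h * s) (t := h * t)
    (fun x => by
      rw [hf.integral_slice _ x hh, abs_mul, abs_of_pos hh]
      exact mul_le_mul_of_nonneg_left (hs x) hh.le)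
    (fun x => by
      rw [hf.integral_slice _ x hh, abs_mul, abs_of_pos hh]
      exact mul_le_mul_of_nonneg_left (ht x) hh.le) (by omega)
  have hmean : ∫ z : ℝ × ℝ, opV (pairKernel K n) ((z.1 - z.2) / h) ∂((law f).prod (law f))
      = -(h ^ 2 * ∫ u, u * pairKernel K n u * autocorr (deriv f) f (h * u)) := by
    rw [hf.integral_pair_law hVm hp.rapid_opV.integrable hh,
      hp.integral_opV_mul (q := fun u => autocorr f f (h * u))
        (q' := fun u => h * autocorr (deriv f) f (h * u)) (C := F) (C' := h * F₁)
        (fun u => by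
          have h1 : HasDerivAt (fun u => h * u) h u := hasDerivAt_const_mul h
          exact ((hf.hasDerivAt_r (h * u)).comp u h1).congr_deriv (by ring))
        (fun u => abs_autocorr_le hf.dens hF _)
        (fun u => by
          rw [abs_mul, abs_of_pos hh]
          exact mul_le_mul_of_nonneg_left (abs_autocorr_le hf.dens hF₁ _) hh.le)]
    have e : ∫ u, u * pairKernel K n u * (h * autocorr (deriv f) f (h * u))
        = h * ∫ u, u * pairKernel K n u * autocorr (deriv f) f (h * u) := by
      rw [← integral_const_mul]
      congr 1 with u
      ring
    rw [e]
    ring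
  -- Twice the pair kernel is (A - 2K) - A/n, the combination that appears in M'. So the mean of CV'
  -- is M', and the first-order condition makes it vanish.
  have hsplit : 2 * ∫ u, u * pairKernel K n u * autocorr (deriv f) f (h * u)
      = -((∫ u, u * conv K K u * autocorr (deriv f) f (h * u)) / n)
        + ∫ u, u * (conv K K u - 2 * K u) * autocorr (deriv f) f (h * u) := by
    have hrm : Measurable fun u => autocorr (deriv f) f (h * u) :=
      ((continuous_iff_continuousAt.2 fun u => (hf.hasDerivAt_r1 u).continuousAt).comp
        (continuous_const_mul h)).measurable
    have hrb : ∀ u, |autocorr (deriv f) f (h * u)| ≤ F₁ := fun u => abs_autocorr_le hf.dens hF₁ _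
    have i1 := hK.conv_self.rapid.id_mul.integrable_mul_bdd hrm hrb
    have i2 := (hK.conv_self.rapid.sub (hK.rapid.const_mul 2)).id_mul.integrable_mul_bdd hrm hrb
    rw [← integral_div, ← integral_neg, ← integral_add (i1.div_const _).fun_neg i2,
      ← integral_const_mul]
    congr 1 with u
    rw [pairKernel]
    ring
  have hJ : ∫ z : ℝ × ℝ, opV (pairKernel K n) ((z.1 - z.2) / h)
      * opW (pairKernel K n) ((z.1 - z.2) / h) ∂((law f).prod (law f))
      = h * ∫ u, opV (pairKernel K n) u * opW (pairKernel K n) u * autocorr f f (h * u) :=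
    hf.integral_pair_law (φ := fun u => opV (pairKernel K n) u * opW (pairKernel K n) u)
      (hVm.mul hWm) hVW hh
  have hzero : -(conv K K 0 / n * (h ^ 2)⁻¹) + -(2 / ((n : ℝ) * (n - 1)) * (h ^ 2)⁻¹) *
      ((Finset.univ : Finset (Fin n)).offDiag.card *
        ∫ z : ℝ × ℝ, opV (pairKernel K n) ((z.1 - z.2) / h) ∂((law f).prod (law f))) = 0 := by
    rw [hmean, card_offDiag_fin]
    have e1 : -(2 / ((n : ℝ) * (n - 1)) * (h ^ 2)⁻¹) * ((n : ℝ) * (n - 1) *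
        -(h ^ 2 * ∫ u, u * pairKernel K n u * autocorr (deriv f) f (h * u)))
        = 2 * ∫ u, u * pairKernel K n u * autocorr (deriv f) f (h * u) := by
      field_simp
    rw [div_mul_eq_div_div, div_eq_mul_inv (_ / _) (h ^ 2)] at hfoc
    rw [e1, hsplit]
    linarith
  have hE := key hzero
  simp only [fun ω => (hasDerivAt_CV hK (sample X n ω) hh).deriv,
    fun ω => (hasDerivAt_deriv_CV hK (sample X n ω) hh).deriv]
  simp only [sample]
  rw [hE]
  rw [hJ] at bound
  generalize (∑ p ∈ (Finset.univ : Finset (Fin n)).offDiag, _ : ℝ) = Z at bound ⊢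
  generalize ∫ u, opV (pairKernel K n) u * opW (pairKernel K n) u * autocorr f f (h * u) = I
    at bound ⊢
  have e2 : (n : ℝ) ^ 2 * h ^ 4 * (-(2 / ((n : ℝ) * (n - 1)) * (h ^ 2)⁻¹)
      * (2 / ((n : ℝ) * (n - 1)) * (h ^ 3)⁻¹) * Z) + 8 * (n / (n - 1)) * I
      = -(4 / ((n - 1 : ℝ) ^ 2 * h)) * (Z - 2 * ((n : ℝ) * (n - 1)) * (h * I)) := by
    field_simp
    ring
  rw [e2, abs_mul, abs_neg, abs_of_pos (by positivity)]
  calc 4 / ((n - 1 : ℝ) ^ 2 * h) * |Z - 2 * ((n : ℝ) * (n - 1)) * (h * I)|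
      ≤ 4 / ((n - 1 : ℝ) ^ 2 * h) * (8 * (h * s) * (h * t) * n * ((n : ℝ) * (n - 1))) := by
        gcongr
    _ = 32 * (n / (n - 1)) * (n * h * (s * t)) := by
        field_simp
        ring
    -- Here n/(n-1) ≤ 2, since n ≥ 2.
    _ ≤ 32 * 2 * (n * h * (s * t)) := by
        gcongr
        rw [div_le_iff₀ hn1]
        linarith
    _ = _ := by ring

/-- The error nh(h³ + h²/n)h² equals nh⁶ + h⁵, which tends to 0 because nh⁵ converges and h tends to
0. -/
theorem tendsto_mul_integral_deriv_CV (hf : SmoothDensity f) (hK : Admissible K)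
    (hd : IsDensity K) (hXm : ∀ i, Measurable (X i)) (hXi : iIndepFun X P)
    (hXd : ∀ i, P.map (X i) = law f) {h₀ : ℕ → ℝ}
    (hmin : ∀ᶠ n in atTop, IsOptimalBandwidth (risk (conv K K 0)
      (fun h => ∫ u, conv K K u * autocorr f f (h * u))
      (fun h => (∫ u, (conv K K u - 2 * K u) * autocorr f f (h * u)) + autocorr f f 0) n) (h₀ n)) :
    Tendsto (fun n : ℕ => (n : ℝ) ^ 2 * h₀ n ^ 4 *
        ∫ ω, deriv (CV K (sample X n ω)) (h₀ n) * deriv (deriv (CV K (sample X n ω))) (h₀ n) ∂P)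
      atTop (𝓝 (-(8 * ((∫ u, kerV K u * kerW K u) * autocorr f f 0)))) := by
  have H := riskProfile hf hK hd
  have h0 : Tendsto h₀ atTop (𝓝 0) := (H.tendsto_min hmin).mono_right nhdsWithin_le_nhds
  have h5 := H.tendsto_mul_pow_five hmin
  obtain ⟨C₁, hC₁0, hC₁⟩ := exists_slice_opV_le hf hK hd
  obtain ⟨C₂, hC₂0, hC₂⟩ := exists_slice_opW_le hf hK
  have hI := tendsto_integral_opV_mul_opW hf hK h0
  have hq : Tendsto (fun n : ℕ => (n : ℝ) / (n - 1)) atTop (𝓝 1) := by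
    have h1 : Tendsto (fun n : ℕ => 1 / (1 - 1 / (n : ℝ))) atTop (𝓝 (1 / (1 - 0))) :=
      (tendsto_const_nhds (x := (1 : ℝ))).div
        ((tendsto_one_div_atTop_nhds_zero_nat (𝕜 := ℝ)).const_sub 1) (by norm_num)
    rw [sub_zero, div_one] at h1
    refine h1.congr' ?_
    filter_upwards [eventually_ge_atTop 2] with n hn
    have : (2 : ℝ) ≤ n := by exact_mod_cast hn
    have h2 : (n : ℝ) ≠ 0 := by linarith
    field_simp
  have hmain := ((hq.mul hI).const_mul 8).neg
  rw [one_mul] at hmain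
  have herr : Tendsto (fun n : ℕ => 64 * (n * h₀ n *
      ((C₁ * (h₀ n ^ 3 + h₀ n ^ 2 / n)) * (C₂ * h₀ n ^ 2)))) atTop (𝓝 0) := by
    have h6 := (((h5.mul h0).add (h0.pow 5)).const_mul (64 * C₁ * C₂))
    simp only [ne_eq, OfNat.ofNat_ne_zero, not_false_eq_true, zero_pow, mul_zero, add_zero] at h6
    refine h6.congr' ?_
    filter_upwards [eventually_ge_atTop 1] with n hn
    have h2 : (n : ℝ) ≠ 0 := by exact_mod_cast (by omega : n ≠ 0)
    field_simp
  have hdiff := squeeze_zero_norm' (f := fun n : ℕ => (n : ℝ) ^ 2 * h₀ n ^ 4 *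
        (∫ ω, deriv (CV K (sample X n ω)) (h₀ n) *
          deriv (deriv (CV K (sample X n ω))) (h₀ n) ∂P)
        + 8 * (n / (n - 1)) * ∫ u, opV (pairKernel K n) u * opW (pairKernel K n) u
          * autocorr f f (h₀ n * u)) (t₀ := atTop) (by
    filter_upwards [hmin, eventually_ge_atTop 2] with n hn hn2
    exact abs_integral_deriv_CV_mul_le hf hK hXm hXi hXd hn2 hn.1 (H.deriv_eq_zero hn)
      (fun x => hC₁ n x _ hn.1) (fun x => hC₂ n x _ hn.1)) herr
  have hsum := hdiff.add hmain
  rw [zero_add] at hsum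
  refine hsum.congr fun n => ?_
  ring

theorem isOptimalBandwidth_MISE_iff (hf : SmoothDensity f) (hK : Admissible K)
    (hd : IsDensity K) (hXm : ∀ i, Measurable (X i)) (hXi : iIndepFun X P)
    (hXd : ∀ i, P.map (X i) = law f) {n : ℕ} (hn : 1 ≤ n) {h : ℝ} :
    IsOptimalBandwidth (MISE P X K f n) h ↔ IsOptimalBandwidth (risk (conv K K 0)
      (fun h => ∫ u, conv K K u * autocorr f f (h * u))
      (fun h => (∫ u, (conv K K u - 2 * K u) * autocorr f f (h * u)) + autocorr f f 0) n) h := by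
  have e := fun {h : ℝ} (hh : 0 < h) => MISE_eq_risk hf hK hd hXm hXi hXd hn hh
  refine and_congr_right fun hh => ?_
  simp only [isMinOn_iff, Set.mem_Ioi]
  exact forall₂_congr fun y hy => by rw [e hy, e hh]

theorem hasDerivAt_MISE (hf : SmoothDensity f) (hK : Admissible K)
    (hd : IsDensity K) (hXm : ∀ i, Measurable (X i)) (hXi : iIndepFun X P)
    (hXd : ∀ i, P.map (X i) = law f) {n : ℕ} (hn : 1 ≤ n) {h : ℝ} (hh : 0 < h) :
    HasDerivAt (MISE P X K f n) (-(conv K K 0 / (n * h ^ 2))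
      - (∫ u, u * conv K K u * autocorr (deriv f) f (h * u)) / n
      + ∫ u, u * (conv K K u - 2 * K u) * autocorr (deriv f) f (h * u)) h :=
  ((riskProfile hf hK hd).hasDerivAt_risk n hh.ne').congr_of_eventuallyEq (by
    filter_upwards [Ioi_mem_nhds hh] with y hy
    exact MISE_eq_risk hf hK hd hXm hXi hXd hn hy)

theorem hasDerivAt_deriv_MISE (hf : SmoothDensity f) (hK : Admissible K)
    (hd : IsDensity K) (hXm : ∀ i, Measurable (X i)) (hXi : iIndepFun X P)
    (hXd : ∀ i, P.map (X i) = law f) {n : ℕ} (hn : 1 ≤ n) {h : ℝ} (hh : 0 < h) :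
    HasDerivAt (deriv (MISE P X K f n)) (2 * conv K K 0 / (n * h ^ 3)
      - (∫ u, u ^ 2 * conv K K u * autocorr (deriv (deriv f)) f (h * u)) / n
      + ∫ u, u ^ 2 * (conv K K u - 2 * K u) * autocorr (deriv (deriv f)) f (h * u)) h :=
  ((riskProfile hf hK hd).hasDerivAt_risk' n hh.ne').congr_of_eventuallyEq (by
    filter_upwards [Ioi_mem_nhds hh] with y hy
    exact (hasDerivAt_MISE hf hK hd hXm hXi hXd hn hy).deriv)

theorem BStar_pos (hf : SmoothDensity f) (hK : Admissible K) (hd : IsDensity K) :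
    0 < BStar K f := by
  obtain ⟨C, -, hC⟩ := hK.rapid.bounded
  obtain ⟨F, hF⟩ := hf.b0
  have h1 := integral_kerV_mul_kerW_pos hK hd
  have h2 := hf.dens.integral_sq_pos hf.d0.continuous hF
  have h3 := hd.integral_sq_pos hK.diff.continuous hC
  have h4 := hK.second_moment_pos hd
  have h5 := hf.sq_deriv_pos
  unfold BStar
  positivity

/-- With A(0) = ∫K², the power 2 from M''² and the power 2/5 from nh⁵ combine to the exponent 8/5,
and 8/5² is the numerical factor. -/
theorem BStar_eq (hf : SmoothDensity f) (hK : Admissible K) (hd : IsDensity K) :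
    -(8 * ((∫ u, kerV K u * kerW K u) * autocorr f f 0)) / (5 * conv K K 0) ^ 2
      * (conv K K 0 / ((∫ u, u ^ 2 * K u) ^ 2 * ∫ x, deriv (deriv f) x ^ 2)) ^ (2 / 5 : ℝ)
      = -BStar K f := by
  have H := riskProfile hf hK hd
  have hA := H.A₀_pos
  have hβ := H.β_pos
  have hr : autocorr f f 0 = ∫ x, f x ^ 2 := by simp [autocorr, sq]
  rw [BStar, ← hr, ← hK.conv_self_zero, Real.div_rpow hA.le hβ.le]
  have e : conv K K 0 ^ (8 / 5 : ℝ) = conv K K 0 ^ 2 / conv K K 0 ^ (2 / 5 : ℝ) := by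
    rw [← Real.rpow_natCast, ← Real.rpow_sub hA]
    norm_num
  rw [e]
  have h1 := Real.rpow_pos_of_pos hA (2 / 5)
  have h2 := Real.rpow_pos_of_pos hβ (2 / 5)
  field_simp
  norm_num

/-- The quotient of n²h⁴ E[CV'CV''] by (nh³M'')² is E[CV'CV'']/(h²M''²). The factor h⁻² is cancelled
by (nh⁵)^(2/5) = n^(2/5)h², so no separate asymptotics for h are needed. -/
theorem isLittleO_deriv_CV (hf : SmoothDensity f) (hK : Admissible K)
    (hd : IsDensity K) (hXm : ∀ i, Measurable (X i)) (hXi : iIndepFun X P)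
    (hXd : ∀ i, P.map (X i) = law f) {h₀ : ℕ → ℝ}
    (hmin : ∀ᶠ n in atTop, IsOptimalBandwidth (MISE P X K f n) (h₀ n)) :
    (fun n : ℕ =>
        (∫ ω, deriv (CV K (sample X n ω)) (h₀ n) *
            deriv (deriv (CV K (sample X n ω))) (h₀ n) ∂P) /
          deriv (deriv (MISE P X K f n)) (h₀ n) ^ 2
        - (-BStar K f * (n : ℝ) ^ (-(2 / 5) : ℝ)))
      =o[atTop] fun n : ℕ => (n : ℝ) ^ (-(2 / 5) : ℝ) := by
  have H := riskProfile hf hK hd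
  have hmin' : ∀ᶠ n in atTop, IsOptimalBandwidth (risk (conv K K 0)
      (fun h => ∫ u, conv K K u * autocorr f f (h * u))
      (fun h => (∫ u, (conv K K u - 2 * K u) * autocorr f f (h * u)) + autocorr f f 0) n)
      (h₀ n) := by
    filter_upwards [hmin, eventually_ge_atTop 1] with n h1 h2
    exact (isOptimalBandwidth_MISE_iff hf hK hd hXm hXi hXd h2).1 h1
  have hN := tendsto_mul_integral_deriv_CV hf hK hd hXm hXi hXd hmin'
  have hD := H.tendsto_deriv2 hmin'
  have h5 := (H.tendsto_mul_pow_five hmin').rpow_const (p := 2 / 5)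
    (Or.inl (div_pos H.A₀_pos H.β_pos).ne')
  have hA0 : (5 * conv K K 0) ^ 2 ≠ 0 := by
    have := H.A₀_pos
    positivity
  have hlim := (hN.div (hD.pow 2) hA0).mul h5
  rw [BStar_eq hf hK hd] at hlim
  rw [isLittleO_iff_tendsto' (by
    filter_upwards [eventually_ge_atTop 1] with n hn h1
    have : (0 : ℝ) < n := by exact_mod_cast hn
    exact absurd h1 (Real.rpow_pos_of_pos this _).ne')]
  have hlim' := hlim.sub_const (-BStar K f)
  rw [sub_self] at hlim'
  refine hlim'.congr' ?_
  filter_upwards [hmin', eventually_ge_atTop 1, hD.eventually_ne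
    (mul_pos (by norm_num : (0 : ℝ) < 5) H.A₀_pos).ne'] with n h1 hn hne
  have hn0 : (0 : ℝ) < n := by exact_mod_cast hn
  have hh := h1.1
  have hnp := Real.rpow_pos_of_pos hn0 (-(2 / 5))
  rw [(hasDerivAt_deriv_MISE hf hK hd hXm hXi hXd hn hh).deriv]
  rw [sub_div, mul_div_cancel_right₀ _ hnp.ne']
  congr 1
  have e1 : ((n : ℝ) * h₀ n ^ 5) ^ (2 / 5 : ℝ) = (n : ℝ) ^ (2 / 5 : ℝ) * h₀ n ^ 2 := by
    rw [Real.mul_rpow hn0.le (by positivity), ← Real.rpow_natCast (h₀ n) 5, ← Real.rpow_mul hh.le]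
    norm_num
  have e2 : (n : ℝ) ^ (-(2 / 5) : ℝ) = ((n : ℝ) ^ (2 / 5 : ℝ))⁻¹ := Real.rpow_neg hn0.le _
  have hM := right_ne_zero_of_mul hne
  simp only [Pi.div_apply]
  rw [e1, e2]
  generalize (2 * conv K K 0 / (n * h₀ n ^ 3) - _ + _ : ℝ) = M at hM ⊢
  have hq := Real.rpow_pos_of_pos hn0 (2 / 5)
  field_simp

end main

end KernelCV

theorem theorem1
    {Ω : Type*} [MeasurableSpace Ω] (P : Measure Ω) [IsProbabilityMeasure P]
    (K f : ℝ → ℝ) (X : ℕ → Ω → ℝ)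
    -- the kernel: a density symmetric about 0, twice differentiable, with the decay condition
    (hK : IsDensity K) (hKsymm : ∀ u, K (-u) = K u)
    (hKd : Differentiable ℝ K) (hKdd : Differentiable ℝ (deriv K))
    (a₁ a₂ : ℝ) (ha₁ : 0 < a₁) (ha₂ : 0 < a₂)
    (hKdecay : K =o[atTop] fun u : ℝ => Real.exp (-a₁ * u ^ a₂))
    (hKdecay' : deriv K =o[atTop] fun u : ℝ => Real.exp (-a₁ * u ^ a₂))
    (hKint : Integrable fun u : ℝ => u ^ 2 * deriv (deriv K) u)
    -- the density: three bounded continuous derivatives, square integrable second derivative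
    (hf : IsDensity f) (hfC : ContDiff ℝ 3 f)
    (hfb : ∀ k : ℕ, 1 ≤ k → k ≤ 3 → ∃ C : ℝ, ∀ x, |iteratedDeriv k f x| ≤ C)
    (hfint : Integrable fun x => deriv (deriv f) x ^ 2)
    -- a random sample from the density
    (hXm : ∀ i, Measurable (X i)) (hXi : iIndepFun X P)
    (hXd : ∀ i, P.map (X i) = volume.withDensity fun x => ENNReal.ofReal (f x)) :
    -- the derivatives and the expectation that occur in the claim exist
    (∀ (n : ℕ) (x : Fin n → ℝ) (h : ℝ), 0 < h →
      DifferentiableAt ℝ (CV K x) h ∧ DifferentiableAt ℝ (deriv (CV K x)) h) ∧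
    (∀ (n : ℕ) (h : ℝ), 0 < h →
      DifferentiableAt ℝ (MISE P X K f n) h ∧ DifferentiableAt ℝ (deriv (MISE P X K f n)) h) ∧
    (∀ (n : ℕ) (h : ℝ), 0 < h →
      Integrable (fun ω => deriv (CV K (sample X n ω)) h *
        deriv (deriv (CV K (sample X n ω))) h) P) ∧
    -- the optimal bandwidth exists for all large sample sizes
    (∀ᶠ n : ℕ in atTop, ∃ h, IsOptimalBandwidth (MISE P X K f n) h) ∧
    -- the constant is positive, and the expansion holds
    0 < BStar K f ∧
    ∀ h₀ : ℕ → ℝ, (∀ᶠ n in atTop, IsOptimalBandwidth (MISE P X K f n) (h₀ n)) →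
      (fun n : ℕ =>
          (∫ ω, deriv (CV K (sample X n ω)) (h₀ n) *
              deriv (deriv (CV K (sample X n ω))) (h₀ n) ∂P) /
            deriv (deriv (MISE P X K f n)) (h₀ n) ^ 2
          - (-BStar K f * (n : ℝ) ^ (-(2 / 5) : ℝ)))
        =o[atTop] fun n : ℕ => (n : ℝ) ^ (-(2 / 5) : ℝ) := by
  have hKA := admissible_of_isLittleO hKsymm hKd hKdd ha₁ ha₂ hKdecay hKdecay' hKint
  have hfS := SmoothDensity.of_contDiff hf hfC hfb hfint
  have hXl : ∀ i, P.map (X i) = law f := hXd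
  refine ⟨fun n x h hh => ⟨(hasDerivAt_CV hKA x hh).differentiableAt,
      (hasDerivAt_deriv_CV hKA x hh).differentiableAt⟩, fun n h hh => ?_,
    fun n h hh => integrable_deriv_CV_mul hfS hKA hXm hXi hXl n hh, ?_, BStar_pos hfS hKA hK,
    fun h₀ hmin => isLittleO_deriv_CV hfS hKA hK hXm hXi hXl hmin⟩
  · rcases Nat.eq_zero_or_pos n with rfl | hn
    -- For the empty sample the estimate is zero, so the risk does not depend on h.
    · have e : MISE P X K f 0 = fun _ => ∫ t, f t ^ 2 := funext fun h => MISE_zero h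
      rw [e]
      simp
    · exact ⟨(hasDerivAt_MISE hfS hKA hK hXm hXi hXl hn hh).differentiableAt,
        (hasDerivAt_deriv_MISE hfS hKA hK hXm hXi hXl hn hh).differentiableAt⟩
  · filter_upwards [(riskProfile hfS hKA hK).eventually_exists_min, eventually_ge_atTop 1]
      with n ⟨h, hh⟩ hn
    exact ⟨h, (isOptimalBandwidth_MISE_iff hfS hKA hK hXm hXi hXl hn).2 hh⟩
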